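/- Let $\mathbb F_q$ be a finite field, $\psi$ a complex additive character of $\mathbb F_q$, and $a\in M_n(\mathbb F_q)$ a matrix whose only eigenvalue in $\overline{\mathbb F_q}$ is $\alpha\in\mathbb F_q$, $\alpha\neq 0$. Put $V_j=\ker\big((a-\alpha)^j\big)\subseteq\mathbb F_q^n$ and $\mu_j=\dim(V_j/V_{j-1})$ for $j\ge 1$, so that $\mu_1$ is the dimension of the eigenspace of $\alpha$. For $m\ge 1$ let $$K^\mu(\mathbb F_{q^m})=\sum_{x\in \mathrm{GL}_n(\mathbb F_{q^m})}\psi\big(\mathrm{Tr}_{\mathbb F_{q^m}|\mathbb F_q}(\operatorname{tr}(ax+x^{-1}))\big).$$ The Frobenius eigenvalues of $K^\mu$ are the nonzero complex numbers $z$ that occur with nonzero (integer, possibly negative) multiplicity $c(z)$ in the finite expansion $$K^\mu(\mathbb F_{q^m})=\sum_{z}c(z)\,z^m\qquad(m\ge 1),$$ which is unique; equivalently, they are the reciprocal zeros and poles of the $L$-function $\exp\big(\sum_{m\ge1}K^\mu(\mathbb F_{q^m})T^m/m\big)$. An eigenvalue $z$ has weight $w$, where $w\ge 0$ is an integer, if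 $|z|=q^{w/2}$. If $\mu_1>1$, then such an expansion exists and $K^\mu$ has Frobenius eigenvalues of at least two different weights. -/

import Mathlib

/-- The matrix Kloosterman sum over a finite extension `E` of the finite field `F`:
`K(a, E) = ∑_{x ∈ GL_n(E)} ψ(Tr_{E/F}(tr(a x + x⁻¹)))`.
(`GL_n(E)` is finite, so the `finsum` is the ordinary sum over all its elements.) -/
noncomputable def matrixKloostermanSum {F : Type*} [Field F] {n : ℕ} (ψ : AddChar F ℂ)
    (a : Matrix (Fin n) (Fin n) F) (E : Type*) [Field E] [Algebra F E] : ℂ :=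
  ∑ᶠ x : GL (Fin n) E,
    ψ (Algebra.trace F E
      (Matrix.trace (a.map (algebraMap F E) * (x : Matrix (Fin n) (Fin n) E)
        + ((x⁻¹ : GL (Fin n) E) : Matrix (Fin n) (Fin n) E))))

/-- `c` is the multiset, with signed multiplicities, of Frobenius eigenvalues of the family of
sums `K(a, E)`: `K(a, 𝔽_{q^m}) = ∑_z c(z) z^m` for all finite extensions `𝔽_{q^m}` of `F` inside
the algebraic closure. Equivalently, the `L`-function `exp (∑ K(a, 𝔽_{q^m}) T^m / m)` is
`∏_z (1 - z T) ^ (-c(z))`. Such a `c` is unique. -/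
def IsFrobeniusDivisor {F : Type*} [Field F] {n : ℕ} (ψ : AddChar F ℂ)
    (a : Matrix (Fin n) (Fin n) F) (c : ℂ →₀ ℤ) : Prop :=
  c 0 = 0 ∧
    ∀ E : IntermediateField F (AlgebraicClosure F), FiniteDimensional F E →
      matrixKloostermanSum ψ a E = c.sum fun z k => (k : ℂ) * z ^ Module.finrank F E

/-- `z` is a Frobenius eigenvalue of the matrix Kloosterman sum attached to `a`: it occurs
with nonzero total multiplicity. -/
def IsFrobeniusEigenvalue {F : Type*} [Field F] {n : ℕ} (ψ : AddChar F ℂ)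
    (a : Matrix (Fin n) (Fin n) F) (z : ℂ) : Prop :=
  ∃ c : ℂ →₀ ℤ, IsFrobeniusDivisor ψ a c ∧ c z ≠ 0

/-- `z` has weight `w` relative to `q`: `|z| = q^{w/2}`. -/
def HasWeight (q : ℕ) (z : ℂ) (w : ℕ) : Prop :=
  ‖z‖ = (q : ℝ) ^ ((w : ℝ) / 2)

/-- `α` is the only eigenvalue of `a` in the algebraic closure of the base field. -/
def HasUniqueEigenvalue {F : Type*} [Field F] {n : ℕ} (a : Matrix (Fin n) (Fin n) F) (α : F) :
    Prop :=
  ∀ β : AlgebraicClosure F,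
    Module.End.HasEigenvalue
      (Matrix.toLin' (a.map (algebraMap F (AlgebraicClosure F)))) β ↔
      β = algebraMap F (AlgebraicClosure F) α

/-- The filtration `V_j = ker ((a - α)^j)` of `V = F^n`. -/
def kerFiltration {F : Type*} [Field F] {n : ℕ} (a : Matrix (Fin n) (Fin n) F) (α : F) (j : ℕ) :
    Submodule F (Fin n → F) :=
  LinearMap.ker ((Matrix.toLin' a - α • (1 : Module.End F (Fin n → F))) ^ j)

/-- The parts `μ_j = dim (V_j / V_{j-1})`, `j ≥ 1`, of the partition `μ` attached to `a`
and `α`. -/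
noncomputable def muPart {F : Type*} [Field F] {n : ℕ} (a : Matrix (Fin n) (Fin n) F) (α : F)
    (j : ℕ) : ℕ :=
  Module.finrank F
    (kerFiltration a α j ⧸ (kerFiltration a α (j - 1)).submoduleOf (kerFiltration a α j))

/-- A finite field has an extension of every positive degree in its algebraic closure. -/
theorem exists_intermediateField_finrank {F : Type*} [Field F] [Finite F] (m : ℕ) (hm : m ≠ 0) :
    ∃ E : IntermediateField F (AlgebraicClosure F),
      FiniteDimensional F E ∧ Module.finrank F E = m := by
  obtain ⟨p, hp⟩ := CharP.exists F
  have : Fact p.Prime := ⟨CharP.char_is_prime F p⟩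
  have : NeZero m := ⟨hm⟩
  let f : FiniteField.Extension F p m →ₐ[F] AlgebraicClosure F := IsAlgClosed.lift
  let e := (AlgEquiv.ofInjectiveField f).toLinearEquiv
  refine ⟨f.fieldRange, Module.Finite.equiv e, ?_⟩
  exact (LinearEquiv.finrank_eq e).symm.trans (FiniteField.finrank_extension F p m)

/-- The Frobenius eigenvalues and their multiplicities are determined by the sums. -/
theorem IsFrobeniusDivisor.unique {F : Type*} [Field F] [Finite F] {n : ℕ} {ψ : AddChar F ℂ}
    {a : Matrix (Fin n) (Fin n) F} {c d : ℂ →₀ ℤ}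
    (hc : IsFrobeniusDivisor ψ a c) (hd : IsFrobeniusDivisor ψ a d) : c = d := by
  classical
  have key : ∀ m : ℕ, (c - d).sum (fun z k => (k : ℂ) * z ^ (m + 1)) = 0 := by
    intro m
    obtain ⟨E, hE, hm⟩ := exists_intermediateField_finrank (F := F) (m + 1) (by omega)
    have h := (hc.2 E hE).symm.trans (hd.2 E hE)
    rw [hm] at h
    rw [Finsupp.sum_sub_index (by intros; push_cast; ring), h, sub_self]
  have h0 : (c - d) 0 = 0 := by simp [hc.1, hd.1]
  have hli := linearIndependent_monoidHom (Multiplicative ℕ) ℂ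
  have hli' := hli.comp (fun z : ℂ => powersHom ℂ z) (powersHom ℂ).injective
  rw [linearIndependent_iff'] at hli'
  have hz := hli' (c - d).support (fun z => ((c - d) z : ℂ) * z) (by
    ext x
    have := key x.toAdd
    simp only [Finsupp.sum] at this
    simp only [Finset.sum_apply, Pi.smul_apply, Function.comp_apply, powersHom_apply,
      smul_eq_mul, Pi.zero_apply]
    rw [← this]
    refine Finset.sum_congr rfl fun z _ => ?_
    rw [pow_succ]; ring)
  rw [← sub_eq_zero]
  ext z
  by_contra hne
  have hne' : (c - d) z ≠ 0 := hne
  have h1 := hz z (Finsupp.mem_support_iff.2 hne')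
  rcases mul_eq_zero.1 h1 with h2 | h2
  · exact hne' (by exact_mod_cast h2)
  · subst h2; exact hne' h0

/-!
For `N = a - α` nilpotent on a space `V` over an extension of `F` with `Q` elements, the matrix
Kloosterman sum is the sum `glSum` of `ψ (tr y + tr (y⁻¹ a))` over `y ∈ GL(V)`. Averaging over the
transvections along an eigenvector `e` of `a` leaves only the `y` that stabilize the line `⟨e⟩` or
the plane `⟨e, α y⁻¹ e⟩`, and these contribute sums attached to quotients of `V`
(`glSum_recursion`). If `e` is taken in the last nonzero power `im N ^ (k - 1)`, then almost all
the planes cancel, and the sum, which depends only on the ranks `r` of the powers of `N`,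
satisfies with `b = r (k - 1)` and `n = dim V`

  `K(r) = Q ^ (n - 1) K₁ K(r') + Q ^ (2 n - 3) ((Q ^ b - Q) K(r'') - Q ^ b K(r'''))`

(`glSum_rank_recursion`). Here `K₁` is the classical Kloosterman sum, `r'` and `r''` arise by
removing one box and two boxes from Jordan blocks of size `k`, and `r'''` by removing a box from a
block of size `k` and one from a block of size `k - 1`, the last term being absent for `k = 1`.

The classical sum over the extension of degree `m` is `-(u ^ m + v ^ m)` with `u v = q`, because
its `L`-function is a quadratic polynomial (`eulerSum_eq_neg_powerSum`), and `‖u‖ = ‖v‖ = √q`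
(`exists_weil_numbers`). The latter is proved by Bombieri's version of Stepanov's method on the
curves `y ^ q - y = x + α / x - c`, which bounds the number of solutions of `Tr (x + α / x) = c`
(`exists_auxiliary_polynomial`, `card_mul_card_trace_eq_le`).

Hence the sums over the extensions of `F` are the values `(-1) ^ n q ^ (m n (n - 1) / 2) H(m)`,
where `H = ∑ c(z) [z]` is an element of the group ring `ℤ[ℂˣ]` and `H(m) = ∑ c(z) z ^ m`. The
recursion shows that `H` is the sum of the complete homogeneous polynomial `h_n([u], [v])`, of
weight `n`, of `[q] ^ 2 h_{n-2}([u], [v])`, of weight `n + 2`, if `N` has at least two Jordan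
blocks, and of terms of weight at least `n + 4` (`exists_computesGLSum`). There is no cancellation
in the two lowest weights since these polynomials have nonnegative coefficients
(`exists_coeff_ne_zero`), so that both `n ^ 2` and `n ^ 2 + 2` are weights of Frobenius
eigenvalues. For trivial `ψ` the sum is `|GL_n| = ∏ (Q ^ n - Q ^ i)`, which is not a monomial in
`Q` (`exists_coeff_cardGLPolynomial_ne_zero`).
-/

/-! ### Sums over the general linear group of a vector space -/

section GLSums

open LinearMap Module

variable {E : Type*} [Field E] {V V' C W : Type*} [AddCommGroup V] [Module E V]
  [AddCommGroup V'] [Module E V'] [AddCommGroup C] [Module E C] [AddCommGroup W] [Module E W]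

theorem finite_linearMap [Finite V] [Finite V'] : Finite (V →ₗ[E] V') := DFunLike.finite _

theorem finite_linearEquiv [Finite V] [Finite V'] : Finite (V ≃ₗ[E] V') := DFunLike.finite _

/-- The summand `ψ (tr y + tr (y⁻¹ a))` of the Kloosterman sum over `GL(V)`. The substitution
`y = x⁻¹` turns it into `ψ (tr (a x) + tr x⁻¹)`. -/
noncomputable def glWeight (ψ : AddChar E ℂ) (a : V →ₗ[E] V) (y : V ≃ₗ[E] V) : ℂ :=
  ψ (trace E V (y : V →ₗ[E] V) + trace E V ((y.symm : V →ₗ[E] V) ∘ₗ a))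

/-- The Kloosterman sum `∑_y ψ (tr y + tr (y⁻¹ a))` over `GL(V)`. -/
noncomputable def glSum (ψ : AddChar E ℂ) (a : V →ₗ[E] V) : ℂ :=
  ∑ᶠ y : V ≃ₗ[E] V, glWeight ψ a y

theorem glSum_conj (ψ : AddChar E ℂ) (a : V →ₗ[E] V) (φ : V ≃ₗ[E] V') :
    glSum ψ (φ.conj a) = glSum ψ a := by
  symm
  refine finsum_eq_of_bijective (fun y => φ.symm ≪≫ₗ y ≪≫ₗ φ) ⟨fun y z h => ?_, fun z =>
    ⟨φ ≪≫ₗ z ≪≫ₗ φ.symm, by ext; simp⟩⟩ fun y => ?_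
  · ext v
    simpa using LinearEquiv.congr_fun h (φ v)
  · unfold glWeight
    have h1 : ((φ.symm ≪≫ₗ y ≪≫ₗ φ : V' ≃ₗ[E] V') : V' →ₗ[E] V') = φ.conj y := by
      ext; simp
    have h2 : ((φ.symm ≪≫ₗ y ≪≫ₗ φ).symm : V' →ₗ[E] V') ∘ₗ φ.conj a =
        φ.conj ((y.symm : V →ₗ[E] V) ∘ₗ a) := by
      ext; simp
    rw [h1, h2, trace_conj', trace_conj']

theorem trace_eq_trace_add_trace_of_prod [FiniteDimensional E C] [FiniteDimensional E W]
    (f : C × W →ₗ[E] C × W) :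
    trace E (C × W) f =
      trace E C (fst E C W ∘ₗ f ∘ₗ inl E C W) + trace E W (snd E C W ∘ₗ f ∘ₗ inr E C W) := by
  rw [trace_comp_comm' (f ∘ₗ inl E C W) (fst E C W), trace_comp_comm' (f ∘ₗ inr E C W) (snd E C W),
    ← map_add]
  congr 1
  ext x <;> simp [← Prod.zero_eq_mk]

/-- Orthogonality on `Hom(C, W)`: the trace pairing with `Hom(W, C)` is nondegenerate. -/
theorem sum_addChar_trace_comp [FiniteDimensional E W] [Fintype (C →ₗ[E] W)]
    [FiniteDimensional E C]
    {ψ : AddChar E ℂ} (hψ : ψ ≠ 1) (A : W ≃ₗ[E] W) (D : C ≃ₗ[E] C) (g : W →ₗ[E] C)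
    [Decidable (g = 0)] :
    ∑ B : C →ₗ[E] W, ψ (trace E W ((A : W →ₗ[E] W) ∘ₗ B ∘ₗ (D : C →ₗ[E] C) ∘ₗ g)) =
      if g = 0 then (Fintype.card (C →ₗ[E] W) : ℂ) else 0 := by
  split_ifs with hg
  · simp [hg]
  · let L : (C →ₗ[E] W) →+ E :=
      { toFun := fun B => trace E W ((A : W →ₗ[E] W) ∘ₗ B ∘ₗ (D : C →ₗ[E] C) ∘ₗ g)
        map_zero' := by simp
        map_add' := fun B B' => by rw [LinearMap.add_comp, LinearMap.comp_add, map_add] }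
    have := AddChar.sum_eq_zero_of_ne_one (ψ := ψ.compAddMonoidHom L) ?_
    · exact this
    · obtain ⟨w, hw⟩ : ∃ w, g w ≠ 0 := by
        by_contra! h
        exact hg (LinearMap.ext h)
      obtain ⟨t, ht⟩ : ∃ t, ψ t ≠ 1 := by
        by_contra! h
        exact hψ (by ext t; simpa using h t)
      obtain ⟨φ, hφ, -⟩ := Submodule.exists_le_ker_of_notMem (p := (⊥ : Submodule E C))
        (v := D (g w)) (by simpa using hw)
      refine fun h => ht ?_
      have h1 : L (φ.smulRight ((t / φ (D (g w))) • A.symm w)) = t := by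
        have : (A : W →ₗ[E] W) ∘ₗ (φ.smulRight ((t / φ (D (g w))) • A.symm w)) ∘ₗ
            (D : C →ₗ[E] C) ∘ₗ g = (φ ∘ₗ (D : C →ₗ[E] C) ∘ₗ g).smulRight
              ((t / φ (D (g w))) • w) := by
          ext v
          simp
        change trace E W _ = t
        rw [this, trace_smulRight]
        simp [hφ]
      have h2 := DFunLike.congr_fun h (φ.smulRight ((t / φ (D (g w))) • A.symm w))
      rw [AddChar.compAddMonoidHom_apply, h1] at h2
      simpa using h2

theorem trace_skewProd [FiniteDimensional E C] [FiniteDimensional E W] (A : W ≃ₗ[E] W)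
    (D : C ≃ₗ[E] C) (B : C →ₗ[E] W) :
    trace E (C × W) (D.skewProd A B : (C × W) →ₗ[E] (C × W)) =
      trace E C (D : C →ₗ[E] C) + trace E W (A : W →ₗ[E] W) := by
  rw [trace_eq_trace_add_trace_of_prod]
  congr 2
  ext; simp

theorem trace_skewProd_symm_comp [FiniteDimensional E C] [FiniteDimensional E W] (A : W ≃ₗ[E] W)
    (D : C ≃ₗ[E] C) (B : C →ₗ[E] W) (a : C × W →ₗ[E] C × W) :
    trace E (C × W) (((D.skewProd A B).symm : (C × W) →ₗ[E] (C × W)) ∘ₗ a) =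
      trace E C ((D.symm : C →ₗ[E] C) ∘ₗ (fst E C W ∘ₗ a ∘ₗ inl E C W)) +
      trace E W ((A.symm : W →ₗ[E] W) ∘ₗ (snd E C W ∘ₗ a ∘ₗ inr E C W)) -
      trace E W ((A.symm : W →ₗ[E] W) ∘ₗ B ∘ₗ (D.symm : C →ₗ[E] C) ∘ₗ
        (fst E C W ∘ₗ a ∘ₗ inr E C W)) := by
  rw [trace_eq_trace_add_trace_of_prod, add_sub_assoc, ← map_sub]
  congr 2
  ext; simp

/-- The automorphisms of `C × W` that restrict to `A` on `W` are the block triangular ones. -/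
theorem bijective_skewProd [FiniteDimensional E C] (A : W ≃ₗ[E] W) :
    Function.Bijective (fun x : (C ≃ₗ[E] C) × (C →ₗ[E] W) =>
      (⟨x.1.skewProd A x.2, by simp⟩ :
        {y : (C × W) ≃ₗ[E] (C × W) // ∀ w, y (0, w) = (0, A w)})) := by
  constructor
  · rintro ⟨D, B⟩ ⟨D', B'⟩ h
    have h' : ∀ c, (D c, B c) = (D' c, B' c) := fun c => by
      simpa using LinearEquiv.congr_fun (Subtype.ext_iff.1 h) (c, 0)
    simp only [Prod.mk.injEq] at h' ⊢
    exact ⟨LinearEquiv.ext fun c => (h' c).1, LinearMap.ext fun c => (h' c).2⟩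
  · rintro ⟨y, hy⟩
    let D₀ : C →ₗ[E] C := fst E C W ∘ₗ (y : (C × W) →ₗ[E] (C × W)) ∘ₗ inl E C W
    have hD : Function.Injective D₀ := by
      rw [injective_iff_map_eq_zero]
      intro c hc
      have hc' : (y (c, 0)).1 = 0 := hc
      have h1 : y (c, 0) = y (0, A.symm (y (c, 0)).2) := by
        rw [hy]
        exact Prod.ext hc' (by simp)
      simpa using congrArg Prod.fst (y.injective h1)
    refine ⟨⟨LinearEquiv.ofInjectiveEndo D₀ hD,
      snd E C W ∘ₗ (y : (C × W) →ₗ[E] (C × W)) ∘ₗ inl E C W⟩, Subtype.ext ?_⟩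
    refine LinearEquiv.ext fun x => ?_
    have hx : y x = y (x.1, 0) + y (0, x.2) := by rw [← map_add]; simp
    rw [hx, hy]
    ext <;> simp [D₀, add_comm]

/-- The part of the sum over `GL(C × W)` where `y` restricts to a given automorphism of `W`. The
sum over the off-diagonal blocks of `y` vanishes unless the block of `a` from `W` to `C` is zero. -/
theorem sum_glWeight_prod [FiniteDimensional E C] [FiniteDimensional E W]
    [Finite C] [Finite W] {ψ : AddChar E ℂ} (hψ : ψ ≠ 1)
    (A : W ≃ₗ[E] W) (a : C × W →ₗ[E] C × W) [Decidable (fst E C W ∘ₗ a ∘ₗ inr E C W = 0)] :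
    ∑ᶠ y : {y : (C × W) ≃ₗ[E] (C × W) // ∀ w, y (0, w) = (0, A w)}, glWeight ψ a y.1 =
      if fst E C W ∘ₗ a ∘ₗ inr E C W = 0 then
        Nat.card (C →ₗ[E] W) * ψ (trace E W (A : W →ₗ[E] W) +
          trace E W ((A.symm : W →ₗ[E] W) ∘ₗ (snd E C W ∘ₗ a ∘ₗ inr E C W))) *
          glSum ψ (fst E C W ∘ₗ a ∘ₗ inl E C W)
      else 0 := by
  have := finite_linearMap (E := E) (V := C) (V' := W)
  have := finite_linearEquiv (E := E) (V := C) (V' := C)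
  cases nonempty_fintype (C →ₗ[E] W)
  cases nonempty_fintype (C ≃ₗ[E] C)
  rw [← finsum_eq_of_bijective (f := fun x : (C ≃ₗ[E] C) × (C →ₗ[E] W) =>
    glWeight ψ a (x.1.skewProd A x.2)) _ (bijective_skewProd A) fun _ => rfl]
  rw [finsum_eq_sum_of_fintype, Fintype.sum_prod_type]
  have key : ∀ D : C ≃ₗ[E] C, ∑ B : C →ₗ[E] W, glWeight ψ a (D.skewProd A B) =
      glWeight ψ (fst E C W ∘ₗ a ∘ₗ inl E C W) D * ψ (trace E W (A : W →ₗ[E] W) +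
          trace E W ((A.symm : W →ₗ[E] W) ∘ₗ (snd E C W ∘ₗ a ∘ₗ inr E C W))) *
      if fst E C W ∘ₗ a ∘ₗ inr E C W = 0 then (Fintype.card (C →ₗ[E] W) : ℂ) else 0 := by
    intro D
    rw [← sum_addChar_trace_comp hψ A.symm D.symm, ← Equiv.sum_comp (Equiv.neg (C →ₗ[E] W)),
      Finset.mul_sum]
    refine Finset.sum_congr rfl fun B _ => ?_
    rw [glWeight, glWeight, trace_skewProd, trace_skewProd_symm_comp, ← AddChar.map_add_eq_mul,
      ← AddChar.map_add_eq_mul]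
    congr 1
    simp only [Equiv.neg_apply, LinearMap.neg_comp, LinearMap.comp_neg, map_neg]
    ring
  simp_rw [key]
  split_ifs
  · rw [glSum, finsum_eq_sum_of_fintype, Finset.mul_sum, Nat.card_eq_fintype_card]
    exact Finset.sum_congr rfl fun D _ => by ring
  · simp

/-- The part of the sum over `GL(V)` where `y` restricts to a given automorphism `A` of a subspace
`W`, transported to `C × W` for a complement `C` of `W`. -/
theorem sum_glWeight_eq_prod (ψ : AddChar E ℂ) {C W : Submodule E V}
    (h : IsCompl C W) (A : W ≃ₗ[E] W) (a : V →ₗ[E] V) :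
    ∑ᶠ y : {y : V ≃ₗ[E] V // ∀ w : W, y w = A w}, glWeight ψ a y.1 =
      ∑ᶠ y : {y : (C × W) ≃ₗ[E] (C × W) // ∀ w, y (0, w) = (0, A w)},
        glWeight ψ ((C.prodEquivOfIsCompl W h).symm.conj a) y.1 := by
  set φ := C.prodEquivOfIsCompl W h with hφ
  have h0 : ∀ w : W, φ (0, w) = w := fun w => by simp [hφ]
  have h1 : ∀ w : W, φ.symm w = (0, w) := fun w => by rw [← h0, φ.symm_apply_apply]
  refine finsum_eq_of_bijective (fun y => ⟨φ ≪≫ₗ y.1 ≪≫ₗ φ.symm, fun w => ?_⟩)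
    ⟨fun y z hyz => ?_, fun z => ?_⟩ fun y => ?_
  · simp [h0, y.2, h1]
  · ext v
    have := LinearEquiv.congr_fun (Subtype.ext_iff.1 hyz) (φ.symm v)
    simpa using this
  · refine ⟨⟨φ.symm ≪≫ₗ z.1 ≪≫ₗ φ, fun w => ?_⟩, ?_⟩
    · simp [h0, z.2, h1]
    · ext <;> simp
  · unfold glWeight
    have h1 : ((φ ≪≫ₗ y.1 ≪≫ₗ φ.symm : (C × W) ≃ₗ[E] (C × W)) : (C × W) →ₗ[E] (C × W)) =
        φ.symm.conj y.1 := by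
      ext <;> simp
    have h2 : ((φ ≪≫ₗ y.1 ≪≫ₗ φ.symm).symm : (C × W) →ₗ[E] (C × W)) ∘ₗ φ.symm.conj a =
        φ.symm.conj ((y.1.symm : V →ₗ[E] V) ∘ₗ a) := by
      ext <;> simp
    rw [h1, h2, trace_conj', trace_conj']

/-- The `y` restricting to a given automorphism of a subspace which is not stable under `a`
contribute nothing to the sum over `GL(V)`. -/
theorem sum_glWeight_of_not_le [Finite E] [FiniteDimensional E V] {ψ : AddChar E ℂ} (hψ : ψ ≠ 1)
    {W : Submodule E V} (A : W ≃ₗ[E] W) {a : V →ₗ[E] V} (hW : ¬ W ≤ W.comap a) :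
    ∑ᶠ y : {y : V ≃ₗ[E] V // ∀ w : W, y w = A w}, glWeight ψ a y.1 = 0 := by
  classical
  obtain ⟨C, hC⟩ := W.exists_isCompl
  have : Finite V := Module.finite_of_finite E
  rw [sum_glWeight_eq_prod ψ hC.symm, sum_glWeight_prod hψ, if_neg]
  refine fun h => hW fun w hw => ?_
  have h1 := LinearMap.congr_fun h ⟨w, hw⟩
  rw [Submodule.mem_comap]
  refine (C.prodEquivOfIsCompl_symm_apply_fst_eq_zero W hC.symm).1 ?_
  simpa using h1

/-- The contribution to the sum over `GL(V)` of the `y` restricting to a given automorphism `A` of a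
subspace `W` stable under `a` is, up to a factor, the sum attached to `V ⧸ W`. -/
theorem sum_glWeight_of_le [Finite E] [FiniteDimensional E V] {ψ : AddChar E ℂ} (hψ : ψ ≠ 1)
    {W : Submodule E V} (A : W ≃ₗ[E] W) {a : V →ₗ[E] V} (hW : W ≤ W.comap a) :
    ∑ᶠ y : {y : V ≃ₗ[E] V // ∀ w : W, y w = A w}, glWeight ψ a y.1 =
      (Nat.card E : ℂ) ^ (finrank E W * finrank E (V ⧸ W)) *
        ψ (trace E W (A : W →ₗ[E] W) + trace E W ((A.symm : W →ₗ[E] W) ∘ₗ a.restrict hW)) *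
        glSum ψ (W.mapQ W a hW) := by
  classical
  obtain ⟨C, hC⟩ := W.exists_isCompl
  have : Finite V := Module.finite_of_finite E
  have hW' : ∀ w : W, a w ∈ W := fun w => hW w.2
  have key : ∀ w : W, (C.prodEquivOfIsCompl W hC.symm).symm (a w) = (0, ⟨a w, hW' w⟩) := by
    intro w
    rw [LinearEquiv.symm_apply_eq]
    simp
  rw [sum_glWeight_eq_prod ψ hC.symm, sum_glWeight_prod hψ, if_pos]
  · have h1 : snd E C W ∘ₗ (C.prodEquivOfIsCompl W hC.symm).symm.conj a ∘ₗ inr E C W =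
        a.restrict hW := by
      ext w
      simp [key]
    have h2 : (W.quotientEquivOfIsCompl C hC).conj (W.mapQ W a hW) =
        fst E C W ∘ₗ (C.prodEquivOfIsCompl W hC.symm).symm.conj a ∘ₗ inl E C W := by
      ext c
      simp
    have h3 : Nat.card (C →ₗ[E] W) = Nat.card E ^ (finrank E W * finrank E (V ⧸ W)) := by
      have := finite_linearMap (E := E) (V := C) (V' := W)
      rw [Module.natCard_eq_pow_finrank (K := E), Module.finrank_linearMap,
        (W.quotientEquivOfIsCompl C hC).finrank_eq, mul_comm]
    rw [h1, ← h2, glSum_conj, h3, Nat.cast_pow]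
  · ext w
    simp [key]

end GLSums

/-! ### Reduction along an eigenvector -/

section GLRecursion

open LinearMap Module

variable {E : Type*} [Field E] {V : Type*} [AddCommGroup V] [Module E V]

theorem finsum_subtype_eq_sum_ite {ι : Type*} [Fintype ι] (p : ι → Prop) [DecidablePred p]
    (f : ι → ℂ) : ∑ᶠ i : {i // p i}, f i.1 = ∑ i, if p i then f i else 0 := by
  have := Fintype.ofFinite {i // p i}
  rw [finsum_eq_sum_of_fintype, ← Finset.sum_filter]
  exact (Finset.sum_subtype _ (by simp) f).symm

/-- The effect on the summand of composing `y` with a transvection along an eigenvector of `a`. -/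
theorem glWeight_trans_transvection [FiniteDimensional E V] (ψ : AddChar E ℂ) {a : V →ₗ[E] V}
    {e : V} {α : E} (hae : a e = α • e) {φ : Dual E V} (hφ : φ e = 0) (y : V ≃ₗ[E] V) :
    glWeight ψ a (LinearEquiv.transvection hφ ≪≫ₗ y) =
      glWeight ψ a y * ψ (φ (y e - α • y.symm e)) := by
  have h1 : ((LinearEquiv.transvection hφ ≪≫ₗ y : V ≃ₗ[E] V) : V →ₗ[E] V) =
      y + φ.smulRight (y e) := by
    ext v
    simp [LinearMap.transvection.apply]
  have h2 : ((LinearEquiv.transvection hφ ≪≫ₗ y).symm : V →ₗ[E] V) ∘ₗ a =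
      (y.symm : V →ₗ[E] V) ∘ₗ a - (φ ∘ₗ (y.symm : V →ₗ[E] V) ∘ₗ a).smulRight e := by
    ext v
    simp only [LinearMap.comp_apply, LinearEquiv.coe_coe, LinearEquiv.trans_symm,
      LinearEquiv.trans_apply, LinearMap.sub_apply, smulRight_apply]
    rw [LinearEquiv.symm_apply_eq]
    simp [LinearMap.transvection.apply, hφ]
  rw [glWeight, glWeight, h1, h2, map_add (trace E V), map_sub (trace E V), trace_smulRight,
    trace_smulRight, ← AddChar.map_add_eq_mul]
  congr 1
  simp [hae]
  ring

/-- Averaging the sum over `GL(V)` over the transvections `1 + φ(·) e`, `φ(e) = 0`, where `e` is an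
eigenvector of `a`, leaves only those `y` for which `y e - α y⁻¹ e` is a multiple of `e`. -/
theorem glSum_eq_of_eigenvector [Finite E] [FiniteDimensional E V] [Fintype (V ≃ₗ[E] V)]
    {ψ : AddChar E ℂ}
    (hψ : ψ ≠ 1) {a : V →ₗ[E] V} {e : V} {α : E} (hae : a e = α • e)
    [∀ y : V ≃ₗ[E] V, Decidable (y e - α • y.symm e ∈ Submodule.span E {e})] :
    glSum ψ a =
      ∑ y : V ≃ₗ[E] V, if y e - α • y.symm e ∈ Submodule.span E {e} then glWeight ψ a y else 0 := by
  classical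
  have : Finite V := Module.finite_of_finite E
  let S : Submodule E (Dual E V) := LinearMap.ker (Dual.eval E V e)
  have hS : ∀ φ : S, φ.1 e = 0 := fun φ => φ.2
  have : Finite (Dual E V) := finite_linearMap (E := E) (V := V) (V' := E)
  cases nonempty_fintype S
  have h1 : ∀ φ : S, glSum ψ a = ∑ y, glWeight ψ a y * ψ (φ.1 (y e - α • y.symm e)) := by
    intro φ
    rw [glSum, finsum_eq_sum_of_fintype,
      ← Equiv.sum_comp (Equiv.mulRight (LinearEquiv.transvection (hS φ)))]
    exact Finset.sum_congr rfl fun y _ => glWeight_trans_transvection ψ hae (hS φ) y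
  have h2 : ∀ w : V, ∑ φ : S, ψ (φ.1 w) =
      if w ∈ Submodule.span E {e} then (Fintype.card S : ℂ) else 0 := by
    intro w
    split_ifs with hw
    · obtain ⟨c, rfl⟩ := Submodule.mem_span_singleton.1 hw
      simp [hS]
    · obtain ⟨φ, hφ, hker⟩ := Submodule.exists_le_ker_of_notMem hw
      have hφe : φ e = 0 := hker (Submodule.mem_span_singleton_self e)
      obtain ⟨t, ht⟩ : ∃ t, ψ t ≠ 1 := by
        by_contra! h
        exact hψ (by ext t; simpa using h t)
      let L : S →+ E :=
        { toFun := fun φ => φ.1 w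
          map_zero' := by simp
          map_add' := fun _ _ => by simp }
      refine AddChar.sum_eq_zero_of_ne_one (ψ := ψ.compAddMonoidHom L) fun h => ht ?_
      have h3 := DFunLike.congr_fun h (⟨(t / φ w) • φ, by simp [S, hφe]⟩ : S)
      simpa [L, hφ] using h3
  have hcard : (Fintype.card S : ℂ) ≠ 0 := by simp
  refine mul_left_cancel₀ hcard ?_
  calc (Fintype.card S : ℂ) * glSum ψ a = ∑ φ : S, glSum ψ a := by simp
    _ = ∑ y, glWeight ψ a y * ∑ φ : S, ψ (φ.1 (y e - α • y.symm e)) := by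
      rw [Finset.sum_congr rfl fun φ _ => h1 φ, Finset.sum_comm]
      simp_rw [Finset.mul_sum]
    _ = _ := by
      rw [Finset.mul_sum]
      refine Finset.sum_congr rfl fun y _ => ?_
      rw [h2]
      split_ifs <;> ring

/-- The classical Kloosterman sum `∑_{x ≠ 0} ψ (x + α / x)`. -/
noncomputable def kloostermanSum (ψ : AddChar E ℂ) (α : E) : ℂ :=
  ∑ᶠ x : Eˣ, ψ (x + α * (x⁻¹ : Eˣ))

/-- Contribution to the sum over `GL(V)` of the `y` having the eigenvector `e`. -/
theorem sum_glWeight_eigenvector [Finite E] [FiniteDimensional E V] [Fintype (V ≃ₗ[E] V)]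
    {ψ : AddChar E ℂ} (hψ : ψ ≠ 1) {a : V →ₗ[E] V} {e : V} (he : e ≠ 0) {α : E}
    (hae : a e = α • e) (hle : Submodule.span E {e} ≤ (Submodule.span E {e}).comap a) (x : Eˣ)
    [∀ y : V ≃ₗ[E] V, Decidable (y e = (x : E) • e)] :
    ∑ y : V ≃ₗ[E] V, (if y e = (x : E) • e then glWeight ψ a y else 0) =
      (Nat.card E : ℂ) ^ (finrank E V - 1) * ψ (x + α * (x⁻¹ : Eˣ)) *
        glSum ψ ((Submodule.span E {e}).mapQ _ a hle) := by
  classical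
  set W := Submodule.span E {e} with hWdef
  have heW : e ∈ W := Submodule.mem_span_singleton_self e
  let A : W ≃ₗ[E] W := LinearEquiv.smulOfUnit x
  have hA : ∀ w : W, A w = (x : E) • w := fun w => rfl
  have hiff : ∀ y : V ≃ₗ[E] V, y e = (x : E) • e ↔ ∀ w : W, y w = A w := by
    intro y
    constructor
    · rintro h ⟨w, hw⟩
      obtain ⟨c, rfl⟩ := Submodule.mem_span_singleton.1 hw
      simp [hA, h, smul_comm c (x : E)]
    · intro h
      simpa [hA] using h ⟨e, heW⟩
  have hdim : finrank E W = 1 := finrank_span_singleton he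
  have h1 := sum_glWeight_of_le hψ A hle
  rw [finsum_subtype_eq_sum_ite] at h1
  simp_rw [hiff]
  rw [h1, hdim, one_mul]
  have h2 : finrank E (V ⧸ W) = finrank E V - 1 := by
    have := W.finrank_quotient_add_finrank
    omega
  have h3 : trace E W (A : W →ₗ[E] W) = x := by
    have : (A : W →ₗ[E] W) = (x : E) • LinearMap.id := by ext w; simp [hA]
    rw [this, map_smul, trace_id, hdim]
    simp
  have h4 : trace E W ((A.symm : W →ₗ[E] W) ∘ₗ a.restrict hle) = α * (x⁻¹ : Eˣ) := by
    have : ((A.symm : W →ₗ[E] W) ∘ₗ a.restrict hle) = (α * (x⁻¹ : Eˣ)) • LinearMap.id := by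
      ext ⟨w, hw⟩
      obtain ⟨c, rfl⟩ := Submodule.mem_span_singleton.1 hw
      simp only [LinearMap.comp_apply, LinearEquiv.coe_coe]
      have : A.symm (a.restrict hle ⟨c • e, hw⟩) = (α * (x⁻¹ : Eˣ)) • (⟨c • e, hw⟩ : W) := by
        rw [LinearEquiv.symm_apply_eq, hA, smul_smul]
        ext
        simp [hae, smul_comm c α, mul_comm α]
      rw [this]
      simp
    rw [this, map_smul, trace_id, hdim]
    simp
  rw [h2, h3, h4]

/-- The automorphism of the plane `⟨e, f⟩` with `e ↦ f + c e` and `f ↦ α e`. -/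
theorem exists_basis_span_pair {e f : V} (hef : LinearIndependent E ![e, f]) {α : E} (hα : α ≠ 0)
    (c : E) :
    ∃ (b : Basis (Fin 2) E (Submodule.span E {e, f}))
      (A : Submodule.span E {e, f} ≃ₗ[E] Submodule.span E {e, f}), (b 0 : V) = e ∧ (b 1 : V) = f ∧
        A (b 0) = b 1 + c • b 0 ∧ A (b 1) = α • b 0 := by
  have hr : Set.range ![e, f] = {e, f} := by simp [Set.pair_comm]
  obtain ⟨b, hb⟩ : ∃ b : Basis (Fin 2) E (Submodule.span E {e, f}), ∀ i, (b i : V) = ![e, f] i := by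
    rw [← hr]
    exact ⟨Basis.span hef, fun i => by rw [Basis.span_apply hef i]⟩
  refine ⟨b, LinearEquiv.ofLinearMap (b.constr E ![b 1 + c • b 0, α • b 0])
    (b.constr E ![α⁻¹ • b 1, b 0 - (c * α⁻¹) • b 1]) (b.ext fun i => ?_) (b.ext fun i => ?_),
    hb 0, hb 1, ?_, ?_⟩
  · fin_cases i
    · simp [hα]
    · simp [smul_smul, hα]
  · fin_cases i
    · simp [smul_smul]
    · simp [smul_smul, hα]
  · simp
  · simp

theorem forall_span_pair_iff {e f : V} {α c : E} {b : Basis (Fin 2) E (Submodule.span E {e, f})}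
    {A : Submodule.span E {e, f} ≃ₗ[E] Submodule.span E {e, f}} (hb0 : (b 0 : V) = e)
    (hb1 : (b 1 : V) = f) (hA0 : A (b 0) = b 1 + c • b 0) (hA1 : A (b 1) = α • b 0)
    (y : V ≃ₗ[E] V) :
    (y f = α • e ∧ y e = f + c • e) ↔ ∀ w : Submodule.span E {e, f}, y w = A w := by
  constructor
  · rintro ⟨h1, h2⟩
    have : (y : V →ₗ[E] V) ∘ₗ (Submodule.span E {e, f}).subtype =
        (Submodule.span E {e, f}).subtype ∘ₗ (A : _ →ₗ[E] _) := by
      refine b.ext fun i => ?_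
      fin_cases i
      · simp [hb0, hb1, hA0, h2]
      · simp [hb0, hb1, hA1, h1]
    exact fun w => LinearMap.congr_fun this w
  · intro h
    constructor
    · simpa [hb0, hb1, hA1] using h (b 1)
    · simpa [hb0, hb1, hA0] using h (b 0)

/-- Contribution to the sum over `GL(V)` of the `y` with `y f = α e` and `y e = f + c e`, where `e`
and `f` are linearly independent and span a subspace stable under `a`. -/
theorem sum_glWeight_plane [Finite E] [FiniteDimensional E V] [Fintype (V ≃ₗ[E] V)]
    {ψ : AddChar E ℂ} (hψ : ψ ≠ 1) {a : V →ₗ[E] V} {e f : V}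
    (hef : LinearIndependent E ![e, f]) {α : E} (hα : α ≠ 0)
    (hae : a e = α • e) (s : E) (haf : a f = α • f + s • e)
    (hle : Submodule.span E {e, f} ≤ (Submodule.span E {e, f}).comap a) (c : E)
    [∀ y : V ≃ₗ[E] V, Decidable (y f = α • e ∧ y e = f + c • e)] :
    ∑ y : V ≃ₗ[E] V, (if y f = α • e ∧ y e = f + c • e then glWeight ψ a y else 0) =
      (Nat.card E : ℂ) ^ (2 * (finrank E V - 2)) * ψ (s / α) *
        glSum ψ ((Submodule.span E {e, f}).mapQ _ a hle) := by
  classical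
  obtain ⟨b, A, hb0, hb1, hA0, hA1⟩ := exists_basis_span_pair hef hα c
  have h1 := sum_glWeight_of_le hψ A hle
  rw [finsum_subtype_eq_sum_ite] at h1
  simp_rw [forall_span_pair_iff hb0 hb1 hA0 hA1]
  have hdim : finrank E (Submodule.span E {e, f}) = 2 := by
    rw [finrank_eq_card_basis b, Fintype.card_fin]
  have h2 : finrank E (V ⧸ Submodule.span E {e, f}) = finrank E V - 2 := by
    have := (Submodule.span E {e, f}).finrank_quotient_add_finrank
    omega
  rw [h1, hdim, h2]
  have hA0' : A.symm (b 0) = α⁻¹ • b 1 := by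
    rw [LinearEquiv.symm_apply_eq, map_smul, hA1, smul_smul, inv_mul_cancel₀ hα, one_smul]
  have hA1' : A.symm (b 1) = b 0 - (c * α⁻¹) • b 1 := by
    rw [LinearEquiv.symm_apply_eq, map_sub, map_smul, hA1, hA0, smul_smul, mul_assoc,
      inv_mul_cancel₀ hα, mul_one, add_sub_cancel_right]
  have ha0 : a.restrict hle (b 0) = α • b 0 := by
    ext; simp [hb0, hae]
  have ha1 : a.restrict hle (b 1) = α • b 1 + s • b 0 := by
    ext; simp [hb0, hb1, haf]
  have h3 : trace E (Submodule.span E {e, f}) (A : _ →ₗ[E] _) = c := by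
    rw [trace_eq_matrix_trace E b, Matrix.trace, Fin.sum_univ_two]
    simp [toMatrix_apply, hA0, hA1]
  have h4 : trace E (Submodule.span E {e, f})
      ((A.symm : Submodule.span E {e, f} →ₗ[E] Submodule.span E {e, f}) ∘ₗ a.restrict hle) =
        - c + s / α := by
    rw [trace_eq_matrix_trace E b, Matrix.trace, Fin.sum_univ_two]
    simp [toMatrix_apply, ha0, ha1, hA0', hA1']
    field_simp
  rw [h3, h4]
  ring_nf

theorem sum_glWeight_plane_eq_zero [Finite E] [FiniteDimensional E V] [Fintype (V ≃ₗ[E] V)]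
    {ψ : AddChar E ℂ} (hψ : ψ ≠ 1) {a : V →ₗ[E] V} {e f : V}
    (hef : LinearIndependent E ![e, f]) {α : E} (hα : α ≠ 0)
    (hle : ¬ Submodule.span E {e, f} ≤ (Submodule.span E {e, f}).comap a) (c : E)
    [∀ y : V ≃ₗ[E] V, Decidable (y f = α • e ∧ y e = f + c • e)] :
    ∑ y : V ≃ₗ[E] V, (if y f = α • e ∧ y e = f + c • e then glWeight ψ a y else 0) = 0 := by
  classical
  obtain ⟨b, A, hb0, hb1, hA0, hA1⟩ := exists_basis_span_pair hef hα c
  have h1 := sum_glWeight_of_not_le hψ A hle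
  rw [finsum_subtype_eq_sum_ite] at h1
  simp_rw [forall_span_pair_iff hb0 hb1 hA0 hA1]
  exact h1

/-- The elements `y` with `y e - α y⁻¹ e ∈ ⟨e⟩` either have `e` as an eigenvector, or map the plane
spanned by `e` and `f = α y⁻¹ e` to itself. -/
theorem ite_mem_span_eq_sum_add_sum [Fintype E] [Fintype V] [Fintype Eˣ] [DecidableEq V]
    {e : V} (he : e ≠ 0) {α : E} (hα : α ≠ 0) (y : V ≃ₗ[E] V)
    [∀ v : V, Decidable (v ∈ Submodule.span E {e})] (z : ℂ) :
    (if y e - α • y.symm e ∈ Submodule.span E {e} then z else 0) =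
      ∑ x : Eˣ, (if y e = (x : E) • e then z else 0) +
      ∑ f : V, if f ∈ Submodule.span E {e} then 0 else
        ∑ c : E, if y f = α • e ∧ y e = f + c • e then z else 0 := by
  set f₀ := α • y.symm e with hf₀
  have hyf₀ : y f₀ = α • e := by simp [hf₀]
  have hiff : ∀ f, y f = α • e ↔ f = f₀ := fun f => by rw [← hyf₀, y.injective.eq_iff]
  have h2 : (∑ f : V, if f ∈ Submodule.span E {e} then 0 else
        ∑ c : E, if y f = α • e ∧ y e = f + c • e then z else 0) =
      if f₀ ∈ Submodule.span E {e} then 0 else ∑ c : E, if y e = f₀ + c • e then z else 0 := by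
    rw [Finset.sum_eq_single f₀]
    · simp [hyf₀]
    · intro f _ hf
      simp [hiff, hf]
    · simp
  have hinj : ∀ c d : E, c • e = d • e → c = d := fun c d h => smul_left_injective E he h
  rw [h2]
  by_cases hf : f₀ ∈ Submodule.span E {e}
  · obtain ⟨t, ht⟩ := Submodule.mem_span_singleton.1 hf
    have ht0 : t ≠ 0 := by
      rintro rfl
      rw [zero_smul] at ht
      rw [← ht, map_zero] at hyf₀
      exact smul_ne_zero hα he hyf₀.symm
    have hye : y e = (α / t) • e := by
      rw [← ht, map_smul] at hyf₀
      rw [div_eq_inv_mul, mul_smul, ← hyf₀, smul_smul, inv_mul_cancel₀ ht0, one_smul]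
    have hmem : y e - f₀ ∈ Submodule.span E {e} := by
      rw [hye]
      exact sub_mem (Submodule.smul_mem _ _ (Submodule.mem_span_singleton_self e)) hf
    rw [if_pos hmem, if_pos hf, add_zero, Finset.sum_eq_single (Units.mk0 (α / t) (by positivity))]
    · simp [hye]
    · intro x _ hx
      rw [if_neg]
      intro h
      exact hx (Units.ext (hinj _ _ (by rw [← h, hye]; rfl)))
    · simp
  · rw [if_neg hf, Finset.sum_eq_zero (s := (Finset.univ : Finset Eˣ)), zero_add]
    · by_cases hmem : y e - f₀ ∈ Submodule.span E {e}
      · obtain ⟨c, hc⟩ := Submodule.mem_span_singleton.1 hmem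
        rw [if_pos hmem, Finset.sum_eq_single c]
        · rw [if_pos]
          rw [hc]; abel
        · intro d _ hd
          rw [if_neg]
          intro h
          exact hd (hinj _ _ (by rw [hc, h]; abel))
        · simp
      · rw [if_neg hmem, Finset.sum_eq_zero]
        intro c _
        rw [if_neg]
        intro h
        exact hmem (Submodule.mem_span_singleton.2 ⟨c, by rw [h]; abel⟩)
    · intro x _
      rw [if_neg]
      intro h
      refine hf (Submodule.mem_span_singleton.2 ⟨α * (x⁻¹ : Eˣ), ?_⟩)
      rw [hf₀, mul_smul]
      congr 1
      rw [LinearEquiv.eq_symm_apply, map_smul, h, smul_smul]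
      simp

/-- Reduction of the Kloosterman sum over `GL(V)` along an eigenvector `e` of `a`: with `N = a - α`
and a linear form `θ` with `θ e = 1`, the sum is expressed through the quotients of `V` by `⟨e⟩`
and by the stable planes `⟨e, f⟩` with `N f ∈ ⟨e⟩`. -/
theorem glSum_recursion [Fintype E] [Fintype V] {ψ : AddChar E ℂ} (hψ : ψ ≠ 1)
    {a : V →ₗ[E] V} {e : V} (he : e ≠ 0) {α : E} (hα : α ≠ 0) (hae : a e = α • e)
    (hle : Submodule.span E {e} ≤ (Submodule.span E {e}).comap a)
    [∀ v : V, Decidable (v ∈ Submodule.span E {e})]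
    (hev : ∀ (v : V) (u : E), a v = u • v → v ≠ 0 → u = α) (θ : V →ₗ[E] E) (hθ : θ e = 1)
    (G : V → ℂ)
    (hG : ∀ f (h : Submodule.span E {e, f} ≤ (Submodule.span E {e, f}).comap a),
      f ∉ Submodule.span E {e} → glSum ψ ((Submodule.span E {e, f}).mapQ _ a h) = G f) :
    glSum ψ a = (Nat.card E : ℂ) ^ (finrank E V - 1) * kloostermanSum ψ α *
        glSum ψ ((Submodule.span E {e}).mapQ _ a hle) +
      (Nat.card E : ℂ) ^ (2 * (finrank E V - 2) + 1) *
        ∑ f : V, if a f - α • f ∈ Submodule.span E {e} ∧ f ∉ Submodule.span E {e} then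
          ψ (θ (a f - α • f) / α) * G f else 0 := by
  classical
  have : FiniteDimensional E V := Module.Finite.of_finite
  have := finite_linearEquiv (E := E) (V := V) (V' := V)
  cases nonempty_fintype (V ≃ₗ[E] V)
  rw [glSum_eq_of_eigenvector hψ hae,
    Finset.sum_congr rfl fun y _ => ite_mem_span_eq_sum_add_sum he hα y _,
    Finset.sum_add_distrib, Finset.sum_comm]
  congr 1
  · rw [Finset.sum_congr rfl fun x _ => sum_glWeight_eigenvector hψ he hae hle x, kloostermanSum,
      finsum_eq_sum_of_fintype, Finset.mul_sum, Finset.sum_mul]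
  · rw [Finset.sum_comm, Finset.mul_sum]
    refine Finset.sum_congr rfl fun f _ => ?_
    by_cases hf : f ∈ Submodule.span E {e}
    · simp [hf]
    have hind : LinearIndependent E ![e, f] :=
      (LinearIndependent.pair_iff' he).2 fun t ht => hf (Submodule.mem_span_singleton.2 ⟨t, ht⟩)
    -- as `α` is the only eigenvalue of `a`, the plane is stable only if `a` acts as `α` modulo `e`
    have hiff : Submodule.span E {e, f} ≤ (Submodule.span E {e, f}).comap a ↔
        a f - α • f ∈ Submodule.span E {e} := by
      have hfmem : f ∈ Submodule.span E {e, f} := Submodule.subset_span (by simp)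
      have hemem : e ∈ Submodule.span E {e, f} := Submodule.subset_span (by simp)
      constructor
      · intro h
        obtain ⟨s, t, hst⟩ := Submodule.mem_span_pair.1 (h hfmem)
        have h1 : a (s • e + (t - α) • f) = t • (s • e + (t - α) • f) := by
          rw [map_add, map_smul, map_smul, hae, ← hst]
          module
        have h2 : a f - α • f = s • e + (t - α) • f := by rw [← hst]; module
        by_cases h3 : s • e + (t - α) • f = 0
        · rw [h2, h3]
          exact zero_mem _
        · rw [h2, hev _ _ h1 h3, sub_self, zero_smul, add_zero]
          exact Submodule.smul_mem _ _ (Submodule.mem_span_singleton_self e)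
      · intro h
        obtain ⟨s, hs⟩ := Submodule.mem_span_singleton.1 h
        rw [Submodule.span_le]
        rintro v (rfl | rfl)
        · simpa [hae] using Submodule.smul_mem _ α hemem
        · have : a v = α • v + s • e := by rw [hs]; abel
          simpa [this] using add_mem (Submodule.smul_mem _ α hfmem) (Submodule.smul_mem _ s hemem)
    simp only [hf, if_false, not_false_eq_true, and_true]
    rw [Finset.sum_comm]
    split_ifs with hs
    · obtain ⟨s, hs'⟩ := Submodule.mem_span_singleton.1 hs
      rw [Finset.sum_congr rfl fun c _ => sum_glWeight_plane hψ hind hα hae s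
        (by rw [hs']; abel) (hiff.2 hs) c, hG _ _ hf, ← hs', map_smul, hθ]
      simp
      ring
    · rw [mul_zero]
      exact Finset.sum_eq_zero fun c _ => sum_glWeight_plane_eq_zero hψ hind hα (mt hiff.1 hs) c

end GLRecursion

/-! ### The recursion in terms of the type of the nilpotent part -/

section RankRecursion

open LinearMap Module

universe v

variable {E : Type*} [Field E]

/-- The nilpotent endomorphism `N` has type `r`: the rank of `N ^ j` is `r j` for every `j`. This
encodes the partition given by the sizes of the Jordan blocks. -/
def HasRanks {V : Type*} [AddCommGroup V] [Module E V] (N : Module.End E V) (r : ℕ → ℕ) : Prop :=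
  ∀ j, finrank E (LinearMap.range (N ^ j)) = r j

/-- The sequence `r` lowered by one at the indices below `k`: on types, this removes a box from a
Jordan block of size `k`. -/
def lowerBelow (r : ℕ → ℕ) (k j : ℕ) : ℕ := r j - if j < k then 1 else 0

variable {V : Type*} [AddCommGroup V] [Module E V]

theorem finrank_range_mapQ_pow [FiniteDimensional E V] {N : Module.End E V} {W : Submodule E V}
    (hW : W ≤ W.comap N) (j : ℕ) :
    finrank E (LinearMap.range ((W.mapQ W N hW : Module.End E (V ⧸ W)) ^ j)) =
      finrank E (LinearMap.range (N ^ j)) -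
        finrank E (LinearMap.range (N ^ j) ⊓ W : Submodule E V) := by
  rw [← W.mapQ_pow hW j, Submodule.range_mapQ]
  have h := LinearMap.finrank_range_add_finrank_ker (W.mkQ.domRestrict (LinearMap.range (N ^ j)))
  rw [LinearMap.range_domRestrict, LinearMap.ker_domRestrict, Submodule.ker_mkQ] at h
  have h2 : finrank E (Submodule.submoduleOf W (LinearMap.range (N ^ j))) =
      finrank E (LinearMap.range (N ^ j) ⊓ W : Submodule E V) := by
    rw [← Submodule.map_comap_subtype]
    exact (LinearEquiv.finrank_eq (Submodule.equivMapOfInjective _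
      (Submodule.injective_subtype _) _))
  change _ + finrank E (Submodule.submoduleOf W (LinearMap.range (N ^ j))) = _ at h
  omega

theorem range_pow_antitone (N : Module.End E V) {i j : ℕ} (h : i ≤ j) :
    LinearMap.range (N ^ j) ≤ LinearMap.range (N ^ i) := by
  obtain ⟨d, rfl⟩ := Nat.exists_eq_add_of_le h
  rw [pow_add]
  exact LinearMap.range_comp_le_range _ _

/-- Dividing by a vector of the largest height `k - 1` shortens a Jordan block of size `k`. -/
theorem HasRanks.mapQ_span_singleton [FiniteDimensional E V] {N : Module.End E V} {r : ℕ → ℕ}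
    (hN : HasRanks N r) {k : ℕ} (hk : N ^ k = 0) {e : V} (he : e ≠ 0)
    (hek : e ∈ LinearMap.range (N ^ (k - 1)))
    (hle : Submodule.span E {e} ≤ (Submodule.span E {e}).comap N) :
    HasRanks ((Submodule.span E {e}).mapQ _ N hle : Module.End E (V ⧸ Submodule.span E {e}))
      (lowerBelow r k) := by
  intro j
  rw [finrank_range_mapQ_pow, hN, lowerBelow]
  congr 1
  split_ifs with hj
  · rw [inf_eq_right.2, finrank_span_singleton he]
    rw [Submodule.span_singleton_le_iff_mem]
    exact range_pow_antitone N (by omega) hek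
  · have : N ^ j = 0 := pow_eq_zero_of_le (by omega) hk
    simp [this]

/-- The type of the quotient by a plane `⟨e, f⟩`, where `e` has the largest height `k - 1` and `f`
has height `m - 1`. -/
theorem HasRanks.mapQ_span_pair [FiniteDimensional E V] {N : Module.End E V} {r : ℕ → ℕ}
    (hN : HasRanks N r) {k : ℕ} (hk : N ^ k = 0) {e f : V} (he : e ≠ 0)
    (hek : e ∈ LinearMap.range (N ^ (k - 1))) (hf : f ∉ Submodule.span E {e}) {m : ℕ}
    (hm : ∀ j, f ∈ LinearMap.range (N ^ j) ↔ j < m)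
    (hle : Submodule.span E {e, f} ≤ (Submodule.span E {e, f}).comap N) :
    HasRanks ((Submodule.span E {e, f}).mapQ _ N hle : Module.End E (V ⧸ Submodule.span E {e, f}))
      (lowerBelow (lowerBelow r k) m) := by
  have hind : LinearIndependent E ![e, f] :=
    (LinearIndependent.pair_iff' he).2 fun t ht => hf (Submodule.mem_span_singleton.2 ⟨t, ht⟩)
  have hdim : finrank E (Submodule.span E {e, f}) = 2 := by
    obtain ⟨b, -⟩ := exists_basis_span_pair hind one_ne_zero 0
    rw [finrank_eq_card_basis b, Fintype.card_fin]
  intro j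
  rw [finrank_range_mapQ_pow, hN, lowerBelow, lowerBelow, Nat.sub_sub]
  congr 1
  by_cases hj : j < k
  · have hej := range_pow_antitone N (show j ≤ k - 1 by omega) hek
    by_cases hfj : f ∈ LinearMap.range (N ^ j)
    · rw [if_pos hj, if_pos ((hm j).1 hfj), inf_eq_right.2, hdim]
      rw [Submodule.span_le]
      rintro v (rfl | rfl)
      · exact hej
      · exact hfj
    · rw [if_pos hj, if_neg (mt (hm j).2 hfj), add_zero, ← finrank_span_singleton (K := E) he]
      have : LinearMap.range (N ^ j) ⊓ Submodule.span E {e, f} = Submodule.span E {e} := by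
        refine le_antisymm ?_ ?_
        · rintro v ⟨hv, hv'⟩
          obtain ⟨s, t, rfl⟩ := Submodule.mem_span_pair.1 hv'
          have ht : t • f ∈ LinearMap.range (N ^ j) :=
            (Submodule.add_mem_iff_right _ (Submodule.smul_mem _ s hej)).1 hv
          have ht0 : t = 0 := by
            by_contra h
            exact hfj ((Submodule.smul_mem_iff _ h).1 ht)
          rw [ht0, zero_smul, add_zero]
          exact Submodule.smul_mem _ _ (Submodule.mem_span_singleton_self e)
        · rw [Submodule.span_singleton_le_iff_mem]
          exact ⟨hej, Submodule.subset_span (by simp)⟩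
      rw [this]
  · have h0 : N ^ j = 0 := pow_eq_zero_of_le (by omega) hk
    have hfj : f ∉ LinearMap.range (N ^ j) := by
      rw [h0]
      rintro ⟨v, hv⟩
      exact hf (by rw [← hv]; simp)
    rw [if_neg hj, if_neg (mt (hm j).2 hfj)]
    simp [h0]

/-- On the subspace `N⁻¹⟨e⟩ ∩ im N^j`, where `e` spans part of the last nonzero power `im N^(k-1)`,
the character `f ↦ ψ (θ (N f) / α)` is nontrivial unless `j = k - 1`. -/
theorem sum_addChar_comap_range [Fintype E] [Fintype V] {ψ : AddChar E ℂ} (hψ : ψ ≠ 1)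
    {N : Module.End E V} {k : ℕ} (hk : N ^ k = 0) {e g : V} (hg : (N ^ (k - 1)) g = e)
    {α : E} (hα : α ≠ 0) {θ : V →ₗ[E] E} (hθ : θ e = 1) {j : ℕ} (hj : j < k)
    [∀ f : V, Decidable (N f ∈ Submodule.span E {e} ∧ f ∈ LinearMap.range (N ^ j))] :
    ∑ f : V, (if N f ∈ Submodule.span E {e} ∧ f ∈ LinearMap.range (N ^ j) then
      ψ (θ (N f) / α) else 0) =
      if j = k - 1 then (Nat.card E : ℂ) ^ finrank E (LinearMap.range (N ^ j)) else 0 := by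
  classical
  split_ifs with hjk
  · have h0 : ∀ f, f ∈ LinearMap.range (N ^ j) → N f = 0 := by
      rintro _ ⟨v, rfl⟩
      have : (N * N ^ j) v = 0 := by
        rw [← pow_succ', show j + 1 = k by omega, hk, LinearMap.zero_apply]
      exact this
    rw [Finset.sum_congr rfl fun f _ => show _ =
      if f ∈ LinearMap.range (N ^ j) then (1 : ℂ) else 0 from ?_]
    · rw [Finset.sum_boole, ← Nat.cast_pow, ← Module.natCard_eq_pow_finrank (K := E),
        Nat.card_eq_fintype_card, Fintype.card_subtype]
    · by_cases hf : f ∈ LinearMap.range (N ^ j)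
      · simp [hf, h0 f hf]
      · simp [hf]
  · let S : Submodule E V := (Submodule.span E {e}).comap N ⊓ LinearMap.range (N ^ j)
    have hS : ∀ f, f ∈ S ↔ N f ∈ Submodule.span E {e} ∧ f ∈ LinearMap.range (N ^ j) :=
      fun f => Iff.rfl
    rw [← Finset.sum_filter, Finset.sum_subtype (p := (· ∈ S)) _ (by simp [hS])]
    let L : S →+ E :=
      { toFun := fun f => θ (N f) / α
        map_zero' := by simp
        map_add' := fun x y => by simp [add_div] }
    obtain ⟨t, ht⟩ : ∃ t, ψ t ≠ 1 := by
      by_contra! h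
      exact hψ (by ext t; simpa using h t)
    have hN : N ((N ^ (k - 2)) g) = e := by
      rw [← hg, show k - 1 = k - 2 + 1 by omega, pow_succ']
      rfl
    have hmem : (N ^ (k - 2)) g ∈ S := by
      rw [hS, hN]
      exact ⟨Submodule.mem_span_singleton_self e, range_pow_antitone N (by omega) ⟨g, rfl⟩⟩
    refine AddChar.sum_eq_zero_of_ne_one (ψ := ψ.compAddMonoidHom L) fun h => ht ?_
    have h3 := DFunLike.congr_fun h (⟨(t * α) • (N ^ (k - 2)) g, S.smul_mem _ hmem⟩ : S)
    simpa [L, hN, hθ, hα] using h3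

theorem sum_ite_mem_span_singleton [Fintype E] [Fintype V] {e : V} (he : e ≠ 0)
    [∀ f : V, Decidable (f ∈ Submodule.span E {e})] (z : ℂ) :
    ∑ f : V, (if f ∈ Submodule.span E {e} then z else 0) = Nat.card E * z := by
  classical
  rw [← Finset.sum_filter, Finset.sum_const, ← Fintype.card_subtype, nsmul_eq_mul]
  congr 2
  have := Module.natCard_eq_pow_finrank (K := E) (V := Submodule.span E {e})
  rw [finrank_span_singleton he, pow_one, Nat.card_eq_fintype_card] at this
  exact this

/-- The Kloosterman sum attached to `α + N`, with `N` nilpotent of type `r` and nilpotency index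
`k`, in terms of the sums for smaller types. The vector `e` of `glSum_recursion` is taken in the
last nonzero power `im N^(k-1)`. In the sum over the planes `⟨e, f⟩`, the vectors `f` are sorted
by height, and all but the two largest possible heights cancel. -/
theorem glSum_rank_recursion {V : Type v} [AddCommGroup V] [Module E V] [Finite E]
    [FiniteDimensional E V] {ψ : AddChar E ℂ} (hψ : ψ ≠ 1)
    {α : E} (hα : α ≠ 0) {N : Module.End E V} {r : ℕ → ℕ} (hN : HasRanks N r) {k : ℕ}
    (hk : N ^ k = 0) (hk' : N ^ (k - 1) ≠ 0) (G₀ : ℂ) (G : ℕ → ℂ) (hG0 : G 0 = 0)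
    (h₀ : ∀ (V' : Type v) [AddCommGroup V'] [Module E V'] [FiniteDimensional E V']
      (N' : Module.End E V'), HasRanks N' (lowerBelow r k) → glSum ψ (α • 1 + N') = G₀)
    (h : ∀ m, 0 < m → m ≤ k → ∀ (V' : Type v) [AddCommGroup V'] [Module E V']
      [FiniteDimensional E V'] (N' : Module.End E V'),
      HasRanks N' (lowerBelow (lowerBelow r k) m) → glSum ψ (α • 1 + N') = G m) :
    glSum ψ (α • 1 + N) = (Nat.card E : ℂ) ^ (r 0 - 1) * kloostermanSum ψ α * G₀ +
      (Nat.card E : ℂ) ^ (2 * (r 0 - 2) + 1) *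
        (((Nat.card E : ℂ) ^ r (k - 1) - Nat.card E) * G k -
          (Nat.card E : ℂ) ^ r (k - 1) * G (k - 1)) := by
  classical
  have hfinV : Finite V := Module.finite_of_finite E
  cases nonempty_fintype E
  cases nonempty_fintype V
  have hk0 : 0 < k := by
    rcases Nat.eq_zero_or_pos k with rfl | h
    · exact absurd hk hk'
    · exact h
  obtain ⟨g, hg⟩ : ∃ g, (N ^ (k - 1)) g ≠ 0 := by
    by_contra! h
    exact hk' (LinearMap.ext h)
  obtain ⟨e, hge⟩ : ∃ e, (N ^ (k - 1)) g = e := ⟨_, rfl⟩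
  have he : e ≠ 0 := hge ▸ hg
  have hek : e ∈ LinearMap.range (N ^ (k - 1)) := ⟨g, hge⟩
  have hNe : N e = 0 := by
    have : (N * N ^ (k - 1)) g = 0 := by
      rw [← pow_succ', Nat.sub_add_cancel hk0, hk, LinearMap.zero_apply]
    rw [← hge]
    exact this
  have hr0 : finrank E V = r 0 := by
    rw [← hN 0, pow_zero, Module.End.one_eq_id, LinearMap.range_id, finrank_top]
  obtain ⟨φ, hφ, -⟩ := Submodule.exists_le_ker_of_notMem (p := (⊥ : Submodule E V))
    (v := e) (by simpa using he)
  let θ : V →ₗ[E] E := (φ e)⁻¹ • φ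
  have hθ : θ e = 1 := by simp [θ, hφ]
  have hmapQ : ∀ (W : Submodule E V) (h1 : W ≤ W.comap (α • 1 + N)) (h2 : W ≤ W.comap N),
      W.mapQ W (α • 1 + N) h1 = α • 1 + (W.mapQ W N h2 : Module.End E (V ⧸ W)) := by
    intro W h1 h2
    ext v
    simp
  have hcomap : ∀ W : Submodule E V, W ≤ W.comap (α • 1 + N) → W ≤ W.comap N := by
    intro W h1 v hv
    have := sub_mem (show (α • 1 + N) v ∈ W from h1 hv) (W.smul_mem α hv)
    simpa using this
  have hle : Submodule.span E {e} ≤ (Submodule.span E {e}).comap (α • 1 + N) := by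
    rw [Submodule.span_singleton_le_iff_mem]
    simpa [hNe] using Submodule.smul_mem _ α (Submodule.mem_span_singleton_self e)
  -- `m f` is the height of `f` plus one
  let m : V → ℕ := fun f => ((Finset.range k).filter fun j => f ∈ LinearMap.range (N ^ j)).card
  have hm : ∀ f ≠ 0, ∀ j, f ∈ LinearMap.range (N ^ j) ↔ j < m f := by
    intro f hf
    have hex : ∃ j, f ∉ LinearMap.range (N ^ j) := ⟨k, by
      rw [hk]
      rintro ⟨v, hv⟩
      exact hf (by rw [← hv]; simp)⟩
    have hiff : ∀ j, f ∈ LinearMap.range (N ^ j) ↔ j < Nat.find hex := by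
      intro j
      rw [Nat.lt_find_iff]
      exact ⟨fun h i hi => not_not.2 (range_pow_antitone N hi h), fun h => not_not.1 (h j le_rfl)⟩
    have hfind : Nat.find hex ≤ k := by
      refine Nat.find_min' hex ?_
      rw [hk]
      rintro ⟨v, hv⟩
      exact hf (by rw [← hv]; simp)
    have hm : m f = Nat.find hex := by
      simp only [m]
      rw [Finset.filter_congr fun j _ => hiff j, show (Finset.range k).filter (· < Nat.find hex) =
        Finset.range (Nat.find hex) by
          ext j; simp only [Finset.mem_filter, Finset.mem_range]; omega, Finset.card_range]
    rw [hm]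
    exact hiff
  have hmk : ∀ f, m f ≤ k := fun f => (Finset.card_filter_le _ _).trans (by simp)
  have hmtop : ∀ f ∈ Submodule.span E {e}, m f = k := by
    intro f hf
    obtain ⟨c, rfl⟩ := Submodule.mem_span_singleton.1 hf
    simp only [m]
    rw [Finset.filter_true_of_mem, Finset.card_range]
    intro j hj
    exact Submodule.smul_mem _ _ (range_pow_antitone N (by rw [Finset.mem_range] at hj; omega) hek)
  rw [glSum_recursion hψ he hα (by simp [hNe]) hle ?_ θ hθ (fun f => G (m f)) ?_, hr0,
    hmapQ _ _ (hcomap _ hle), h₀ _ _ (hN.mapQ_span_singleton hk he hek _)]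
  · congr 2
    have hsum : ∑ f : V, (if N f ∈ Submodule.span E {e} then ψ (θ (N f) / α) * G (m f) else 0) =
        (Nat.card E : ℂ) ^ r (k - 1) * (G k - G (k - 1)) := by
      have hGm : ∀ f, G (m f) = ∑ j ∈ Finset.range k,
          if f ∈ LinearMap.range (N ^ j) then G (j + 1) - G j else 0 := by
        intro f
        have hmf : ∀ j ∈ Finset.range k, (f ∈ LinearMap.range (N ^ j) ↔ j < m f) := by
          intro j hj
          by_cases hf : f = 0
          · rw [hmtop f (by rw [hf]; exact zero_mem _), hf]
            simpa using hj
          · exact hm f hf j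
        rw [← Finset.sum_filter, Finset.filter_congr hmf,
          show (Finset.range k).filter (· < m f) = Finset.range (m f) by
            ext j
            have := hmk f
            simp only [Finset.mem_filter, Finset.mem_range]
            omega, Finset.sum_range_sub, hG0, sub_zero]
      -- summation by parts over the heights, where only the largest one contributes
      have hterm : ∀ f : V, (if N f ∈ Submodule.span E {e} then ψ (θ (N f) / α) * G (m f) else 0) =
          ∑ j ∈ Finset.range k, (G (j + 1) - G j) *
            if N f ∈ Submodule.span E {e} ∧ f ∈ LinearMap.range (N ^ j) then
              ψ (θ (N f) / α) else 0 := by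
        intro f
        by_cases hf : N f ∈ Submodule.span E {e}
        · simp only [hf, if_true, true_and]
          rw [hGm, Finset.mul_sum]
          refine Finset.sum_congr rfl fun j _ => ?_
          split_ifs <;> ring
        · simp [hf]
      rw [Finset.sum_congr rfl fun f _ => hterm f, Finset.sum_comm, Finset.sum_eq_single (k - 1)]
      · rw [← Finset.mul_sum, sum_addChar_comap_range hψ hk hge hα hθ (by omega), if_pos rfl, hN,
          Nat.sub_add_cancel hk0, mul_comm]
      · intro j hj hjk
        rw [← Finset.mul_sum, sum_addChar_comap_range hψ hk hge hα hθ (Finset.mem_range.1 hj),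
          if_neg hjk, mul_zero]
      · intro hk1
        exact absurd (Finset.mem_range.2 (by omega)) hk1
    rw [show ((Nat.card E : ℂ) ^ r (k - 1) - Nat.card E) * G k -
          (Nat.card E : ℂ) ^ r (k - 1) * G (k - 1) =
            (Nat.card E : ℂ) ^ r (k - 1) * (G k - G (k - 1))
          - Nat.card E * G k by ring, ← hsum, ← sum_ite_mem_span_singleton he,
      ← Finset.sum_sub_distrib]
    refine Finset.sum_congr rfl fun f _ => ?_
    by_cases hf : f ∈ Submodule.span E {e}
    · obtain ⟨c, rfl⟩ := Submodule.mem_span_singleton.1 hf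
      simp [hf, hNe, hmtop _ hf]
    · simp [hf]
  · intro v u hvu hv
    have h1 : N v = (u - α) • v := by
      rw [sub_smul, ← hvu]
      simp
    have h2 : ∀ j, (N ^ j) v = (u - α) ^ j • v := by
      intro j
      induction j with
      | zero => simp
      | succ j ih => rw [pow_succ', Module.End.mul_apply, ih, map_smul, h1, smul_smul, pow_succ]
    have h3 := h2 k
    rw [hk, LinearMap.zero_apply, eq_comm, smul_eq_zero_iff_left hv] at h3
    exact sub_eq_zero.1 (pow_eq_zero_iff hk0.ne' |>.1 h3)
  · intro f hf hfe
    have hf0 : f ≠ 0 := fun h => hfe (h ▸ zero_mem _)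
    have hm0 : 0 < m f := (hm f hf0 0).1 (by simp)
    rw [hmapQ _ _ (hcomap _ hf)]
    exact h _ hm0 (hmk f) _ _ (hN.mapQ_span_pair hk he hek hfe (hm f hf0) _)

end RankRecursion

/-! ### Weights in the group ring of `ℂˣ` -/

section WeightFiltration

/-- The complete homogeneous symmetric polynomial of degree `n` in two variables. -/
def completeHomogeneous {R : Type*} [CommRing R] (x y : R) : ℕ → R
  | 0 => 1
  | n + 1 => x ^ (n + 1) + y * completeHomogeneous x y n

theorem completeHomogeneous_add_two {R : Type*} [CommRing R] (x y : R) (n : ℕ) :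
    completeHomogeneous x y (n + 2) =
      (x + y) * completeHomogeneous x y (n + 1) - x * y * completeHomogeneous x y n := by
  simp only [completeHomogeneous]
  ring

/-- The sequence `completeHomogeneous`, shifted by two places and continued by zero. -/
def shiftedHomogeneous {R : Type*} [CommRing R] (x y : R) : ℕ → R
  | 0 => 0
  | 1 => 0
  | n + 2 => completeHomogeneous x y n

theorem shiftedHomogeneous_add_three {R : Type*} [CommRing R] (x y : R) (n : ℕ) :
    shiftedHomogeneous x y (n + 3) =
      (x + y) * shiftedHomogeneous x y (n + 2) - x * y * shiftedHomogeneous x y (n + 1) := by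
  cases n with
  | zero => simp only [shiftedHomogeneous, completeHomogeneous]; ring
  | succ n => exact completeHomogeneous_add_two x y n

/-- The elements of the group ring of `ℂˣ` supported on the `z` with `‖z‖ = s ^ (n + 2 j)`,
`j ≥ k`. For `s = √q` these are the `z` whose weight has the parity of `n` and is at least
`n + 2 k`. -/
def weightFiltration (s : ℝ) (n k : ℕ) : AddSubgroup (MonoidAlgebra ℤ ℂˣ) where
  carrier := {c | ∀ z, c.coeff z ≠ 0 → ∃ j ≥ k, ‖(z : ℂ)‖ = s ^ (n + 2 * j)}
  zero_mem' := by simp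
  add_mem' := by
    intro a b ha hb z hz
    by_cases h : a.coeff z = 0
    · refine hb z fun h' => hz ?_
      rw [MonoidAlgebra.coeff_add, Finsupp.add_apply, h, h', add_zero]
    · exact ha z h
  neg_mem' := by
    intro a ha z hz
    refine ha z fun h => hz ?_
    rw [MonoidAlgebra.coeff_neg, Finsupp.neg_apply, h, neg_zero]

variable {s : ℝ}

theorem weightFiltration_antitone {n k l : ℕ} (h : k ≤ l) :
    weightFiltration s n l ≤ weightFiltration s n k := by
  intro c hc z hz
  obtain ⟨j, hj, hz⟩ := hc z hz
  exact ⟨j, h.trans hj, hz⟩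

theorem one_mem_weightFiltration : (1 : MonoidAlgebra ℤ ℂˣ) ∈ weightFiltration s 0 0 := by
  intro z hz
  have : z = 1 := by
    by_contra h
    exact hz (by rw [MonoidAlgebra.one_def, MonoidAlgebra.coeff_single, Finsupp.single_apply,
      if_neg (Ne.symm h)])
  exact ⟨0, le_rfl, by simp [this]⟩

theorem single_mul_mem_weightFiltration {u : ℂˣ} {i l n k : ℕ} (hu : ‖(u : ℂ)‖ = s ^ (i + 2 * l))
    {c : MonoidAlgebra ℤ ℂˣ} (hc : c ∈ weightFiltration s n k) :
    MonoidAlgebra.single u 1 * c ∈ weightFiltration s (i + n) (l + k) := by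
  intro z hz
  rw [MonoidAlgebra.coeff_single_mul_apply, one_mul] at hz
  obtain ⟨j, hj, h⟩ := hc _ hz
  refine ⟨l + j, by omega, ?_⟩
  rw [show z = u * (u⁻¹ * z) by group, Units.val_mul, norm_mul, hu, h, ← pow_add]
  congr 1
  ring

theorem completeHomogeneous_mem_weightFiltration {u v : ℂˣ} (hu : ‖(u : ℂ)‖ = s)
    (hv : ‖(v : ℂ)‖ = s) (n : ℕ) :
    completeHomogeneous (MonoidAlgebra.single u (1 : ℤ)) (MonoidAlgebra.single v 1) n ∈
      weightFiltration s n 0 := by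
  have hpow : ∀ n, MonoidAlgebra.single u (1 : ℤ) ^ n ∈ weightFiltration s n 0 := by
    intro n
    induction n with
    | zero => exact one_mem_weightFiltration
    | succ n ih =>
      rw [pow_succ', add_comm]
      exact single_mul_mem_weightFiltration (i := 1) (l := 0) (by simpa using hu) ih
  induction n with
  | zero => exact one_mem_weightFiltration
  | succ n ih =>
    refine add_mem (hpow _) ?_
    rw [add_comm]
    exact single_mul_mem_weightFiltration (i := 1) (l := 0) (by simpa using hv) ih

theorem coeff_completeHomogeneous_nonneg (u v : ℂˣ) (n : ℕ) (z : ℂˣ) :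
    0 ≤ (completeHomogeneous (MonoidAlgebra.single u (1 : ℤ))
      (MonoidAlgebra.single v 1) n).coeff z := by
  classical
  induction n generalizing z with
  | zero =>
    rw [completeHomogeneous, MonoidAlgebra.one_def, MonoidAlgebra.coeff_single,
      Finsupp.single_apply]
    split_ifs <;> norm_num
  | succ n ih =>
    rw [completeHomogeneous, MonoidAlgebra.coeff_add, Finsupp.add_apply,
      MonoidAlgebra.coeff_single_mul_apply, one_mul, MonoidAlgebra.single_pow,
      MonoidAlgebra.coeff_single, Finsupp.single_apply]
    have := ih (v⁻¹ * z)
    split_ifs <;> simp <;> omega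

theorem coeff_completeHomogeneous_pos (u v : ℂˣ) (n : ℕ) :
    0 < (completeHomogeneous (MonoidAlgebra.single u (1 : ℤ)) (MonoidAlgebra.single v 1) n).coeff
      (u ^ n) := by
  classical
  cases n with
  | zero => simp [completeHomogeneous]
  | succ n =>
    rw [completeHomogeneous, MonoidAlgebra.coeff_add, Finsupp.add_apply,
      MonoidAlgebra.coeff_single_mul_apply, one_mul, MonoidAlgebra.single_pow,
      MonoidAlgebra.coeff_single, Finsupp.single_apply]
    have := coeff_completeHomogeneous_nonneg u v n (v⁻¹ * u ^ (n + 1))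
    simp
    omega

theorem coeff_eq_zero_of_mem_weightFiltration (hs : 1 < s) {n k i : ℕ} (hi : i < k)
    {c : MonoidAlgebra ℤ ℂˣ} (hc : c ∈ weightFiltration s n k) {z : ℂˣ}
    (hz : ‖(z : ℂ)‖ = s ^ (n + 2 * i)) : c.coeff z = 0 := by
  by_contra h
  obtain ⟨j, hj, h'⟩ := hc z h
  have := (pow_right_injective₀ (by linarith) hs.ne') (hz.symm.trans h')
  omega

/-- The element `h_n + d T² h_{n-2}` of the group ring, where `X = [u]`, `Y = [v]`, `T = [t]` and
`h` denotes complete homogeneous polynomials in `X` and `Y`. -/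
noncomputable def leadingPart (u v t : ℂˣ) (n : ℕ) (d : MonoidAlgebra ℤ ℂˣ) : MonoidAlgebra ℤ ℂˣ :=
  completeHomogeneous (MonoidAlgebra.single u (1 : ℤ)) (MonoidAlgebra.single v 1) n +
    d * (MonoidAlgebra.single t 1 ^ 2 *
      shiftedHomogeneous (MonoidAlgebra.single u (1 : ℤ)) (MonoidAlgebra.single v 1) n)

variable {u v t : ℂˣ}

theorem sq_mul_shiftedHomogeneous_mem (hu : ‖(u : ℂ)‖ = s) (hv : ‖(v : ℂ)‖ = s)
    (ht : ‖(t : ℂ)‖ = s ^ 2) (n : ℕ) :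
    MonoidAlgebra.single t 1 ^ 2 * shiftedHomogeneous (MonoidAlgebra.single u (1 : ℤ))
      (MonoidAlgebra.single v 1) n ∈ weightFiltration s n 1 := by
  match n with
  | 0 => simp [shiftedHomogeneous, zero_mem]
  | 1 => simp [shiftedHomogeneous, zero_mem]
  | n + 2 =>
    have h1 := completeHomogeneous_mem_weightFiltration hu hv n
    have h2 := single_mul_mem_weightFiltration (i := 2) (l := 0) (by simpa using ht) h1
    have h3 := single_mul_mem_weightFiltration (i := 0) (l := 1) (by simpa using ht) h2
    rw [pow_two, mul_assoc, shiftedHomogeneous]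
    rw [zero_add, add_comm 2 n] at h3
    simpa using h3

/-- Both parts of `leadingPart` have positive coefficients and different weights, so that neither
cancels in an element congruent to it modulo higher weights. -/
theorem exists_coeff_ne_zero (hs : 1 < s) (hu : ‖(u : ℂ)‖ = s) (hv : ‖(v : ℂ)‖ = s)
    (ht : ‖(t : ℂ)‖ = s ^ 2) {n : ℕ} (hn : 2 ≤ n) {H : MonoidAlgebra ℤ ℂˣ}
    (hH : H - leadingPart u v t n 1 ∈ weightFiltration s n 2) :
    ∃ z₁ z₂ : ℂˣ, H.coeff z₁ ≠ 0 ∧ H.coeff z₂ ≠ 0 ∧ ‖(z₁ : ℂ)‖ = s ^ n ∧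
      ‖(z₂ : ℂ)‖ = s ^ (n + 2) := by
  obtain ⟨n, rfl⟩ := Nat.exists_eq_add_of_le' hn
  have hH' : H = completeHomogeneous (MonoidAlgebra.single u (1 : ℤ))
      (MonoidAlgebra.single v 1) (n + 2) + MonoidAlgebra.single t 1 ^ 2 *
        shiftedHomogeneous (MonoidAlgebra.single u (1 : ℤ))
      (MonoidAlgebra.single v 1) (n + 2) + (H - leadingPart u v t (n + 2) 1) := by
    rw [leadingPart]; ring
  have hsq := sq_mul_shiftedHomogeneous_mem hu hv ht (n + 2)
  have hz₁ : ‖((u ^ (n + 2) : ℂˣ) : ℂ)‖ = s ^ (n + 2) := by simp [hu]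
  have hz₂ : ‖((t ^ 2 * u ^ n : ℂˣ) : ℂ)‖ = s ^ (n + 2 + 2) := by
    simp [hu, ht]; ring
  refine ⟨u ^ (n + 2), t ^ 2 * u ^ n, ?_, ?_, hz₁, hz₂⟩
  · rw [hH', MonoidAlgebra.coeff_add, MonoidAlgebra.coeff_add, Finsupp.add_apply,
      Finsupp.add_apply, coeff_eq_zero_of_mem_weightFiltration hs (i := 0) (by norm_num) hH
        (by simpa using hz₁), coeff_eq_zero_of_mem_weightFiltration hs (i := 0) (by norm_num) hsq
        (by simpa using hz₁), add_zero, add_zero]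
    exact (coeff_completeHomogeneous_pos u v (n + 2)).ne'
  · have h0 := coeff_completeHomogeneous_nonneg u v (n + 2) (t ^ 2 * u ^ n)
    have h1 := coeff_completeHomogeneous_pos u v n
    rw [hH', MonoidAlgebra.coeff_add, MonoidAlgebra.coeff_add, Finsupp.add_apply,
      Finsupp.add_apply, coeff_eq_zero_of_mem_weightFiltration hs (i := 1) (by norm_num) hH
        (by simpa using hz₂), add_zero, shiftedHomogeneous, MonoidAlgebra.single_pow, one_pow,
      MonoidAlgebra.coeff_single_mul_apply, one_mul, inv_mul_cancel_left]
    omega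

local notation "𝐗" => (MonoidAlgebra.single u 1 : MonoidAlgebra ℤ ℂˣ)
local notation "𝐘" => (MonoidAlgebra.single v 1 : MonoidAlgebra ℤ ℂˣ)
local notation "𝐓" => (MonoidAlgebra.single t 1 : MonoidAlgebra ℤ ℂˣ)

theorem X_add_Y_mul_mem (hu : ‖(u : ℂ)‖ = s) (hv : ‖(v : ℂ)‖ = s) {n k : ℕ}
    {c : MonoidAlgebra ℤ ℂˣ} (hc : c ∈ weightFiltration s n k) :
    (𝐗 + 𝐘) * c ∈ weightFiltration s (n + 1) k := by
  rw [add_mul]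
  have h1 := single_mul_mem_weightFiltration (u := u) (i := 1) (l := 0) (by simpa using hu) hc
  have h2 := single_mul_mem_weightFiltration (u := v) (i := 1) (l := 0) (by simpa using hv) hc
  rw [zero_add, add_comm 1 n] at h1 h2
  exact add_mem h1 h2

theorem T_mul_mem (ht : ‖(t : ℂ)‖ = s ^ 2) {n k : ℕ}
    {c : MonoidAlgebra ℤ ℂˣ} (hc : c ∈ weightFiltration s n k) :
    𝐓 * c ∈ weightFiltration s (n + 2) k := by
  have h1 := single_mul_mem_weightFiltration (u := t) (i := 2) (l := 0) (by simpa using ht) hc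
  rwa [zero_add, add_comm 2 n] at h1

theorem T_pow_mul_mem (ht : ‖(t : ℂ)‖ = s ^ 2) {n k : ℕ}
    {c : MonoidAlgebra ℤ ℂˣ} (hc : c ∈ weightFiltration s n k) (b : ℕ) :
    𝐓 ^ b * c ∈ weightFiltration s n (b + k) := by
  induction b with
  | zero => simpa using hc
  | succ b ih =>
    have h1 := single_mul_mem_weightFiltration (u := t) (i := 0) (l := 1) (by simpa using ht) ih
    rw [pow_succ', mul_assoc, add_comm b, add_assoc]
    rwa [zero_add] at h1

end WeightFiltration

/-! ### The sums as values of an element of the group ring -/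

section GroupRingElement

open Module

universe u

variable {s : ℝ} {u v t : ℂˣ}

local notation "𝐗" => (MonoidAlgebra.single u 1 : MonoidAlgebra ℤ ℂˣ)
local notation "𝐘" => (MonoidAlgebra.single v 1 : MonoidAlgebra ℤ ℂˣ)
local notation "𝐓" => (MonoidAlgebra.single t 1 : MonoidAlgebra ℤ ℂˣ)

/-- The recursion for the elements of the group ring that compute the sums preserves the shape
`leadingPart` modulo higher weights. Here `R` stands for the last term of the recursion, and `ε` for
its contribution to the second lowest weight. -/
theorem recursion_mem_weightFiltration (hu : ‖(u : ℂ)‖ = s) (hv : ‖(v : ℂ)‖ = s)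
    (huv : u * v = t) (ht : ‖(t : ℂ)‖ = s ^ 2) {n : ℕ}
    {H₁ H₂ R d₁ d₂ d ε : MonoidAlgebra ℤ ℂˣ}
    (h₁ : H₁ - leadingPart u v t (n + 1) d₁ ∈ weightFiltration s (n + 1) 2)
    (h₂ : H₂ - leadingPart u v t n d₂ ∈ weightFiltration s n 2)
    (hR : R - 𝐓 ^ 2 * ε ∈ weightFiltration s (n + 2) 2)
    (hd : (𝐗 + 𝐘) * (d₁ * shiftedHomogeneous 𝐗 𝐘 (n + 1)) -
      𝐓 * (d₂ * shiftedHomogeneous 𝐗 𝐘 n) + ε = d * shiftedHomogeneous 𝐗 𝐘 (n + 2)) :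
    (𝐗 + 𝐘) * H₁ - 𝐓 * H₂ + R - leadingPart u v t (n + 2) d ∈ weightFiltration s (n + 2) 2 := by
  have hXY : 𝐗 * 𝐘 = 𝐓 := by rw [MonoidAlgebra.single_mul_single, huv, one_mul]
  have key : (𝐗 + 𝐘) * H₁ - 𝐓 * H₂ + R - leadingPart u v t (n + 2) d =
      (𝐗 + 𝐘) * (H₁ - leadingPart u v t (n + 1) d₁) - 𝐓 * (H₂ - leadingPart u v t n d₂) +
        (R - 𝐓 ^ 2 * ε) := by
    unfold leadingPart
    rw [completeHomogeneous_add_two, hXY]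
    linear_combination 𝐓 ^ 2 * hd
  rw [key]
  exact add_mem (sub_mem (X_add_Y_mul_mem hu hv h₁) (T_mul_mem ht h₂)) hR

theorem shiftedHomogeneous_recursion (huv : u * v = t) {n : ℕ}
    {d₁ d₂ d : MonoidAlgebra ℤ ℂˣ} (h1 : d₁ = d) (h2 : d₂ = d ∨ n ≤ 1) (h0 : n = 0 → d = 0) :
    (𝐗 + 𝐘) * (d₁ * shiftedHomogeneous 𝐗 𝐘 (n + 1)) - 𝐓 * (d₂ * shiftedHomogeneous 𝐗 𝐘 n) + 0 =
      d * shiftedHomogeneous 𝐗 𝐘 (n + 2) := by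
  have hXY : 𝐗 * 𝐘 = 𝐓 := by rw [MonoidAlgebra.single_mul_single, huv, one_mul]
  subst h1
  match n with
  | 0 => simp [h0 rfl, shiftedHomogeneous]
  | n + 1 =>
    rw [shiftedHomogeneous_add_three, hXY]
    rcases h2 with rfl | h2
    · ring
    · have : n = 0 := by omega
      subst this
      simp only [shiftedHomogeneous]
      ring

theorem sub_completeHomogeneous_mem (hu : ‖(u : ℂ)‖ = s) (hv : ‖(v : ℂ)‖ = s)
    (ht : ‖(t : ℂ)‖ = s ^ 2) {n : ℕ} {H d : MonoidAlgebra ℤ ℂˣ} (hd : d = 0 ∨ d = 1)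
    (hH : H - leadingPart u v t n d ∈ weightFiltration s n 2) :
    H - completeHomogeneous 𝐗 𝐘 n ∈ weightFiltration s n 1 := by
  have h1 := add_mem (weightFiltration_antitone (show 1 ≤ 2 by norm_num) hH)
    (show d * (𝐓 ^ 2 * shiftedHomogeneous 𝐗 𝐘 n) ∈ weightFiltration s n 1 by
      rcases hd with rfl | rfl
      · rw [zero_mul]; exact zero_mem _
      · rw [one_mul]; exact sq_mul_shiftedHomogeneous_mem hu hv ht n)
  convert h1 using 1
  unfold leadingPart
  ring

/-- Inequalities for the ranks `r j` of the powers of a nilpotent endomorphism with nilpotency index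
`k`. -/
theorem HasRanks.rank_bounds {E V : Type*} [Field E] [AddCommGroup V] [Module E V]
    [FiniteDimensional E V] {N : Module.End E V} {r : ℕ → ℕ} (hN : HasRanks N r) {k : ℕ}
    (hrk : r k = 0) (hk : ∀ j < k, r j ≠ 0) (hk0 : 0 < k) :
    N ^ k = 0 ∧ N ^ (k - 1) ≠ 0 ∧ r (k - 1) + r 1 ≤ r 0 ∧ (3 ≤ k → 2 ≤ r 1) ∧
      (2 ≤ k → r (k - 1) ≤ r 1) := by
  have hNk : N ^ k = 0 := by
    rw [← LinearMap.range_eq_bot, ← Submodule.finrank_eq_zero (R := E), hN, hrk]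
  have hanti : ∀ {i j}, i ≤ j → r j ≤ r i := fun {i j} h => by
    rw [← hN i, ← hN j]
    exact Submodule.finrank_mono (range_pow_antitone N h)
  refine ⟨hNk, fun h => hk (k - 1) (by omega) ?_, ?_, fun hk3 => ?_, fun hk2 => hanti (by omega)⟩
  · rw [← hN, h]
    simp
  · have h1 := LinearMap.finrank_range_add_finrank_ker N
    have h2 : finrank E (LinearMap.range (N ^ (k - 1))) ≤ finrank E (LinearMap.ker N) := by
      refine Submodule.finrank_mono ?_
      rintro _ ⟨x, rfl⟩
      rw [LinearMap.mem_ker, ← Module.End.mul_apply, ← pow_succ', Nat.sub_add_cancel hk0, hNk,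
        LinearMap.zero_apply]
    have h3 := hN 0
    have h4 := hN 1
    rw [pow_zero, Module.End.one_eq_id, LinearMap.range_id, finrank_top] at h3
    rw [pow_one] at h4
    rw [hN] at h2
    omega
  · by_contra hlt
    -- if `r 1 = r 2 = 1`, then the images of `N` and `N²` agree, and so `N` is not nilpotent
    have hr2 : r 2 ≠ 0 := hk 2 (by omega)
    have h12 : r 2 ≤ r 1 := hanti (by omega)
    have heq : LinearMap.range (N ^ 2) = LinearMap.range (N ^ 1) :=
      Submodule.eq_of_le_of_finrank_eq (range_pow_antitone N (by omega)) (by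
        rw [hN, hN]; omega)
    have hstable : ∀ j, LinearMap.range (N ^ (j + 1)) = LinearMap.range (N ^ 1) := by
      intro j
      induction j with
      | zero => rfl
      | succ j ih =>
        rw [pow_succ', Module.End.mul_eq_comp, LinearMap.range_comp, ih, ← LinearMap.range_comp,
          ← Module.End.mul_eq_comp, ← pow_succ', heq]
    have h5 := hstable (k - 1)
    rw [Nat.sub_add_cancel hk0] at h5
    have h6 := hN 1
    rw [← h5, hN, hrk] at h6
    omega

/-- The ring homomorphism from the group ring of `ℂˣ` sending `∑ c(z) [z]` to `∑ c(z) z ^ m`. -/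
noncomputable def powerSumEval (m : ℕ) : MonoidAlgebra ℤ ℂˣ →+* ℂ :=
  (MonoidAlgebra.lift ℤ ℂ ℂˣ ((Units.coeHom ℂ).comp (powMonoidHom m))).toRingHom

theorem powerSumEval_single (m : ℕ) (z : ℂˣ) (k : ℤ) :
    powerSumEval m (MonoidAlgebra.single z k) = k * (z : ℂ) ^ m := by
  simp [powerSumEval]

theorem powerSumEval_apply (m : ℕ) (c : MonoidAlgebra ℤ ℂˣ) :
    powerSumEval m c = c.coeff.sum fun z k => (k : ℂ) * (z : ℂ) ^ m := by
  simp [powerSumEval, MonoidAlgebra.lift_apply]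

theorem glSum_of_finrank_eq_zero {E V : Type*} [Field E] [AddCommGroup V] [Module E V]
    [FiniteDimensional E V] (h : finrank E V = 0) (ψ : AddChar E ℂ) (a : V →ₗ[E] V) :
    glSum ψ a = 1 := by
  have : Subsingleton V := Module.finrank_zero_iff.1 h
  have h0 : ∀ f : V →ₗ[E] V, LinearMap.trace E V f = 0 := fun f => by
    rw [Subsingleton.elim f 0, map_zero]
  have : Unique (V ≃ₗ[E] V) :=
    ⟨⟨LinearEquiv.refl E V⟩, fun y => by ext v; exact Subsingleton.elim _ _⟩
  rw [glSum, finsum_unique, glWeight, h0, h0, add_zero, AddChar.map_zero_eq_one]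
/-- The element `H` of the group ring computes the Kloosterman sums attached to `α + N` with `N` of
type `r`, over all the fields whose Kloosterman sum at `α` is `-(u ^ m + v ^ m)` and whose
cardinality is `t ^ m`. -/
def ComputesGLSum (u v t : ℂˣ) (r : ℕ → ℕ) (H : MonoidAlgebra ℤ ℂˣ) : Prop :=
  ∀ (E : Type u) [Field E] [Finite E] (ψ : AddChar E ℂ) (α : E) (m : ℕ), ψ ≠ 1 → α ≠ 0 →
    (Nat.card E : ℂ) = (t : ℂ) ^ m → kloostermanSum ψ α = -((u : ℂ) ^ m + (v : ℂ) ^ m) →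
    ∀ (V : Type u) [AddCommGroup V] [Module E V] [FiniteDimensional E V] (N : Module.End E V),
      HasRanks N r → glSum ψ (α • 1 + N) =
        (-1) ^ r 0 * ((t : ℂ) ^ m) ^ (r 0).choose 2 * powerSumEval m H

/-- The recursion `glSum_rank_recursion` in the group ring. The exponents of `q` and the signs agree
because `n.choose 2 = (n - 1) + (n - 1).choose 2`. -/
theorem computesGLSum_recursion {r : ℕ → ℕ} {k : ℕ} (hrk : r k = 0) (hk : ∀ j < k, r j ≠ 0)
    (hk0 : 0 < k) {H₁ H₂ H₃ : MonoidAlgebra ℤ ℂˣ}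
    (h₁ : ComputesGLSum.{u} u v t (lowerBelow r k) H₁)
    {Hf : ℕ → MonoidAlgebra ℤ ℂˣ}
    (hf : ∀ m, 0 < m → ComputesGLSum.{u} u v t (lowerBelow (lowerBelow r k) m) (Hf m))
    (h₂ : H₂ = Hf k) (h₃ : H₃ = if k = 1 then 0 else Hf (k - 1)) :
    ComputesGLSum.{u} u v t r ((𝐗 + 𝐘) * H₁ - 𝐓 * H₂ + 𝐓 ^ r (k - 1) * (H₂ - H₃)) := by
  intro E _ _ ψ α m hψ hα hcard hKl V _ _ _ N hN
  obtain ⟨hNk, hNk', hr01, hk3, hk2⟩ := hN.rank_bounds hrk hk hk0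
  have hb : r (k - 1) ≠ 0 := hk _ (by omega)
  have hr0 : r 0 ≠ 0 := hk 0 hk0
  have hlow : ∀ m, 0 < m → lowerBelow (lowerBelow r k) m 0 = r 0 - 2 := by
    intro m hm
    simp [lowerBelow, hm, hk0]
    omega
  have hlow1 : lowerBelow r k 0 = r 0 - 1 := by simp [lowerBelow, hk0]
  set Q : ℂ := (t : ℂ) ^ m with hQ
  have hX : powerSumEval m 𝐗 = (u : ℂ) ^ m := by simp [powerSumEval_single]
  have hY : powerSumEval m 𝐘 = (v : ℂ) ^ m := by simp [powerSumEval_single]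
  have hT : powerSumEval m 𝐓 = Q := by simp [powerSumEval_single, hQ]
  rw [glSum_rank_recursion hψ hα hN hNk hNk'
    ((-1) ^ (r 0 - 1) * Q ^ (r 0 - 1).choose 2 * powerSumEval m H₁)
    (fun i => if i = 0 then 0 else
      (-1) ^ (r 0 - 2) * Q ^ (r 0 - 2).choose 2 * powerSumEval m (Hf i))
    (by simp) ?_ ?_, hKl, hcard, ← hX, ← hY, map_add, map_sub, map_mul, map_mul, map_mul, map_add,
    map_pow, map_sub, hT, h₂]
  · have h3' : powerSumEval m H₃ = if k - 1 = 0 then 0 else powerSumEval m (Hf (k - 1)) := by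
      rw [h₃]
      by_cases h : k = 1
      · simp [h]
      · rw [if_neg h, if_neg (by omega)]
    by_cases hr1 : r 0 = 1
    · have hb1 : r (k - 1) = 1 := by omega
      have hk1 : k = 1 := by
        by_contra h
        have := hk 1 (by omega)
        omega
      rw [h3', hb1, hr1, hk1]
      simp
      ring
    · obtain ⟨n, hn⟩ := Nat.exists_eq_add_of_le' (show 2 ≤ r 0 by omega)
      obtain ⟨b, hb'⟩ := Nat.exists_eq_succ_of_ne_zero hb
      have hc1 : (n + 2).choose 2 = (n + 1) + (n + 1).choose 2 := by
        rw [Nat.choose_succ_succ' (n + 1) 1, Nat.choose_one_right]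
      have hc2 : (n + 1).choose 2 = n + n.choose 2 := by
        rw [Nat.choose_succ_succ' n 1, Nat.choose_one_right]
      rw [h3', hb', hn, if_neg hk0.ne', hc1, hc2]
      simp only [Nat.add_sub_cancel, show n + 2 - 1 = n + 1 by omega, hc2]
      split_ifs <;> ring
  · intro V' _ _ _ N' hN'
    rw [h₁ E ψ α m hψ hα hcard hKl V' N' hN', hlow1]
  · intro i hi _ V' _ _ _ N' hN'
    rw [hf i hi E ψ α m hψ hα hcard hKl V' N' hN', hlow i hi, if_neg hi.ne']

/-- The sums attached to `α + N`, for `N` nilpotent of type `r`, are given by an element of the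
group ring whose lowest part is `h_n`, and whose part of the next weight is `T² h_{n-2}` if `N` has
at least two Jordan blocks. -/
theorem exists_computesGLSum (hu : ‖(u : ℂ)‖ = s) (hv : ‖(v : ℂ)‖ = s)
    (huv : u * v = t) (ht : ‖(t : ℂ)‖ = s ^ 2) (n : ℕ) :
    ∀ r : ℕ → ℕ, r 0 = n → (∃ k, r k = 0) → ∃ H,
      H - leadingPart u v t n (if 2 ≤ r 0 - r 1 then 1 else 0) ∈ weightFiltration s n 2 ∧
      ComputesGLSum.{u} u v t r H := by
  induction n using Nat.strong_induction_on with
  | _ n ih =>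
  intro r hrn hex
  -- a sequence `r` which is not a type imposes no condition on the sums
  by_cases hreal : ∃ (E : Type u) (_ : Field E) (V : Type u) (_ : AddCommGroup V) (_ : Module E V)
      (_ : FiniteDimensional E V) (N : Module.End E V), HasRanks N r
  swap
  · refine ⟨leadingPart u v t n (if 2 ≤ r 0 - r 1 then 1 else 0), by simp [zero_mem], ?_⟩
    intro E _ _ ψ α m _ _ _ _ V _ _ _ N hN
    exact absurd ⟨E, _, V, _, _, inferInstance, N, hN⟩ hreal
  obtain ⟨E, _, V, _, _, _, N, hN⟩ := hreal
  rcases Nat.eq_zero_or_pos n with hn0 | hn0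
  · refine ⟨1, ?_, ?_⟩
    · simp [hrn, hn0, leadingPart, completeHomogeneous, zero_mem]
    · intro E _ _ ψ α m _ _ _ _ V _ _ _ N hN
      have h0 := hN 0
      rw [pow_zero, Module.End.one_eq_id, LinearMap.range_id, finrank_top, hrn, hn0] at h0
      rw [glSum_of_finrank_eq_zero h0, hrn, hn0]
      simp
  classical
  let k := Nat.find hex
  have hrk : r k = 0 := Nat.find_spec hex
  have hk : ∀ j < k, r j ≠ 0 := fun j hj => Nat.find_min hex hj
  have hk0 : 0 < k := by
    by_contra h
    have h1 : k = 0 := by omega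
    rw [h1] at hrk
    omega
  obtain ⟨-, -, hr01, hk3, hk2⟩ := hN.rank_bounds hrk hk hk0
  have hb : r (k - 1) ≠ 0 := hk _ (by omega)
  have hlow1 : lowerBelow r k 0 = n - 1 := by simp [lowerBelow, hk0, hrn]
  have hlowk : lowerBelow r k k = 0 := by simp [lowerBelow, hrk]
  obtain ⟨H₁, hH₁, hc₁⟩ := ih (n - 1) (by omega) (lowerBelow r k) hlow1 ⟨k, hlowk⟩
  have hlow2 : ∀ m, 0 < m → lowerBelow (lowerBelow r k) m 0 = n - 2 := by
    intro m hm
    simp [lowerBelow, hm, hk0, hrn]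
    omega
  have hf : ∀ m, ∃ H, 0 < m → H - leadingPart u v t (n - 2)
      (if 2 ≤ (n - 2) - lowerBelow (lowerBelow r k) m 1 then 1 else 0) ∈
        weightFiltration s (n - 2) 2 ∧
      ComputesGLSum.{u} u v t (lowerBelow (lowerBelow r k) m) H := by
    intro m
    by_cases hm : 0 < m
    · obtain ⟨H, h1, h2⟩ := ih (n - 2) (by omega) (lowerBelow (lowerBelow r k) m) (hlow2 m hm)
        ⟨k, by simp [lowerBelow, hrk]⟩
      rw [hlow2 m hm] at h1
      exact ⟨H, fun _ => ⟨h1, h2⟩⟩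
    · exact ⟨0, fun h => absurd h hm⟩
  choose Hf hHf using hf
  refine ⟨_, ?_, computesGLSum_recursion hrk hk hk0 hc₁ (fun m hm => (hHf m hm).2) rfl rfl⟩
  rw [hlow1] at hH₁
  obtain hn1 | hn2 : n = 1 ∨ 2 ≤ n := by omega
  · -- here `r 0 = 1`, and the terms with `H₂` cancel
    have hb1 : r (k - 1) = 1 := by omega
    have hk1 : k = 1 := by
      by_contra h
      have := hk 1 (by omega)
      omega
    rw [hn1] at hH₁ ⊢
    have h1 := X_add_Y_mul_mem (u := u) (v := v) hu hv hH₁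
    rw [hb1, hk1, if_pos rfl]
    convert h1 using 1
    simp only [leadingPart, Nat.sub_self, completeHomogeneous, shiftedHomogeneous]
    ring
  obtain ⟨n, rfl⟩ := Nat.exists_eq_add_of_le' hn2
  simp only [show n + 2 - 1 = n + 1 by omega, Nat.add_sub_cancel] at hH₁ hHf hlow1 hlow2
  obtain ⟨hH₂, -⟩ := hHf k hk0
  have hl1 : lowerBelow r k 1 = r 1 - if 1 < k then 1 else 0 := rfl
  have hl2 : lowerBelow (lowerBelow r k) k 1 =
    (r 1 - if 1 < k then 1 else 0) - if 1 < k then 1 else 0 := rfl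
  rw [hl1] at hH₁
  rw [hl2] at hH₂
  have hr1k : k = 1 → r 1 = 0 := fun h => h ▸ hrk
  have hr1k' : 1 < k → r 1 ≠ 0 := fun h => hk 1 h
  obtain hb1 | hb2 : r (k - 1) = 1 ∨ 2 ≤ r (k - 1) := by omega
  · -- there is one largest Jordan block, and the terms with `Hf k` combine to `-T H₃`
    have hk1 : 2 ≤ k := by
      by_contra h
      have h1 : k = 1 := by omega
      rw [h1] at hb1
      simp only [Nat.sub_self] at hb1
      omega
    obtain ⟨hH₃, -⟩ := hHf (k - 1) (by omega)
    have hl3 : lowerBelow (lowerBelow r k) (k - 1) 1 = (r 1 - if 1 < k then 1 else 0) -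
      if 1 < k - 1 then 1 else 0 := rfl
    rw [hl3] at hH₃
    have hmem := recursion_mem_weightFiltration (R := 0) (ε := 0) hu hv huv ht hH₁ hH₃
      (by simp [zero_mem])
      (d := if 2 ≤ r 0 - r 1 then 1 else 0) (shiftedHomogeneous_recursion huv ?_ ?_ ?_)
    · convert hmem using 2
      rw [if_neg (show ¬ k = 1 by omega), hb1]
      ring
    · have := hr1k' hk1
      congr 1
      rw [if_pos (show 1 < k by omega), hrn]
      simp only [eq_iff_iff]
      omega
    · rw [if_pos (show 1 < k by omega), hrn]
      by_cases hn : n ≤ 1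
      · exact Or.inr hn
      · left
        congr 1
        simp only [eq_iff_iff]
        by_cases hk2' : k = 2
        · rw [hk2'] at hb1 ⊢
          simp only [show 2 - 1 = 1 from rfl] at hb1
          simp only [lt_self_iff_false, show 2 - 1 = 1 from rfl, if_false]
          omega
        · have := hk3 (by omega)
          rw [if_pos (show 1 < k - 1 by omega)]
          omega
    · intro h
      have := hr1k' hk1
      rw [if_neg (by omega)]
  · -- there are at least two largest Jordan blocks, and the last term has high weight
    obtain ⟨b, hb'⟩ := Nat.exists_eq_add_of_le' hb2
    have hsplit : ∀ c, 𝐓 ^ r (k - 1) * c = 𝐓 * (𝐓 ^ (b + 1) * c) := fun c => by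
      rw [hb']
      ring
    have hd : (if 2 ≤ r 0 - r 1 then 1 else 0 : MonoidAlgebra ℤ ℂˣ) = 1 := by
      rw [if_pos]
      by_cases hk1 : k = 1
      · have := hr1k hk1
        omega
      · omega
    have h2 := sub_completeHomogeneous_mem hu hv ht (by split_ifs <;> simp) hH₂
    rw [hd]
    have hd₁ : (if 2 ≤ n + 1 - (r 1 - if 1 < k then 1 else 0) then 1 else 0 :
        MonoidAlgebra ℤ ℂˣ) = 1 ∨ n = 0 := by
      by_cases hn0 : n = 0
      · exact Or.inr hn0
      · left
        rw [if_pos]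
        by_cases hk1 : k = 1
        · have := hr1k hk1
          omega
        · rw [if_pos (by omega)]
          omega
    by_cases hk1 : k = 1
    · have hr1 := hr1k hk1
      have hbn : b = n := by
        rw [hk1] at hb'
        simp only [Nat.sub_self] at hb'
        omega
      rw [if_pos hk1, sub_zero]
      by_cases hn0 : n = 0
      · subst hn0
        refine recursion_mem_weightFiltration (ε := 1) hu hv huv ht hH₁ hH₂ ?_
          (by simp [shiftedHomogeneous, completeHomogeneous])
        rw [hsplit, hbn, show 𝐓 * (𝐓 ^ (0 + 1) * Hf k) - 𝐓 ^ 2 * 1 =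
          𝐓 * (𝐓 ^ 1 * (Hf k - completeHomogeneous 𝐗 𝐘 0)) by
            simp only [completeHomogeneous]; ring]
        exact T_mul_mem ht (T_pow_mul_mem ht h2 1)
      · refine recursion_mem_weightFiltration (ε := 0) hu hv huv ht hH₁ hH₂ ?_
          (shiftedHomogeneous_recursion huv (hd₁.resolve_right hn0) ?_ (fun h => absurd h hn0))
        · rw [mul_zero, sub_zero, hsplit]
          refine T_mul_mem ht (weightFiltration_antitone (show 2 ≤ b + 1 + 0 by omega)
            (T_pow_mul_mem ht ?_ (b + 1)))
          have := add_mem (weightFiltration_antitone (Nat.zero_le 1) h2)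
            (completeHomogeneous_mem_weightFiltration hu hv n)
          rwa [sub_add_cancel] at this
        · by_cases hn : n ≤ 1
          · exact Or.inr hn
          · left
            rw [if_pos (by omega)]
    · have hk2' : 2 ≤ k := by omega
      have := hk2 hk2'
      have hn0 : n ≠ 0 := by omega
      obtain ⟨hH₃, -⟩ := hHf (k - 1) (by omega)
      have h3 := sub_completeHomogeneous_mem hu hv ht (by split_ifs <;> simp) hH₃
      rw [if_neg hk1]
      refine recursion_mem_weightFiltration (ε := 0) hu hv huv ht hH₁ hH₂ ?_
          (shiftedHomogeneous_recursion huv (hd₁.resolve_right hn0) ?_ (fun h => absurd h hn0))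
      · rw [mul_zero, sub_zero, hsplit]
        refine T_mul_mem ht (weightFiltration_antitone (show 2 ≤ b + 1 + 1 by omega)
            (T_pow_mul_mem ht ?_ (b + 1)))
        have := sub_mem h2 h3
        rwa [sub_sub_sub_cancel_right] at this
      · left
        rw [if_pos (show 1 < k by omega), if_pos (by omega)]

end GroupRingElement

/-! ### The `L`-function of the Kloosterman sums -/

section LFunction

open Polynomial Module

variable {F : Type*} [Field F]

/-- The function `f ↦ ψ (∑ r + α ∑ r⁻¹)`, the sums being over the roots `r` of `f`, on monic
polynomials `f` with `f(0) ≠ 0`, continued by zero. -/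
noncomputable def rootWeight (ψ : AddChar F ℂ) (α : F) (f : F[X]) : ℂ :=
  open Classical in
  if f.coeff 0 = 0 then 0 else ψ (-f.nextCoeff - α * (f.coeff 1 / f.coeff 0))

theorem rootWeight_one (ψ : AddChar F ℂ) (α : F) : rootWeight ψ α 1 = 1 := by
  simp [rootWeight, nextCoeff, coeff_one]

theorem rootWeight_mul (ψ : AddChar F ℂ) (α : F) {f g : F[X]} (hf : f.Monic) (hg : g.Monic) :
    rootWeight ψ α (f * g) = rootWeight ψ α f * rootWeight ψ α g := by
  unfold rootWeight
  rw [mul_coeff_zero]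
  by_cases h1 : f.coeff 0 = 0
  · simp [h1]
  by_cases h2 : g.coeff 0 = 0
  · simp [h2]
  rw [if_neg h1, if_neg h2, if_neg (mul_ne_zero h1 h2), ← AddChar.map_add_eq_mul,
    hf.nextCoeff_mul hg, mul_coeff_one]
  congr 1
  field_simp
  ring

theorem rootWeight_pow (ψ : AddChar F ℂ) (α : F) {f : F[X]} (hf : f.Monic) (n : ℕ) :
    rootWeight ψ α (f ^ n) = rootWeight ψ α f ^ n := by
  induction n with
  | zero => simp [rootWeight_one]
  | succ n ih => rw [pow_succ, rootWeight_mul ψ α (hf.pow n) hf, ih, pow_succ]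

section Trace

variable {E : Type*} [Field E] [Algebra F E] [FiniteDimensional F E]

/-- The minimal polynomial of `x⁻¹` is the normalized reverse of the minimal polynomial of `x`. -/
theorem nextCoeff_minpoly_inv {x : E} (hx : x ≠ 0) :
    (minpoly F x⁻¹).nextCoeff = (minpoly F x).coeff 1 / (minpoly F x).coeff 0 := by
  have hint : IsIntegral F x := Algebra.IsIntegral.isIntegral x
  have hint' : IsIntegral F x⁻¹ := Algebra.IsIntegral.isIntegral x⁻¹
  set P := minpoly F x with hP
  have h0 : P.coeff 0 ≠ 0 := minpoly.coeff_zero_ne_zero hint hx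
  have hdeg0 : 0 < P.natDegree := minpoly.natDegree_pos hint
  have hroot : aeval x⁻¹ P.reverse = 0 := by
    let _ := invertibleOfNonzero hx
    have h := Polynomial.eval₂_reverse_eq_zero_iff (algebraMap F E) x P
    rw [invOf_eq_inv] at h
    have h2 : eval₂ (algebraMap F E) x P = 0 := minpoly.aeval F x
    rwa [← h] at h2
  have hlc : P.reverse.leadingCoeff = P.coeff 0 := by
    rw [reverse_leadingCoeff, trailingCoeff, natTrailingDegree_eq_zero.2 (Or.inr h0)]
  have hdeg : P.reverse.natDegree = P.natDegree := by
    rw [reverse_natDegree, natTrailingDegree_eq_zero.2 (Or.inr h0), Nat.sub_zero]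
  have hmonic : (P.reverse * C (P.coeff 0)⁻¹).Monic := by
    have := monic_mul_leadingCoeff_inv (p := P.reverse) (by
      intro h
      rw [h, leadingCoeff_zero] at hlc
      exact h0 hlc.symm)
    rwa [hlc] at this
  have hadj : IntermediateField.adjoin F {x⁻¹} = IntermediateField.adjoin F {x} := by
    refine le_antisymm ?_ ?_
    · rw [IntermediateField.adjoin_simple_le_iff]
      exact inv_mem (IntermediateField.mem_adjoin_simple_self F x)
    · rw [IntermediateField.adjoin_simple_le_iff]
      have := inv_mem (IntermediateField.mem_adjoin_simple_self F x⁻¹)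
      rwa [inv_inv] at this
  have heq : P.reverse * C (P.coeff 0)⁻¹ = minpoly F x⁻¹ := by
    refine eq_of_monic_of_dvd_of_natDegree_le (minpoly.monic hint') hmonic (minpoly.dvd _ _ ?_) ?_
    · rw [map_mul, hroot, zero_mul]
    · rw [natDegree_mul_C (inv_ne_zero h0), hdeg, ← IntermediateField.adjoin.finrank hint',
        hadj, IntermediateField.adjoin.finrank hint]
  have hd : (P.reverse * C (P.coeff 0)⁻¹).natDegree = P.natDegree := by
    rw [natDegree_mul_C (inv_ne_zero h0), hdeg]
  rw [← heq, nextCoeff, hd, if_neg hdeg0.ne', coeff_mul_C, coeff_reverse, div_eq_mul_inv]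
  congr 2
  rw [revAt_le (by omega)]
  omega

/-- The summand of the Kloosterman sum at `x` depends only on the minimal polynomial of `x`. -/
theorem addChar_trace_eq_rootWeight (ψ : AddChar F ℂ) (α : F) {x : E} (hx : x ≠ 0) :
    ψ (Algebra.trace F E (x + algebraMap F E α * x⁻¹)) =
      rootWeight ψ α (minpoly F x) ^ (finrank F E / (minpoly F x).natDegree) := by
  have hint : IsIntegral F x := Algebra.IsIntegral.isIntegral x
  have hadj : IntermediateField.adjoin F {x⁻¹} = IntermediateField.adjoin F {x} := by
    refine le_antisymm ?_ ?_
    · rw [IntermediateField.adjoin_simple_le_iff]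
      exact inv_mem (IntermediateField.mem_adjoin_simple_self F x)
    · rw [IntermediateField.adjoin_simple_le_iff]
      have := inv_mem (IntermediateField.mem_adjoin_simple_self F x⁻¹)
      rwa [inv_inv] at this
  have hk : finrank F E / (minpoly F x).natDegree = finrank (IntermediateField.adjoin F {x}) E := by
    rw [← IntermediateField.adjoin.finrank hint]
    refine Nat.div_eq_of_eq_mul_right finrank_pos ?_
    rw [Module.finrank_mul_finrank]
  rw [hk, rootWeight, if_neg (minpoly.coeff_zero_ne_zero hint hx), ← AddChar.map_nsmul_eq_pow,
    map_add, trace_eq_finrank_mul_minpoly_nextCoeff, ← Algebra.smul_def, map_smul,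
    trace_eq_finrank_mul_minpoly_nextCoeff, hadj, nextCoeff_minpoly_inv hx, nsmul_eq_mul,
    smul_eq_mul]
  congr 1
  ring

end Trace

section Euler

theorem finite_monic_natDegree [Finite F] (d : ℕ) :
    {f : F[X] | f.Monic ∧ f.natDegree = d}.Finite := by
  have : Finite (degreeLT F (d + 1)) := Finite.of_equiv _ (degreeLTEquiv F (d + 1)).symm.toEquiv
  refine Set.Finite.subset (Set.toFinite (degreeLT F (d + 1) : Set F[X])) ?_
  rintro f ⟨hf, hd⟩
  rw [SetLike.mem_coe, mem_degreeLT, degree_eq_natDegree hf.ne_zero, hd]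
  exact_mod_cast Nat.lt_succ_self d

/-- The monic polynomials of degree `d`. -/
noncomputable def monicsOfDegree (F : Type*) [Field F] [Finite F] (d : ℕ) : Finset F[X] :=
  (finite_monic_natDegree d).toFinset

variable [Finite F]

theorem mem_monicsOfDegree {d : ℕ} {f : F[X]} :
    f ∈ monicsOfDegree F d ↔ f.Monic ∧ f.natDegree = d := by
  simp [monicsOfDegree]

/-- The monic irreducible polynomials of degree at most `d`. -/
noncomputable def irreduciblesUpTo (F : Type*) [Field F] [Finite F] (d : ℕ) : Finset F[X] :=
  open Classical in ((Finset.range (d + 1)).biUnion (monicsOfDegree F)).filter Irreducible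

theorem mem_irreduciblesUpTo {d : ℕ} {P : F[X]} :
    P ∈ irreduciblesUpTo F d ↔ P.Monic ∧ P.natDegree ≤ d ∧ Irreducible P := by
  classical
  simp [irreduciblesUpTo, mem_monicsOfDegree]
  tauto

/-- The coefficients of the `L`-function as a power series. -/
noncomputable def lCoeff (ψ : AddChar F ℂ) (α : F) (d : ℕ) : ℂ :=
  ∑ f ∈ monicsOfDegree F d, rootWeight ψ α f

/-- The coefficients of the logarithmic derivative of the `L`-function as an Euler product. -/
noncomputable def eulerSum (ψ : AddChar F ℂ) (α : F) (m : ℕ) : ℂ :=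
  ∑ P ∈ (irreduciblesUpTo F m).filter (fun P => P.natDegree ∣ m),
    P.natDegree * rootWeight ψ α P ^ (m / P.natDegree)

theorem sum_monicsOfDegree_dvd (ψ : AddChar F ℂ) (α : F) {g : F[X]} (hg : g.Monic) (d : ℕ)
    [DecidablePred (g ∣ ·)] :
    ∑ f ∈ monicsOfDegree F d, (if g ∣ f then rootWeight ψ α f else 0) =
      if g.natDegree ≤ d then rootWeight ψ α g * lCoeff ψ α (d - g.natDegree) else 0 := by
  classical
  split_ifs with hd
  · rw [← Finset.sum_filter, lCoeff, Finset.mul_sum]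
    symm
    refine Finset.sum_bij (fun f _ => g * f) ?_ ?_ ?_ ?_
    · intro f hf
      rw [mem_monicsOfDegree] at hf
      rw [Finset.mem_filter, mem_monicsOfDegree]
      refine ⟨⟨hg.mul hf.1, ?_⟩, dvd_mul_right _ _⟩
      rw [hg.natDegree_mul hf.1, hf.2]
      omega
    · intro f _ f' _ h
      exact mul_left_cancel₀ hg.ne_zero h
    · intro f hf
      rw [Finset.mem_filter, mem_monicsOfDegree] at hf
      obtain ⟨⟨hf, hfd⟩, f', rfl⟩ := hf
      have hf' : f'.Monic := hg.of_mul_monic_left hf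
      refine ⟨f', ?_, rfl⟩
      rw [mem_monicsOfDegree]
      rw [hg.natDegree_mul hf'] at hfd
      exact ⟨hf', by omega⟩
    · intro f hf
      rw [mem_monicsOfDegree] at hf
      rw [rootWeight_mul ψ α hg hf.1]
  · refine Finset.sum_eq_zero fun f hf => ?_
    rw [mem_monicsOfDegree] at hf
    rw [if_neg]
    intro h
    have := natDegree_le_of_dvd h hf.1.ne_zero
    omega

/-- The degree of a monic polynomial, counted through the powers of irreducibles dividing it. -/
theorem natDegree_eq_sum_sum_dvd {d : ℕ} {f : F[X]} (hf : f ∈ monicsOfDegree F d)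
    [∀ g : F[X], DecidablePred (g ∣ ·)] :
    d = ∑ P ∈ irreduciblesUpTo F d, ∑ j ∈ Finset.Icc 1 d, if P ^ j ∣ f then P.natDegree else 0 := by
  classical
  rw [mem_monicsOfDegree] at hf
  obtain ⟨hf, hd⟩ := hf
  set s := UniqueFactorizationMonoid.normalizedFactors f with hs
  have hsm : ∀ P ∈ s, P ∈ irreduciblesUpTo F d := by
    intro P hP
    rw [mem_irreduciblesUpTo]
    have hirr := UniqueFactorizationMonoid.irreducible_of_normalized_factor P hP
    refine ⟨?_, ?_, hirr⟩
    · rw [← UniqueFactorizationMonoid.normalize_normalized_factor P hP]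
      exact monic_normalize hirr.ne_zero
    · rw [← hd]
      exact natDegree_le_of_dvd (UniqueFactorizationMonoid.dvd_of_mem_normalizedFactors hP)
        hf.ne_zero
  have hcount : ∀ P ∈ irreduciblesUpTo F d, ∀ j, P ^ j ∣ f ↔ j ≤ s.count P := by
    intro P hP j
    rw [mem_irreduciblesUpTo] at hP
    rw [UniqueFactorizationMonoid.dvd_iff_normalizedFactors_le_normalizedFactors
      (pow_ne_zero _ hP.2.2.ne_zero) hf.ne_zero, UniqueFactorizationMonoid.normalizedFactors_pow,
      UniqueFactorizationMonoid.normalizedFactors_irreducible hP.2.2, hP.1.normalize_eq_self,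
      Multiset.nsmul_singleton, ← Multiset.le_count_iff_replicate_le]
  have hsum : d = ∑ P ∈ irreduciblesUpTo F d, s.count P * P.natDegree := by
    have h1 : s.prod = f := by
      have := UniqueFactorizationMonoid.prod_normalizedFactors_eq hf.ne_zero
      rw [this, hf.normalize_eq_self]
    have h2 : (s.map natDegree).sum = d := by
      rw [← hd, ← h1, natDegree_multiset_prod_of_monic]
      intro P hP
      exact (mem_irreduciblesUpTo.1 (hsm P hP)).1
    refine h2.symm.trans ?_
    rw [Finset.sum_multiset_map_count]
    refine Finset.sum_subset_zero_on_sdiff (fun P hP => hsm P (by simpa using hP)) ?_ ?_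
    · intro P hP
      rw [Finset.mem_sdiff, Multiset.mem_toFinset] at hP
      rw [Multiset.count_eq_zero_of_notMem hP.2, zero_mul]
    · intro P _
      simp
  have hle : ∀ P ∈ irreduciblesUpTo F d, s.count P ≤ d := by
    intro P hP
    have h1 := Finset.single_le_sum (f := fun P => s.count P * P.natDegree)
      (fun _ _ => Nat.zero_le _) hP
    have h2 : 1 ≤ P.natDegree := (mem_irreduciblesUpTo.1 hP).2.2.natDegree_pos
    rw [← hsum] at h1
    nlinarith
  conv_lhs => rw [hsum]
  refine Finset.sum_congr rfl fun P hP => ?_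
  rw [← Finset.sum_filter, Finset.sum_const, smul_eq_mul]
  congr 1
  rw [Finset.filter_congr fun j _ => hcount P hP j, show (Finset.Icc 1 d).filter (· ≤ s.count P) =
    Finset.Icc 1 (s.count P) by
      ext j
      have := hle P hP
      simp only [Finset.mem_filter, Finset.mem_Icc]
      omega, Nat.card_Icc]
  omega

/-- The logarithmic derivative of the Euler product. -/
theorem natCast_mul_lCoeff (ψ : AddChar F ℂ) (α : F) (d : ℕ) :
    d * lCoeff ψ α d = ∑ k ∈ Finset.Icc 1 d, eulerSum ψ α k * lCoeff ψ α (d - k) := by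
  classical
  have h1 : d * lCoeff ψ α d = ∑ P ∈ irreduciblesUpTo F d, ∑ j ∈ Finset.Icc 1 d,
      (P.natDegree : ℂ) * if j * P.natDegree ≤ d then
        rootWeight ψ α P ^ j * lCoeff ψ α (d - j * P.natDegree) else 0 := by
    rw [lCoeff, Finset.mul_sum]
    rw [Finset.sum_congr rfl fun f hf => show (d : ℂ) * rootWeight ψ α f =
      ∑ P ∈ irreduciblesUpTo F d, ∑ j ∈ Finset.Icc 1 d, (P.natDegree : ℂ) *
        if P ^ j ∣ f then rootWeight ψ α f else 0 from ?_, Finset.sum_comm]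
    · refine Finset.sum_congr rfl fun P hP => ?_
      rw [Finset.sum_comm]
      refine Finset.sum_congr rfl fun j _ => ?_
      have hP' := (mem_irreduciblesUpTo.1 hP).1
      rw [← Finset.mul_sum, sum_monicsOfDegree_dvd ψ α (hP'.pow j), hP'.natDegree_pow,
        rootWeight_pow ψ α hP']
    · conv_lhs => rw [natDegree_eq_sum_sum_dvd hf]
      push_cast
      rw [Finset.sum_mul]
      refine Finset.sum_congr rfl fun P _ => ?_
      rw [Finset.sum_mul]
      refine Finset.sum_congr rfl fun j _ => ?_
      split_ifs <;> simp
  have h2 : ∀ P ∈ irreduciblesUpTo F d, ∑ j ∈ Finset.Icc 1 d,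
      ((P.natDegree : ℂ) * if j * P.natDegree ≤ d then
        rootWeight ψ α P ^ j * lCoeff ψ α (d - j * P.natDegree) else 0) =
      ∑ k ∈ Finset.Icc 1 d, if P.natDegree ∣ k then
        P.natDegree * rootWeight ψ α P ^ (k / P.natDegree) * lCoeff ψ α (d - k) else 0 := by
    intro P hP
    have he : 0 < P.natDegree := (mem_irreduciblesUpTo.1 hP).2.2.natDegree_pos
    rw [← Finset.sum_filter]
    simp_rw [mul_ite, mul_zero]
    rw [← Finset.sum_filter]
    refine Finset.sum_bij (fun j _ => j * P.natDegree) ?_ ?_ ?_ ?_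
    · intro j hj
      simp only [Finset.mem_filter, Finset.mem_Icc] at hj ⊢
      exact ⟨⟨by nlinarith, hj.2⟩, dvd_mul_left _ _⟩
    · intro i _ j _ h
      exact Nat.eq_of_mul_eq_mul_right he h
    · intro k hk
      simp only [Finset.mem_filter, Finset.mem_Icc] at hk
      obtain ⟨⟨hk1, hkd⟩, j, rfl⟩ := hk
      refine ⟨j, ?_, mul_comm _ _⟩
      simp only [Finset.mem_filter, Finset.mem_Icc]
      have hj : 0 < j := Nat.pos_of_ne_zero (by rintro rfl; simp at hk1)
      refine ⟨⟨hj, by nlinarith⟩, by rwa [mul_comm]⟩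
    · intro j _
      rw [Nat.mul_div_cancel _ he]
      ring
  rw [h1, Finset.sum_congr rfl h2, Finset.sum_comm]
  refine Finset.sum_congr rfl fun k hk => ?_
  rw [Finset.mem_Icc] at hk
  rw [← Finset.sum_filter, eulerSum, Finset.sum_mul]
  refine Finset.sum_congr ?_ fun P _ => rfl
  ext P
  simp only [Finset.mem_filter, mem_irreduciblesUpTo]
  constructor
  · rintro ⟨⟨h1, h2, h3⟩, h4⟩
    exact ⟨⟨h1, Nat.le_of_dvd (by omega) h4, h3⟩, h4⟩
  · rintro ⟨⟨h1, h2, h3⟩, h4⟩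
    exact ⟨⟨h1, h2.trans hk.2, h3⟩, h4⟩

end Euler

end LFunction

section LFunctionValues

open Polynomial Module

variable {F : Type*} [Field F] [Finite F]

theorem lCoeff_zero (ψ : AddChar F ℂ) (α : F) : lCoeff ψ α 0 = 1 := by
  have : monicsOfDegree F 0 = {1} := by
    ext f
    rw [mem_monicsOfDegree, Finset.mem_singleton]
    constructor
    · rintro ⟨h1, h2⟩
      exact h1.natDegree_eq_zero.1 h2
    · rintro rfl
      exact ⟨monic_one, natDegree_one⟩
  rw [lCoeff, this, Finset.sum_singleton, rootWeight_one]

/-- In degree at least three the second coefficient of a polynomial can be varied without changing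
the last two, whence the sum of the weights vanishes. -/
theorem lCoeff_add_three {ψ : AddChar F ℂ} (hψ : ψ ≠ 1) (α : F) (d : ℕ) :
    lCoeff ψ α (d + 3) = 0 := by
  obtain ⟨t, ht⟩ : ∃ t, ψ t ≠ 1 := by
    by_contra! h
    exact hψ (by ext t; simpa using h t)
  have hmem : ∀ (c : F) (f : F[X]), f ∈ monicsOfDegree F (d + 3) →
      f + C c * X ^ (d + 2) ∈ monicsOfDegree F (d + 3) := by
    intro c f hf
    rw [mem_monicsOfDegree] at hf ⊢
    have hlt : (C c * X ^ (d + 2)).degree < f.degree := by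
      refine (degree_C_mul_X_pow_le _ _).trans_lt ?_
      rw [degree_eq_natDegree hf.1.ne_zero, hf.2]
      exact_mod_cast Nat.lt_succ_self _
    exact ⟨hf.1.add_of_left hlt, by rw [natDegree_add_eq_left_of_degree_lt hlt, hf.2]⟩
  have h : lCoeff ψ α (d + 3) = ψ t * lCoeff ψ α (d + 3) := by
    rw [lCoeff, Finset.mul_sum]
    refine Finset.sum_bij' (fun f _ => f + C t * X ^ (d + 2)) (fun f _ => f + C (-t) * X ^ (d + 2))
      (fun f hf => hmem t f hf) (fun f hf => hmem (-t) f hf) (fun f _ => by simp)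
      (fun f _ => by simp) ?_
    intro f hf
    have hf' := mem_monicsOfDegree.1 (hmem t f hf)
    rw [mem_monicsOfDegree] at hf
    have h0 : (f + C t * X ^ (d + 2)).coeff 0 = f.coeff 0 := by simp
    have h1 : (f + C t * X ^ (d + 2)).coeff 1 = f.coeff 1 := by
      simp [coeff_X_pow]
    have h2 : (f + C t * X ^ (d + 2)).nextCoeff = f.nextCoeff + t := by
      rw [nextCoeff_of_natDegree_pos (by omega), nextCoeff_of_natDegree_pos (by omega), hf'.2, hf.2]
      simp
    rw [rootWeight, rootWeight, h0, h1, h2]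
    split_ifs with h3
    · simp
    · rw [← AddChar.map_add_eq_mul]
      congr 1
      ring
  by_contra hne
  exact ht (mul_right_cancel₀ hne (by rw [← h, one_mul]))

/-- The sum over the polynomials `X ^ 2 + a X + b` with `b ≠ 0` fixed is a sum of the values of a
character of `a`, which is trivial only for `b = -α`. -/
theorem lCoeff_two {ψ : AddChar F ℂ} (hψ : ψ ≠ 1) {α : F} (hα : α ≠ 0) :
    lCoeff ψ α 2 = Nat.card F := by
  classical
  cases nonempty_fintype F
  have hdeg : ∀ x : F × F, (X ^ 2 + (C x.1 * X + C x.2)).natDegree = 2 ∧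
      (X ^ 2 + (C x.1 * X + C x.2) : F[X]).Monic := by
    intro x
    have hlt : (C x.1 * X + C x.2 : F[X]).degree < ((2 : ℕ) : WithBot ℕ) :=
      degree_linear_lt.trans_le (by norm_num)
    refine ⟨?_, monic_X_pow_add hlt⟩
    rw [natDegree_add_eq_left_of_degree_lt (by rwa [degree_X_pow]), natDegree_X_pow]
  have h1 : lCoeff ψ α 2 = ∑ x : F × F, rootWeight ψ α (X ^ 2 + (C x.1 * X + C x.2)) := by
    rw [lCoeff]
    symm
    refine Finset.sum_bij (fun x _ => X ^ 2 + (C x.1 * X + C x.2)) ?_ ?_ ?_ fun _ _ => rfl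
    · intro x _
      rw [mem_monicsOfDegree]
      exact (hdeg x).symm
    · intro x _ y _ h
      have h0 := congrArg (fun p => p.coeff 0) h
      have h1 := congrArg (fun p => p.coeff 1) h
      simp [coeff_X, coeff_C, coeff_X_pow] at h0 h1
      exact Prod.ext h1 h0
    · intro f hf
      rw [mem_monicsOfDegree] at hf
      refine ⟨(f.coeff 1, f.coeff 0), Finset.mem_univ _, ?_⟩
      have := hf.1.as_sum
      rw [hf.2, Finset.sum_range_succ, Finset.sum_range_one] at this
      conv_rhs => rw [this]
      simp [add_comm]
  have h2 : ∀ a b : F, rootWeight ψ α (X ^ 2 + (C a * X + C b)) =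
      if b = 0 then 0 else ψ (a * (-1 - α / b)) := by
    intro a b
    have h0 : (X ^ 2 + (C a * X + C b)).coeff 0 = b := by simp
    have h1 : (X ^ 2 + (C a * X + C b)).coeff 1 = a := by simp [coeff_X_pow, coeff_C]
    have h3 : (X ^ 2 + (C a * X + C b)).nextCoeff = a := by
      rw [nextCoeff_of_natDegree_pos (by rw [(hdeg (a, b)).1]; norm_num), (hdeg (a, b)).1, h1]
    rw [rootWeight, h0, h1, h3]
    congr 2
    ring
  have h3 : ∀ b : F, ∑ a : F, rootWeight ψ α (X ^ 2 + (C a * X + C b)) =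
      if b = -α then (Fintype.card F : ℂ) else 0 := by
    intro b
    simp_rw [h2]
    by_cases hb : b = 0
    · simp [hb, hα, eq_comm]
    · simp only [if_neg hb]
      by_cases hbα : b = -α
      · have : -1 - α / b = 0 := by
          rw [hbα]
          field_simp
          ring
        rw [if_pos hbα, this]
        simp
      · rw [if_neg hbα]
        have hc : -1 - α / b ≠ 0 := by
          intro h
          refine hbα ?_
          field_simp at h
          linear_combination -h
        rw [← AddChar.sum_eq_zero_of_ne_one hψ]
        exact Fintype.sum_equiv (Equiv.mulRight₀ _ hc) _ _ fun a => rfl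
  rw [h1, Fintype.sum_prod_type_right]
  simp_rw [h3]
  simp

/-- Over the extension `E` of degree `m`, the sum is the Euler sum of index `m`: the elements of
`E` are the roots of the irreducible polynomials of degree dividing `m`. -/
theorem kloostermanSum_eq_eulerSum {E : Type*} [Field E] [Algebra F E] [FiniteDimensional F E]
    (ψ : AddChar F ℂ) (α : F) :
    kloostermanSum (ψ.compAddMonoidHom (Algebra.trace F E).toAddMonoidHom) (algebraMap F E α) =
      eulerSum ψ α (finrank F E) := by
  classical
  have : Finite E := Module.finite_of_finite F
  cases nonempty_fintype E
  set m := finrank F E with hm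
  have hm0 : 0 < m := finrank_pos
  have h1 : kloostermanSum (ψ.compAddMonoidHom (Algebra.trace F E).toAddMonoidHom)
      (algebraMap F E α) =
        ∑ x : E, rootWeight ψ α (minpoly F x) ^ (m / (minpoly F x).natDegree) := by
    rw [kloostermanSum, finsum_eq_sum_of_fintype]
    have h0 : rootWeight ψ α (minpoly F (0 : E)) ^ (m / (minpoly F (0 : E)).natDegree) = 0 := by
      rw [minpoly.zero, natDegree_X, Nat.div_one, rootWeight, if_pos (by simp), zero_pow hm0.ne']
    rw [← Finset.sum_erase (a := (0 : E)) _ h0]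
    refine Finset.sum_bij (fun x _ => (x : E)) (by simp) (fun x _ y _ h => Units.ext h) ?_ ?_
    · intro x hx
      exact ⟨Units.mk0 x (Finset.ne_of_mem_erase hx), Finset.mem_univ _, rfl⟩
    · intro x _
      rw [← addChar_trace_eq_rootWeight ψ α x.ne_zero, AddChar.compAddMonoidHom_apply,
        Units.val_inv_eq_inv_val]
      rfl
  have hmaps : ∀ x ∈ (Finset.univ : Finset E), minpoly F x ∈
      (irreduciblesUpTo F m).filter (fun P => P.natDegree ∣ m) := by
    intro x _
    have hint : IsIntegral F x := Algebra.IsIntegral.isIntegral x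
    rw [Finset.mem_filter, mem_irreduciblesUpTo]
    have hdvd := minpoly.degree_dvd hint
    exact ⟨⟨minpoly.monic hint, Nat.le_of_dvd hm0 hdvd, minpoly.irreducible hint⟩, hdvd⟩
  rw [h1, ← Finset.sum_fiberwise_of_maps_to hmaps, eulerSum]
  refine Finset.sum_congr rfl fun P hP => ?_
  rw [Finset.mem_filter, mem_irreduciblesUpTo] at hP
  obtain ⟨⟨hmon, -, hirr⟩, hdvd⟩ := hP
  rw [Finset.sum_congr rfl fun x hx => show _ = rootWeight ψ α P ^ (m / P.natDegree) by
    rw [(Finset.mem_filter.1 hx).2], Finset.sum_const, nsmul_eq_mul]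
  congr 2
  have hsplit : (P.map (algebraMap F E)).Splits := by
    have hcard : Nat.card F ^ m = Fintype.card E := by
      rw [← Module.natCard_eq_pow_finrank, Nat.card_eq_fintype_card]
    have h2 := Polynomial.map_dvd (algebraMap F E)
      (hirr.natDegree_dvd_iff_dvd_X_pow_card_pow_sub_X.1 hdvd)
    rw [Polynomial.map_sub, Polynomial.map_pow, map_X, hcard] at h2
    refine Splits.of_dvd ?_ (FiniteField.X_pow_card_sub_X_ne_zero E Fintype.one_lt_card) h2
    rw [splits_iff_card_roots, FiniteField.roots_X_pow_card_sub_X,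
      FiniteField.X_pow_card_sub_X_natDegree_eq E Fintype.one_lt_card]
    rfl
  rw [← card_rootSet_eq_natDegree (PerfectField.separable_of_irreducible hirr) hsplit,
    Fintype.card_subtype]
  congr 1
  ext x
  simp only [Finset.mem_filter, Finset.mem_univ, true_and]
  rw [mem_rootSet]
  constructor
  · rintro rfl
    exact ⟨hmon.ne_zero, minpoly.aeval F x⟩
  · rintro ⟨-, h⟩
    exact (minpoly.eq_of_irreducible_of_monic hirr h hmon).symm

/-- The Kloosterman sums over the extensions of `F` are the negatives of the power sums of the two
roots of `X ^ 2 + K X + q`, where `K` is the sum over `F`. -/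
theorem eulerSum_eq_neg_powerSum {ψ : AddChar F ℂ} (hψ : ψ ≠ 1) {α : F} (hα : α ≠ 0) :
    ∃ u v : ℂ, u * v = Nat.card F ∧ ∀ m, 0 < m → eulerSum ψ α m = -(u ^ m + v ^ m) := by
  set K := eulerSum ψ α 1 with hK
  obtain ⟨u, hu⟩ : ∃ u : ℂ, u ^ 2 + K * u + Nat.card F = 0 := by
    have := IsAlgClosed.exists_root (C 1 * X ^ 2 + C K * X + C (Nat.card F : ℂ) : ℂ[X]) (by
      rw [degree_quadratic one_ne_zero]; norm_num)
    obtain ⟨u, hu⟩ := this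
    exact ⟨u, by simpa using hu⟩
  have h1 := natCast_mul_lCoeff ψ α 1
  have h2 := natCast_mul_lCoeff ψ α 2
  have hI2 : Finset.Icc 1 2 = {1, 2} := rfl
  simp only [Finset.Icc_self, Finset.sum_singleton, Nat.sub_self, lCoeff_zero, mul_one,
    Nat.cast_one, one_mul] at h1
  rw [hI2, Finset.sum_pair (by norm_num), Nat.sub_self, show 2 - 1 = 1 from rfl, lCoeff_zero,
    lCoeff_two hψ hα, h1] at h2
  push_cast at h2
  refine ⟨u, -K - u, by linear_combination -hu, fun m hm => ?_⟩
  induction m using Nat.strong_induction_on with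
  | _ m ih =>
  -- Newton's identities for the `L`-function `1 + K T + q T ^ 2 = (1 - u T) (1 - v T)`
  match m with
  | 1 => ring
  | 2 => linear_combination -h2 + 2 * hu
  | m + 3 =>
    have h3 := natCast_mul_lCoeff ψ α (m + 3)
    rw [lCoeff_add_three hψ, mul_zero, Finset.sum_Icc_succ_top (by omega),
      Finset.sum_Icc_succ_top (by omega), Finset.sum_Icc_succ_top (by omega), Nat.sub_self,
      lCoeff_zero, show m + 3 - (m + 2) = 1 by omega, h1, show m + 3 - (m + 1) = 2 by omega,
      lCoeff_two hψ hα, Finset.sum_eq_zero, zero_add, ih (m + 1) (by omega) (by omega),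
      ih (m + 2) (by omega) (by omega)] at h3
    · have h4 : u * (-K - u) = Nat.card F := by linear_combination -hu
      rw [← h4] at h3
      linear_combination -h3
    · intro k hk
      rw [Finset.mem_Icc] at hk
      obtain ⟨d, hd⟩ := Nat.exists_eq_add_of_le' (show 3 ≤ m + 3 - k by omega)
      rw [hd, lCoeff_add_three hψ, mul_zero]

end LFunctionValues

/-! ### Pole orders on the Artin-Schreier curve `y ^ q - y = x + α / x - c` -/

section ArtinSchreierCurve

open Polynomial Module

variable {E : Type*} [Field E]

/-- The polynomial in `W` over `E[x]` which defines the curve `y ^ q - y = x + α / x - c` in the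
coordinates `x` and `W = x y`. -/
noncomputable def curvePolynomial (q : ℕ) (α c : E) : E[X][X] :=
  X ^ q - (C (X ^ (q - 1)) * X + C (X ^ (q - 1) * (X ^ 2 - C c * X + C α)))

/-- The substitution of `τ ^ q` for `x` and of `τ ^ (q + 1)` for `W`; the exponents are the pole
orders of `x` and `W` at the infinite point of the curve. -/
noncomputable def weightEval (E : Type*) [Field E] (q : ℕ) : E[X][X] →+* E[X] :=
  eval₂RingHom (expand E q).toRingHom (X ^ (q + 1))

theorem weightEval_C (q : ℕ) (f : E[X]) : weightEval E q (C f) = expand E q f := by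
  simp [weightEval]

theorem weightEval_X (q : ℕ) : weightEval E q X = X ^ (q + 1) := by
  simp [weightEval]

variable {q : ℕ} (α c : E)

theorem curvePolynomial_degree_lower (hq : 1 < q) :
    degree (C (X ^ (q - 1)) * X + C (X ^ (q - 1) * (X ^ 2 - C c * X + C α)) : E[X][X]) < q := by
  refine lt_of_le_of_lt (degree_linear_le) ?_
  exact_mod_cast hq

theorem curvePolynomial_monic (hq : 1 < q) : (curvePolynomial q α c).Monic :=
  monic_X_pow_sub (curvePolynomial_degree_lower α c hq)

theorem curvePolynomial_degree (hq : 1 < q) : (curvePolynomial q α c).degree = q := by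
  rw [curvePolynomial, degree_sub_eq_left_of_degree_lt, degree_X_pow]
  rw [degree_X_pow]
  exact curvePolynomial_degree_lower α c hq

theorem natDegree_weightEval_curvePolynomial_le (hq : 1 < q) :
    (weightEval E q (curvePolynomial q α c)).natDegree ≤ q ^ 2 + 1 := by
  obtain ⟨d, rfl⟩ : ∃ d, q = d + 1 := ⟨q - 1, by omega⟩
  have h : weightEval E (d + 1) (curvePolynomial (d + 1) α c) =
      -X ^ ((d + 1) ^ 2 + 1) + C c * X ^ ((d + 1) ^ 2) - C α * X ^ ((d + 1) * d) := by
    simp only [curvePolynomial, map_sub, map_add, map_mul, map_pow, weightEval_C, weightEval_X,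
      expand_X, expand_C, Nat.add_sub_cancel]
    ring
  rw [h]
  have : (d + 1) * d ≤ (d + 1) ^ 2 + 1 := by nlinarith
  compute_degree
  all_goals omega

/-- The terms of `weightEval r` coming from different powers of `W` have degrees which are distinct
modulo `q`, so that there is no cancellation of leading terms. -/
theorem degree_le_degree_weightEval (hq : 1 < q) {r : E[X][X]} (hr : r.degree < q) {j : ℕ}
    (hj : r.coeff j ≠ 0) :
    ((q * (r.coeff j).natDegree + (q + 1) * j : ℕ) : WithBot ℕ) ≤ (weightEval E q r).degree := by
  have hterm : ∀ j, r.coeff j ≠ 0 → (expand E q (r.coeff j) * X ^ ((q + 1) * j)).degree =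
      ((q * (r.coeff j).natDegree + (q + 1) * j : ℕ) : WithBot ℕ) := by
    intro j hj
    have h0 : expand E q (r.coeff j) ≠ 0 := (expand_ne_zero (by omega)).2 hj
    rw [degree_mul, degree_X_pow, degree_eq_natDegree h0, natDegree_expand]
    push_cast
    ring
  have hsum : weightEval E q r =
      ∑ j ∈ Finset.range q, expand E q (r.coeff j) * X ^ ((q + 1) * j) := by
    conv_lhs => rw [r.as_sum_range' q (by
      by_cases h0 : r = 0
      · simp [h0]; omega
      · exact (natDegree_lt_iff_degree_lt h0).2 hr)]
    rw [map_sum]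
    refine Finset.sum_congr rfl fun j _ => ?_
    rw [← C_mul_X_pow_eq_monomial, map_mul, map_pow, weightEval_C, weightEval_X, pow_mul]
  have hjq : j < q := by
    by_contra! h
    exact hj (coeff_eq_zero_of_degree_lt (hr.trans_le (by exact_mod_cast h)))
  rw [hsum, degree_sum_eq_of_disjoint, ← hterm j hj]
  · exact Finset.le_sup (f := fun j => (expand E q (r.coeff j) * X ^ ((q + 1) * j)).degree)
      (Finset.mem_range.2 hjq)
  · rintro a ⟨ha, ha0⟩ b ⟨hb, hb0⟩ hab h
    have ha0 : r.coeff a ≠ 0 := fun h => ha0 (by simp [h])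
    have hb0 : r.coeff b ≠ 0 := fun h => hb0 (by simp [h])
    simp only [Function.comp_apply, hterm a ha0, hterm b hb0, Nat.cast_inj] at h
    have h2 := congrArg (· % q) h
    have e : ∀ m a, q * m + (q + 1) * a = a + q * (m + a) := by intros; ring
    simp only [e, Nat.add_mul_mod_self_left] at h2
    rw [Finset.mem_range] at ha hb
    rw [Nat.mod_eq_of_lt ha, Nat.mod_eq_of_lt hb] at h2
    exact hab h2

/-- The reduction of a polynomial modulo the equation of the curve, with `τ ^ q` and `τ ^ (q + 1)`
substituted for the variables. Its degree is the pole order at infinity of the function which the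
polynomial defines on the curve. -/
noncomputable def poleMap (q : ℕ) (α c : E) : E[X][X] →ₗ[E] E[X] where
  toFun g := weightEval E q (g %ₘ curvePolynomial q α c)
  map_add' f g := by rw [add_modByMonic, map_add]
  map_smul' a g := by
    rw [← algebraMap_smul E[X] a g, smul_modByMonic, smul_eq_C_mul, map_mul, weightEval_C]
    simp [smul_eq_C_mul]

theorem poleMap_apply (g : E[X][X]) :
    poleMap q α c g = weightEval E q (g %ₘ curvePolynomial q α c) := rfl

theorem degree_modByMonic_curvePolynomial_lt (hq : 1 < q) (g : E[X][X]) :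
    (g %ₘ curvePolynomial q α c).degree < q := by
  have := degree_modByMonic_lt g (curvePolynomial_monic α c hq)
  rwa [curvePolynomial_degree α c hq] at this

theorem modByMonic_eq_zero_of_poleMap_eq_zero (hq : 1 < q) {g : E[X][X]}
    (h : poleMap q α c g = 0) : g %ₘ curvePolynomial q α c = 0 := by
  by_contra h0
  obtain ⟨j, hj⟩ : ∃ j, (g %ₘ curvePolynomial q α c).coeff j ≠ 0 := by
    by_contra! h1
    exact h0 (by ext1 j; simpa using h1 j)
  have := degree_le_degree_weightEval hq (degree_modByMonic_curvePolynomial_lt α c hq g) hj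
  rw [← poleMap_apply, h, degree_zero] at this
  exact WithBot.coe_ne_bot (le_bot_iff.1 this)

theorem poleMap_C_C_mul (a : E) (g : E[X][X]) :
    poleMap q α c (C (C a) * g) = a • poleMap q α c g := by
  rw [← map_smul, ← algebraMap_smul E[X] a g, smul_eq_C_mul, algebraMap_eq]

theorem poleMap_C_X_mul (g : E[X][X]) :
    poleMap q α c (C X * g) = X ^ q * poleMap q α c g := by
  rw [poleMap_apply, poleMap_apply, ← smul_eq_C_mul, smul_modByMonic, smul_eq_C_mul, map_mul,
    weightEval_C, expand_X]

/-- As the equation of the curve is monic of degree `q` in `W`, multiplication of a remainder by `W`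
requires at most one step of the division algorithm. -/
theorem X_mul_modByMonic (hq : 1 < q) (g : E[X][X]) :
    (X * g) %ₘ curvePolynomial q α c = X * (g %ₘ curvePolynomial q α c) -
      C ((g %ₘ curvePolynomial q α c).coeff (q - 1)) * curvePolynomial q α c := by
  have hP := curvePolynomial_monic α c hq
  have hdeg := curvePolynomial_degree α c hq
  have hr := degree_modByMonic_curvePolynomial_lt α c hq g
  set P := curvePolynomial q α c
  set r := g %ₘ P with hrdef
  refine (div_modByMonic_unique (X * (g /ₘ P) + C (r.coeff (q - 1))) _ hP ⟨?_, ?_⟩).2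
  · have := modByMonic_add_div g P
    rw [← hrdef] at this
    linear_combination X * this
  · rw [hdeg, degree_lt_iff_coeff_zero]
    intro n hn
    obtain ⟨d, rfl⟩ : ∃ d, q = d + 1 := ⟨q - 1, by omega⟩
    have hPn : P.natDegree = d + 1 := natDegree_eq_of_degree_eq_some hdeg
    obtain ⟨e, rfl⟩ : ∃ e, n = e + 1 := ⟨n - 1, by omega⟩
    rw [coeff_sub, coeff_X_mul, coeff_C_mul, Nat.add_sub_cancel]
    rcases (show d ≤ e by omega).eq_or_lt with rfl | h
    · have : P.coeff (d + 1) = 1 := by rw [← hPn]; exact hP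
      rw [this, mul_one, sub_self]
    · rw [coeff_eq_zero_of_degree_lt (hr.trans_le (by exact_mod_cast h)),
        coeff_eq_zero_of_natDegree_lt (by omega : P.natDegree < e + 1), mul_zero, sub_zero]

/-- Multiplication by `W` raises the pole order by `q + 1`: the correction from the division
algorithm has smaller degree. -/
theorem poleMap_X_mul_monic (hq : 1 < q) {g : E[X][X]} {d : ℕ}
    (hm : (poleMap q α c g).Monic) (hd : (poleMap q α c g).natDegree = d) :
    (poleMap q α c (X * g)).Monic ∧ (poleMap q α c (X * g)).natDegree = d + (q + 1) := by
  have h : poleMap q α c (X * g) = X ^ (q + 1) * poleMap q α c g -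
      expand E q ((g %ₘ curvePolynomial q α c).coeff (q - 1)) *
        weightEval E q (curvePolynomial q α c) := by
    rw [poleMap_apply, X_mul_modByMonic α c hq, map_sub, map_mul, map_mul, weightEval_C,
      weightEval_X, ← poleMap_apply]
  have hmm : (X ^ (q + 1) * poleMap q α c g).Monic := (monic_X_pow _).mul hm
  have hdd : (X ^ (q + 1) * poleMap q α c g).natDegree = d + (q + 1) := by
    rw [(monic_X_pow _).natDegree_mul hm, natDegree_X_pow, hd, add_comm]
  have hlt : (expand E q ((g %ₘ curvePolynomial q α c).coeff (q - 1)) *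
      weightEval E q (curvePolynomial q α c)).degree < (X ^ (q + 1) * poleMap q α c g).degree := by
    rw [degree_eq_natDegree hmm.ne_zero, hdd]
    by_cases h0 : (g %ₘ curvePolynomial q α c).coeff (q - 1) = 0
    · rw [h0, map_zero, zero_mul, degree_zero]
      exact WithBot.bot_lt_coe _
    · refine lt_of_le_of_lt degree_le_natDegree ?_
      have h1 := degree_le_degree_weightEval hq
        (degree_modByMonic_curvePolynomial_lt α c hq g) h0
      rw [← poleMap_apply, degree_eq_natDegree hm.ne_zero, hd, Nat.cast_le] at h1
      have h2 := natDegree_weightEval_curvePolynomial_le α c hq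
      have h3 := natDegree_mul_le
        (p := expand E q ((g %ₘ curvePolynomial q α c).coeff (q - 1)))
        (q := weightEval E q (curvePolynomial q α c))
      rw [natDegree_expand] at h3
      have h4 : (q + 1) * (q - 1) + 1 = q ^ 2 := by
        obtain ⟨e, rfl⟩ : ∃ e, q = e + 1 := ⟨q - 1, by omega⟩
        rw [Nat.add_sub_cancel]; ring
      rw [mul_comm q] at h1
      exact_mod_cast (show _ < d + (q + 1) by omega)
  rw [h]
  exact ⟨hmm.sub_of_left hlt,
    (natDegree_eq_of_degree_eq (degree_sub_eq_left_of_degree_lt hlt)).trans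
    hdd⟩

/-- The pole order of `x ^ i W ^ j` is `q i + (q + 1) j`. -/
theorem poleMap_monomial (hq : 1 < q) (i j : ℕ) :
    (poleMap q α c (C X ^ i * X ^ j)).Monic ∧
      (poleMap q α c (C X ^ i * X ^ j)).natDegree = q * i + (q + 1) * j := by
  induction i with
  | zero =>
    rw [pow_zero, one_mul]
    induction j with
    | zero =>
      have h1 : poleMap q α c 1 = 1 := by
        rw [poleMap_apply, (modByMonic_eq_self_iff (curvePolynomial_monic α c hq)).2, map_one]
        rw [degree_one, curvePolynomial_degree α c hq]
        exact_mod_cast (by omega : 0 < q)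
      rw [pow_zero, h1]
      simp
    | succ j ih =>
      rw [pow_succ']
      have := poleMap_X_mul_monic α c hq ih.1 ih.2
      exact ⟨this.1, this.2.trans (by ring)⟩
  | succ i ih =>
    rw [pow_succ', mul_assoc, poleMap_C_X_mul]
    refine ⟨(monic_X_pow _).mul ih.1, ?_⟩
    rw [(monic_X_pow _).natDegree_mul ih.1, natDegree_X_pow, ih.2]
    ring

end ArtinSchreierCurve

/-! ### The auxiliary function in Stepanov's method -/

section AuxiliaryFunction

open Polynomial Module

variable {E : Type*} [Field E]

/-- The monomial `x ^ i W ^ j`. -/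
noncomputable def curveMonomial (E : Type*) [Field E] (a : ℕ × ℕ) : E[X][X] := C X ^ a.1 * X ^ a.2

/-- The pole order at infinity of the monomial `x ^ i W ^ j`. -/
def poleOrder (q : ℕ) (a : ℕ × ℕ) : ℕ := q * a.1 + (q + 1) * a.2

theorem curveMonomial_pow_mul (s : ℕ) (a b : ℕ × ℕ) :
    curveMonomial E a ^ s * curveMonomial E b = curveMonomial E (s • a + b) := by
  simp only [curveMonomial, Prod.fst_add, Prod.snd_add, Prod.smul_fst, Prod.smul_snd, smul_eq_mul]
  ring

theorem poleOrder_smul_add (q s : ℕ) (a b : ℕ × ℕ) :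
    poleOrder q (s • a + b) = s * poleOrder q a + poleOrder q b := by
  simp only [poleOrder, Prod.fst_add, Prod.snd_add, Prod.smul_fst, Prod.smul_snd, smul_eq_mul]
  ring

theorem eq_of_poleOrder_eq {q : ℕ} {a b : ℕ × ℕ} (ha : a.2 < q) (hb : b.2 < q)
    (h : poleOrder q a = poleOrder q b) : a = b := by
  have e : ∀ a : ℕ × ℕ, poleOrder q a = a.2 + q * (a.1 + a.2) := by
    intro a
    rw [poleOrder]; ring
  rw [e, e] at h
  have h2 := congrArg (· % q) h
  simp only [Nat.add_mul_mod_self_left] at h2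
  rw [Nat.mod_eq_of_lt ha, Nat.mod_eq_of_lt hb] at h2
  rw [h2] at h
  have h3 := Nat.eq_of_mul_eq_mul_left (by omega) (Nat.add_left_cancel h)
  exact Prod.ext (by omega) h2

/-- Too many polynomials of bounded degree are linearly dependent. -/
theorem exists_sum_smul_eq_zero_of_card {ι : Type*} [Fintype ι] (f : ι → E[X]) (D : ℕ)
    (hf : ∀ i, (f i).degree < D) (hD : D < Fintype.card ι) :
    ∃ μ : ι → E, ∑ i, μ i • f i = 0 ∧ ∃ i, μ i ≠ 0 := by
  rw [← Fintype.not_linearIndependent_iff]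
  intro h
  have h1 : LinearIndependent E (fun i => (⟨f i, mem_degreeLT.2 (hf i)⟩ : degreeLT E D)) :=
    LinearIndependent.of_comp (degreeLT E D).subtype h
  have : Module.Finite E (degreeLT E D) := Module.Finite.equiv (degreeLTEquiv E D).symm
  have h2 := h1.fintype_card_le_finrank
  rw [(degreeLTEquiv E D).finrank_eq, finrank_fin_fun] at h2
  omega

/-- The auxiliary function of Bombieri's version of Stepanov's method. With `s ^ 2` the size of the
field, a nontrivial relation `∑ μ u ^ s v = 0` between functions `u` and `v` of small pole order
gives the function `∑ μ ^ s u v ^ s`, whose `s`-th power has the same values on the rational points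
as the left hand side of the relation. It vanishes at all of these points, and it is not zero
because its terms have different pole orders. -/
theorem exists_auxiliary_polynomial {p e q k : ℕ} [Fact p.Prime] [CharP E p] (hqp : q = p ^ e)
    (hq : 1 < q) (hk : 4 ≤ k) (hE : Nat.card E = (q ^ k) ^ 2) (α c : E) :
    ∃ G : E[X][X], poleMap q α c G ≠ 0 ∧
      (poleMap q α c G).natDegree ≤ (q ^ k) ^ 2 + 2 * q ^ 2 * q ^ k ∧
      ∀ x w : E, (curvePolynomial q α c).evalEval x w = 0 → G.evalEval x w = 0 := by
  classical
  obtain ⟨l, rfl⟩ : ∃ l, k = l + 4 := ⟨k - 4, by omega⟩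
  set s := q ^ (l + 4) with hs
  have hql : 1 ≤ q ^ l := Nat.one_le_pow _ _ (by omega)
  have hq2 : 2 * q ^ 2 ≤ q ^ 3 := by rw [pow_succ' q 2]; gcongr; omega
  have hq3 : q ^ 3 ≤ q ^ (l + 3) := Nat.pow_le_pow_right (by omega) (by omega)
  have hq1 : q ≤ q ^ 2 := Nat.le_self_pow two_ne_zero q
  -- The exponents of `x` are bounded by `I = q ^ (k - 1) - q` in `u` and by `J = q ^ (k - 1) + q`
  -- in `v`. Then the pole order of `u` is less than `s`, so that those of `u` and `v` can be recovered
  -- from that of `u v ^ s`, whereas the number `s ^ 2 - q ^ 4` of pairs exceeds all pole orders of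
  -- the functions `u ^ s v`.
  obtain ⟨I, hI⟩ : ∃ I, q ^ (l + 3) = I + q := ⟨q ^ (l + 3) - q, by omega⟩
  have hsI : s = q * I + q ^ 2 := by rw [hs, pow_succ, hI]; ring
  set J := I + 2 * q with hJ
  let a : (Fin I × Fin q) × (Fin J × Fin q) → ℕ × ℕ := fun i => (i.1.1, i.1.2)
  let b : (Fin I × Fin q) × (Fin J × Fin q) → ℕ × ℕ := fun i => (i.2.1, i.2.2)
  have ha : ∀ i, poleOrder q (a i) + q + 1 ≤ s := by
    rintro ⟨⟨i, j⟩, -⟩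
    have h1 : q * (i + 1) ≤ q * I := Nat.mul_le_mul_left _ i.2
    have h2 : (q + 1) * (j + 1) ≤ (q + 1) * q := Nat.mul_le_mul_left _ j.2
    simp only [poleOrder, a]
    rw [hsI]
    nlinarith
  have hb : ∀ i, poleOrder q (b i) + q + 1 ≤ s + 2 * q ^ 2 := by
    rintro ⟨-, ⟨i, j⟩⟩
    have h1 : q * (i + 1) ≤ q * J := Nat.mul_le_mul_left _ i.2
    have h2 : (q + 1) * (j + 1) ≤ (q + 1) * q := Nat.mul_le_mul_left _ j.2
    simp only [poleOrder, b]
    rw [hsI]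
    nlinarith
  have hmonic := poleMap_monomial α c hq
  obtain ⟨μ, hμ, i₀, hi₀⟩ := exists_sum_smul_eq_zero_of_card
    (fun i => poleMap q α c (curveMonomial E (s • a i + b i))) (s * (s - q) + 2 * q ^ 2)
    (by
      intro i
      obtain ⟨h1, h2⟩ := hmonic (s • a i + b i).1 (s • a i + b i).2
      change (poleMap q α c (C X ^ (s • a i + b i).1 * X ^ (s • a i + b i).2)).degree < _
      rw [degree_eq_natDegree h1.ne_zero, h2, Nat.cast_lt]
      change poleOrder q (s • a i + b i) < _
      rw [poleOrder_smul_add]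
      have h3 : s * (poleOrder q (a i) + 1) ≤ s * (s - q) :=
        Nat.mul_le_mul_left _ (by have := ha i; omega)
      have := hb i
      nlinarith)
    (by
      rw [Fintype.card_prod, Fintype.card_prod, Fintype.card_prod, Fintype.card_fin,
        Fintype.card_fin, Fintype.card_fin]
      have h1 : s - q = q * I + q ^ 2 - q := by rw [hsI]
      obtain ⟨d, hd⟩ : ∃ d, q ^ 2 = d + q := ⟨q ^ 2 - q, by omega⟩
      have h2 : s - q = q * I + d := by omega
      have h3 : q ^ 3 ≤ I + q := by omega
      rw [h2, hsI, hJ]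
      zify at *
      have hd' : (d : ℤ) = q ^ 2 - q := by linarith
      rw [hd']
      have h4 : (q : ℤ) ^ 2 * q ^ 3 ≤ q ^ 2 * (I + q) := by gcongr
      have h5 : (2 * q ^ 2) * (q : ℤ) ^ 2 ≤ q ^ 3 * q ^ 2 := by gcongr
      have h6 : (0 : ℤ) < q := by omega
      nlinarith)
  have hterm : ∀ i, (poleMap q α c (C (C (μ i ^ s)) * curveMonomial E (s • b i + a i))) =
      μ i ^ s • poleMap q α c (curveMonomial E (s • b i + a i)) :=
    fun i => poleMap_C_C_mul α c _ _
  have hdeg : ∀ i, μ i ≠ 0 →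
      (poleMap q α c (C (C (μ i ^ s)) * curveMonomial E (s • b i + a i))).degree =
        ((s * poleOrder q (b i) + poleOrder q (a i) : ℕ) : WithBot ℕ) := by
    intro i hi
    obtain ⟨h1, h2⟩ := hmonic (s • b i + a i).1 (s • b i + a i).2
    rw [hterm, smul_eq_C_mul, degree_C_mul (pow_ne_zero _ hi)]
    change (poleMap q α c (C X ^ (s • b i + a i).1 * X ^ (s • b i + a i).2)).degree = _
    rw [degree_eq_natDegree h1.ne_zero, h2, Nat.cast_inj, ← poleOrder_smul_add]
    rfl
  have hmu : ∀ i, poleMap q α c (C (C (μ i ^ s)) * curveMonomial E (s • b i + a i)) ≠ 0 →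
      μ i ≠ 0 := by
    intro i h h0
    apply h
    rw [hterm, h0, zero_pow (by omega), zero_smul]
  have hdegG : (poleMap q α c (∑ i, C (C (μ i ^ s)) * curveMonomial E (s • b i + a i))).degree =
      Finset.univ.sup fun i =>
        (poleMap q α c (C (C (μ i ^ s)) * curveMonomial E (s • b i + a i))).degree := by
    rw [map_sum, degree_sum_eq_of_disjoint]
    rintro i ⟨-, hi⟩ j ⟨-, hj⟩ hij h
    simp only [Function.comp_apply, hdeg i (hmu i hi), hdeg j (hmu j hj), Nat.cast_inj] at h
    have hai := ha i
    have haj := ha j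
    have h1 : poleOrder q (a i) = poleOrder q (a j) := by
      have := congrArg (· % s) h
      simp only [Nat.mul_add_mod] at this
      rwa [Nat.mod_eq_of_lt (by omega), Nat.mod_eq_of_lt (by omega)] at this
    rw [h1] at h
    have h2 := Nat.eq_of_mul_eq_mul_left (by omega) (Nat.add_right_cancel h)
    have h3 := eq_of_poleOrder_eq i.1.2.2 j.1.2.2 h1
    have h4 := eq_of_poleOrder_eq i.2.2.2 j.2.2.2 h2
    simp only [a, b, Prod.mk.injEq, Fin.val_inj] at h3 h4
    exact hij (Prod.ext (Prod.ext h3.1 h3.2) (Prod.ext h4.1 h4.2))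
  refine ⟨∑ i, C (C (μ i ^ s)) * curveMonomial E (s • b i + a i), ?_, ?_, ?_⟩
  · intro h
    rw [h, degree_zero] at hdegG
    have := Finset.le_sup (f := fun i =>
        (poleMap q α c (C (C (μ i ^ s)) * curveMonomial E (s • b i + a i))).degree)
        (Finset.mem_univ i₀)
    rw [← hdegG] at this
    simp only [hdeg i₀ hi₀] at this
    exact WithBot.coe_ne_bot (le_bot_iff.1 this)
  · rw [natDegree_le_iff_degree_le, hdegG]
    refine Finset.sup_le fun i _ => ?_
    by_cases h0 : poleMap q α c (C (C (μ i ^ s)) * curveMonomial E (s • b i + a i)) = 0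
    · rw [h0, degree_zero]
      exact bot_le
    · rw [hdeg i (hmu i h0), Nat.cast_le]
      have h1 := ha i
      have h2 : s * (poleOrder q (b i) + 1) ≤ s * (s + 2 * q ^ 2) :=
        Nat.mul_le_mul_left _ (by have := hb i; omega)
      nlinarith
  · intro x w hxw
    have hfin : Finite E := Nat.finite_of_card_ne_zero (by rw [hE]; positivity)
    have hfrob : ∀ z : E, (z ^ s) ^ s = z := by
      intro z
      have := Fintype.ofFinite E
      rw [← pow_mul, ← sq, ← hE, Nat.card_eq_fintype_card, FiniteField.pow_card]
    have hrel : (∑ i, C (C (μ i)) * curveMonomial E (s • a i + b i)) %ₘ curvePolynomial q α c =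
        0 := by
      refine modByMonic_eq_zero_of_poleMap_eq_zero α c hq ?_
      rw [map_sum, ← hμ]
      refine Finset.sum_congr rfl fun i _ => ?_
      exact poleMap_C_C_mul α c _ _
    have hev : (∑ i, C (C (μ i)) * curveMonomial E (s • a i + b i)).evalEval x w = 0 := by
      have := modByMonic_add_div (∑ i, C (C (μ i)) * curveMonomial E (s • a i + b i))
        (curvePolynomial q α c)
      rw [hrel, zero_add] at this
      rw [← this, evalEval_mul, hxw, zero_mul]
    have hsp : s = p ^ (e * (l + 4)) := by rw [hs, hqp, pow_mul]
    -- the `s`-th power of the value is `∑ μ ^ (s ^ 2) u ^ s v ^ (s ^ 2) = ∑ μ u ^ s v`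
    have hpow :
        ((∑ i, C (C (μ i ^ s)) * curveMonomial E (s • b i + a i)).evalEval x w) ^ s = 0 := by
      rw [← hev]
      change (evalEvalRingHom x w _) ^ s = evalEvalRingHom x w _
      rw [map_sum, map_sum]
      conv_lhs => rw [hsp, sum_pow_char_pow, ← hsp]
      refine Finset.sum_congr rfl fun i _ => ?_
      rw [← curveMonomial_pow_mul, ← curveMonomial_pow_mul]
      simp only [map_mul, map_pow, mul_pow, hfrob]
      rw [mul_comm (evalEvalRingHom x w (curveMonomial E (b i)))]
    exact pow_eq_zero_iff (by omega) |>.1 hpow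

end AuxiliaryFunction

/-! ### The Weil bound -/

section WeilBound

open Polynomial Module

variable {F : Type*} [Field F] [Finite F] {E : Type*} [Field E] [Algebra F E]
  [FiniteDimensional F E]

/-- The additive form of Hilbert's theorem 90 for finite fields: the image of the linear map
`y ↦ y ^ q - y` is contained in the kernel of the trace, and has the same dimension. -/
theorem exists_pow_card_sub_eq_of_trace_eq_zero {z : E} (hz : Algebra.trace F E z = 0) :
    ∃ y : E, y ^ Nat.card F - y = z := by
  have := Fintype.ofFinite F
  have hEfin : Finite E := Module.finite_of_finite F
  have := Fintype.ofFinite E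
  let L : E →ₗ[F] E := (FiniteField.frobeniusAlgHom F E).toLinearMap - LinearMap.id
  have hL : ∀ y, L y = y ^ Nat.card F - y := by
    intro y
    simp [L, Nat.card_eq_fintype_card]
  have hker : finrank F (LinearMap.ker L) ≤ 1 := by
    have h1 : Nat.card (LinearMap.ker L) ≤ Nat.card F := by
      classical
      have hq : 1 < Nat.card F := Finite.one_lt_card
      have h2 := FiniteField.X_pow_card_sub_X_natDegree_eq E hq
      have h3 : (Finset.univ.filter fun y : E => y ∈ LinearMap.ker L).card ≤
          (X ^ Nat.card F - X : E[X]).natDegree := by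
        refine card_le_degree_of_subset_roots fun y hy => ?_
        rw [mem_roots (FiniteField.X_pow_card_sub_X_ne_zero E hq), IsRoot, eval_sub, eval_pow,
          eval_X, ← hL]
        exact (Finset.mem_filter.1 hy).2
      rw [h2] at h3
      rwa [Nat.card_eq_fintype_card, Fintype.card_subtype]
    rw [Module.natCard_eq_pow_finrank (K := F)] at h1
    by_contra! h2
    have := (Nat.pow_lt_pow_iff_right (Finite.one_lt_card (α := F))).2 h2
    rw [pow_one] at this
    omega
  have hle : LinearMap.range L ≤ LinearMap.ker (Algebra.trace F E) := by
    rintro _ ⟨y, rfl⟩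
    rw [LinearMap.mem_ker, LinearMap.sub_apply, map_sub, LinearMap.id_apply,
      AlgHom.toLinearMap_apply, sub_eq_zero]
    exact Algebra.trace_eq_of_algEquiv (FiniteField.frobeniusAlgEquivOfAlgebraic F E) y
  have hrange : LinearMap.range L = LinearMap.ker (Algebra.trace F E) := by
    refine Submodule.eq_of_le_of_finrank_le hle ?_
    have h1 := LinearMap.finrank_range_add_finrank_ker L
    have h2 := LinearMap.finrank_range_add_finrank_ker (Algebra.trace F E)
    rw [LinearMap.range_eq_top.2 (Algebra.trace_surjective F E), finrank_top,
      finrank_self] at h2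
    omega
  obtain ⟨y, hy⟩ : z ∈ LinearMap.range L := hrange ▸ hz
  exact ⟨y, (hL y).symm.trans hy⟩

/-- A polynomial whose values at all the points of the Artin-Schreier curve above `x₀` are zero has
zero remainder, modulo the equation of the curve, above `x₀`. -/
theorem eval_coeff_modByMonic_eq_zero {α c x₀ y₀ : E} (hx₀ : x₀ ≠ 0)
    (hy₀ : y₀ ^ Nat.card F - y₀ = x₀ + α * x₀⁻¹ - c) {G : E[X][X]}
    (hG : ∀ x w : E, (curvePolynomial (Nat.card F) α c).evalEval x w = 0 → G.evalEval x w = 0)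
    (j : ℕ) : ((G %ₘ curvePolynomial (Nat.card F) α c).coeff j).eval x₀ = 0 := by
  have := Fintype.ofFinite F
  have hq : 1 < Nat.card F := Finite.one_lt_card
  obtain ⟨d, hd⟩ : ∃ d, Nat.card F = d + 1 := ⟨Nat.card F - 1, by omega⟩
  set r := G %ₘ curvePolynomial (Nat.card F) α c with hr
  have hcurve : ∀ a : F,
      (curvePolynomial (Nat.card F) α c).evalEval x₀ (x₀ * (y₀ + algebraMap F E a)) = 0 := by
    intro a
    have h1 : (y₀ + algebraMap F E a) ^ Nat.card F =
        y₀ ^ Nat.card F + algebraMap F E a := by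
      have h2 := map_add (FiniteField.frobeniusAlgHom F E) y₀ (algebraMap F E a)
      rw [AlgHom.commutes] at h2
      simpa [Nat.card_eq_fintype_card] using h2
    have h3 : α = x₀ * (y₀ ^ Nat.card F - y₀ - x₀ + c) := by
      rw [hy₀]
      field_simp
      ring
    simp only [curvePolynomial, evalEval_sub, evalEval_add, evalEval_mul, evalEval_pow, evalEval_X,
      evalEval_C, eval_pow, eval_X, eval_mul, eval_add, eval_sub, eval_C, mul_pow, h1]
    rw [hd] at h3 ⊢
    rw [Nat.add_sub_cancel]
    linear_combination (-x₀ ^ d) * h3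
  have hroot : ∀ a : F, (r.map (evalRingHom x₀)).eval (x₀ * (y₀ + algebraMap F E a)) = 0 := by
    intro a
    rw [eval_map, eval₂_evalRingHom]
    have h1 := modByMonic_add_div G (curvePolynomial (Nat.card F) α c)
    have h2 := hG _ _ (hcurve a)
    rwa [← h1, evalEval_add, evalEval_mul, hcurve a, zero_mul, add_zero] at h2
  have hdeg : (r.map (evalRingHom x₀)).natDegree < Fintype.card F := by
    rw [← Nat.card_eq_fintype_card]
    by_cases h0 : r.map (evalRingHom x₀) = 0
    · rw [h0, natDegree_zero]; omega
    · exact (natDegree_lt_iff_degree_lt h0).2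
        (degree_map_le.trans_lt (degree_modByMonic_curvePolynomial_lt α c hq G))
  have hzero := eq_zero_of_natDegree_lt_card_of_eval_eq_zero _
    (f := fun a : F => x₀ * (y₀ + algebraMap F E a)) (fun a b h => by
      exact FaithfulSMul.algebraMap_injective F E (add_left_cancel (mul_left_cancel₀ hx₀ h)))
    hroot hdeg
  have := congrArg (fun p => p.coeff j) hzero
  simpa using this

/-- The number of solutions of `Tr (x + α / x) = c` is at most the main term of its expected size
plus an error of the order of the square root of the size of the field. -/
theorem card_mul_card_trace_eq_le [Fintype Eˣ] [DecidableEq F] {k : ℕ} (hk : 4 ≤ k)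
    (hE : finrank F E = 2 * k) (α : E) (c : F) :
    Nat.card F * (Finset.univ.filter fun x : Eˣ =>
      Algebra.trace F E (x + α * (x⁻¹ : Eˣ)) = c).card ≤
      (Nat.card F ^ k) ^ 2 + 2 * Nat.card F ^ 2 * Nat.card F ^ k := by
  have hq : 1 < Nat.card F := Finite.one_lt_card
  have := Fintype.ofFinite F
  obtain ⟨p, hp⟩ := CharP.exists F
  obtain ⟨e, hpp, hpe⟩ := FiniteField.card F p
  have : Fact p.Prime := ⟨hpp⟩
  have : CharP E p := charP_of_injective_algebraMap (FaithfulSMul.algebraMap_injective F E) p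
  have hcard : Nat.card E = (Nat.card F ^ k) ^ 2 := by
    rw [Module.natCard_eq_pow_finrank (K := F), hE, ← pow_mul, mul_comm]
  obtain ⟨c', hc'⟩ := Algebra.trace_surjective F E c
  obtain ⟨G, hG0, hGdeg, hG⟩ := exists_auxiliary_polynomial
    (Nat.card_eq_fintype_card.trans hpe) hq hk hcard α c'
  set r := G %ₘ curvePolynomial (Nat.card F) α c' with hr
  obtain ⟨j, hj⟩ : ∃ j, r.coeff j ≠ 0 := by
    by_contra! h
    apply hG0
    rw [poleMap_apply, ← hr, show r = 0 by ext1 j; simpa using h j, map_zero]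
  refine le_trans ?_ hGdeg
  have h1 := degree_le_degree_weightEval hq
    (degree_modByMonic_curvePolynomial_lt α c' hq G) hj
  rw [← poleMap_apply, degree_eq_natDegree hG0, Nat.cast_le] at h1
  refine le_trans (Nat.mul_le_mul_left _ ?_) ((Nat.le_add_right _ _).trans h1)
  rw [← Finset.card_map ⟨_, Units.val_injective⟩]
  refine card_le_degree_of_subset_roots fun x hx => ?_
  obtain ⟨x, hxS, rfl⟩ := Finset.mem_map.1 hx
  rw [Finset.mem_filter] at hxS
  obtain ⟨y, hy⟩ := exists_pow_card_sub_eq_of_trace_eq_zero (F := F)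
    (z := (x : E) + α * (x⁻¹ : Eˣ) - c') (by rw [map_sub, hxS.2, hc', sub_self])
  rw [mem_roots hj]
  rw [Units.val_inv_eq_inv_val] at hy
  exact eval_coeff_modByMonic_eq_zero x.ne_zero hy hG j

/-- Since the numbers of solutions of `Tr (x + α / x) = c`, for the different `c`, have the sum
`|Eˣ|`, upper bounds for all of them suffice to bound the Kloosterman sum. -/
theorem norm_kloostermanSum_le {k : ℕ} (hk : 4 ≤ k) (hE : finrank F E = 2 * k) {ψ : AddChar F ℂ}
    (hψ : ψ ≠ 1) (α : E) :
    ‖kloostermanSum (ψ.compAddMonoidHom (Algebra.trace F E).toAddMonoidHom) α‖ ≤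
      (2 * (Nat.card F : ℝ) ^ 2 + 1) * (Nat.card F : ℝ) ^ k := by
  classical
  have := Fintype.ofFinite F
  have hEfin : Finite E := Module.finite_of_finite F
  have := Fintype.ofFinite E
  set q := Nat.card F with hqdef
  have hq : 1 < q := Finite.one_lt_card
  let S : F → Finset Eˣ := fun c =>
    Finset.univ.filter fun x : Eˣ => Algebra.trace F E (x + α * (x⁻¹ : Eˣ)) = c
  set B : ℝ := ((q ^ k) ^ 2 + 2 * q ^ 2 * q ^ k) / q with hB
  have hq0 : (0 : ℝ) < q := by exact_mod_cast (by omega : 0 < q)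
  have hS : ∀ c, ((S c).card : ℝ) ≤ B := by
    intro c
    rw [hB, le_div_iff₀ hq0, mul_comm]
    exact_mod_cast card_mul_card_trace_eq_le hk hE α c
  have hsum : ∑ c, ((S c).card : ℝ) = (q ^ k) ^ 2 - 1 := by
    rw [← Nat.cast_sum, Finset.card_eq_sum_card_fiberwise (s := Finset.univ) (t := Finset.univ)
      (f := fun x : Eˣ => Algebra.trace F E (x + α * (x⁻¹ : Eˣ))) (by simp) |>.symm,
      Finset.card_univ, Fintype.card_units, ← Nat.card_eq_fintype_card,
      Module.natCard_eq_pow_finrank (K := F), hE, Nat.cast_sub (Nat.one_le_pow _ _ (by omega))]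
    push_cast
    rw [← pow_mul, mul_comm k]
  -- the constant `B` may be subtracted because the sum of the values of `ψ` is zero
  have hK : kloostermanSum (ψ.compAddMonoidHom (Algebra.trace F E).toAddMonoidHom) α =
      ∑ c, (((S c).card - B : ℝ) : ℂ) * ψ c := by
    rw [kloostermanSum, finsum_eq_sum_of_fintype]
    have h0 : ∑ c, ψ c = 0 := AddChar.sum_eq_zero_of_ne_one hψ
    have h1 : ∑ c, (((S c).card - B : ℝ) : ℂ) * ψ c = ∑ c, ((S c).card : ℂ) * ψ c := by
      push_cast
      simp only [sub_mul, Finset.sum_sub_distrib, ← Finset.mul_sum, h0, mul_zero, sub_zero]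
    rw [h1, ← Finset.sum_fiberwise Finset.univ
      (fun x : Eˣ => Algebra.trace F E (x + α * (x⁻¹ : Eˣ)))]
    refine Finset.sum_congr rfl fun c _ => ?_
    rw [← nsmul_eq_mul, ← Finset.sum_const]
    refine Finset.sum_congr rfl fun x hx => ?_
    rw [← (Finset.mem_filter.1 hx).2]
    rfl
  rw [hK]
  have hqk : (1 : ℝ) ≤ (q : ℝ) ^ k := one_le_pow₀ (by exact_mod_cast hq.le)
  calc ‖∑ c, (((S c).card - B : ℝ) : ℂ) * ψ c‖ ≤ ∑ c, (B - (S c).card) := by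
        refine norm_sum_le_of_le _ fun c _ => ?_
        rw [norm_mul, AddChar.norm_apply, mul_one, Complex.norm_real, Real.norm_eq_abs,
          abs_sub_comm,
          abs_of_nonneg (by have := hS c; linarith)]
    _ = q * B - ((q ^ k) ^ 2 - 1) := by
        rw [Finset.sum_sub_distrib, hsum, Finset.sum_const, Finset.card_univ, nsmul_eq_mul,
          ← Nat.card_eq_fintype_card]
    _ = 2 * q ^ 2 * q ^ k + 1 := by
        rw [hB, mul_div_cancel₀ _ hq0.ne']
        ring
    _ ≤ _ := by nlinarith

/-- If `‖u‖ ^ 2` were larger than `q`, then `u ^ (2 * k)` would grow faster than `q ^ k`, and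
`v ^ (2 * k)` could not compensate for it since `‖v‖ ^ 2 ≤ q`. -/
theorem norm_sq_le_of_norm_pow_add_pow_le {u v : ℂ} {q C : ℝ} (hq : 0 < q) (huv : u * v = q)
    (h : ∀ k, 4 ≤ k → ‖u ^ (2 * k) + v ^ (2 * k)‖ ≤ C * q ^ k) : ‖u‖ ^ 2 ≤ q := by
  by_contra! hlt
  have huv' : ‖u‖ ^ 2 * ‖v‖ ^ 2 = q ^ 2 := by
    rw [← mul_pow, ← norm_mul, huv, Complex.norm_real, Real.norm_eq_abs, sq_abs]
  have hv : ‖v‖ ^ 2 ≤ q := by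
    by_contra! h1
    nlinarith
  obtain ⟨n, hn⟩ := pow_unbounded_of_one_lt (C + 1) ((one_lt_div hq).2 hlt)
  have h1 := h (n + 4) (by omega)
  have h2 : (C + 1) * q ^ (n + 4) < (‖u‖ ^ 2) ^ (n + 4) := by
    rw [← lt_div_iff₀ (by positivity), ← div_pow]
    exact hn.trans_le (pow_le_pow_right₀ ((one_lt_div hq).2 hlt).le (by omega))
  have h3 : (‖v‖ ^ 2) ^ (n + 4) ≤ q ^ (n + 4) := by gcongr
  have h4 := norm_sub_le_norm_add (u ^ (2 * (n + 4))) (v ^ (2 * (n + 4)))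
  rw [norm_pow, norm_pow, pow_mul, pow_mul] at h4
  linarith

/-- The Weil bound in terms of the `L`-function of the Kloosterman sums: as `‖u‖ ‖v‖ = q`, the upper
bounds for both absolute values give equality. -/
theorem exists_weil_numbers {ψ : AddChar F ℂ} (hψ : ψ ≠ 1) {α : F} (hα : α ≠ 0) :
    ∃ u v : ℂ, u * v = Nat.card F ∧ ‖u‖ = √(Nat.card F) ∧ ‖v‖ = √(Nat.card F) ∧
      ∀ m, 0 < m → eulerSum ψ α m = -(u ^ m + v ^ m) := by
  obtain ⟨u, v, huv, h⟩ := eulerSum_eq_neg_powerSum hψ hα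
  have hq : (0 : ℝ) < Nat.card F := by exact_mod_cast Finite.card_pos
  have hbound : ∀ k, 4 ≤ k →
      ‖u ^ (2 * k) + v ^ (2 * k)‖ ≤ (2 * (Nat.card F : ℝ) ^ 2 + 1) * (Nat.card F : ℝ) ^ k := by
    intro k hk
    obtain ⟨E, _, hE⟩ := exists_intermediateField_finrank (F := F) (2 * k) (by omega)
    have h1 := norm_kloostermanSum_le hk hE hψ (algebraMap F E α)
    rwa [kloostermanSum_eq_eulerSum, hE, h _ (by omega), norm_neg] at h1
  have huv' : u * v = ((Nat.card F : ℝ) : ℂ) := by rw [huv]; simp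
  have hu := norm_sq_le_of_norm_pow_add_pow_le hq huv' hbound
  have hv := norm_sq_le_of_norm_pow_add_pow_le hq ((mul_comm v u).trans huv')
    (fun k hk => by rw [add_comm]; exact hbound k hk)
  have hprod : ‖u‖ ^ 2 * ‖v‖ ^ 2 = (Nat.card F : ℝ) ^ 2 := by
    rw [← mul_pow, ← norm_mul, huv', Complex.norm_real, Real.norm_eq_abs, sq_abs]
  refine ⟨u, v, huv, ?_, ?_, h⟩
  · rw [eq_comm, Real.sqrt_eq_iff_eq_sq hq.le (norm_nonneg _)]
    nlinarith
  · rw [eq_comm, Real.sqrt_eq_iff_eq_sq hq.le (norm_nonneg _)]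
    nlinarith

end WeilBound

/-! ### Matrices over extension fields -/

section RankOfMap

open Matrix

theorem Matrix.rank_map_algebraMap {F E : Type*} [Field F] [Field E] [Algebra F E] {n : Type*}
    [Fintype n] [DecidableEq n] (M : Matrix n n F) :
    (M.map (algebraMap F E)).rank = M.rank := by
  classical
  obtain ⟨L, L', D, rfl⟩ := Matrix.Pivot.exists_list_transvec_mul_diagonal_mul_list_transvec M
  set A := (L.map TransvectionStruct.toMatrix).prod with hA
  set B := (L'.map TransvectionStruct.toMatrix).prod with hB
  have hA1 : A.det = 1 := by rw [hA, TransvectionStruct.det_toMatrix_prod]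
  have hB1 : B.det = 1 := by rw [hB, TransvectionStruct.det_toMatrix_prod]
  have hmap : ∀ C : Matrix n n F, C.det = 1 → IsUnit (C.map (algebraMap F E)).det := by
    intro C hC
    rw [← RingHom.mapMatrix_apply, ← RingHom.map_det, hC, map_one]
    exact isUnit_one
  rw [Matrix.map_mul, Matrix.map_mul, rank_mul_eq_left_of_isUnit_det _ _ (hmap B hB1),
    rank_mul_eq_right_of_isUnit_det _ _ (hmap A hA1),
    rank_mul_eq_left_of_isUnit_det B _ (by rw [hB1]; exact isUnit_one),
    rank_mul_eq_right_of_isUnit_det A _ (by rw [hA1]; exact isUnit_one),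
    diagonal_map (map_zero _), rank_diagonal, rank_diagonal]
  exact Fintype.card_congr (Equiv.subtypeEquivRight fun i => by simp)

end RankOfMap

section MatrixSums

open Module Matrix

universe u

variable {F : Type u} [Field F] {n : ℕ}

/-- The matrix `a - α` is nilpotent: over the algebraic closure, the generalized eigenspace of `α`
is the whole space. -/
theorem sub_smul_one_pow_eq_zero {a : Matrix (Fin n) (Fin n) F} {α : F}
    (ha : HasUniqueEigenvalue a α) : (a - α • (1 : Matrix (Fin n) (Fin n) F)) ^ n = 0 := by
  set K := AlgebraicClosure F
  set f : End K (Fin n → K) := Matrix.toLin' (a.map (algebraMap F K)) with hf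
  have htop : f.maxGenEigenspace (algebraMap F K α) = ⊤ := by
    rw [eq_top_iff, ← End.iSup_maxGenEigenspace_eq_top f]
    refine iSup_le fun β => ?_
    by_cases hβ : β = algebraMap F K α
    · rw [hβ]
    · have h1 : ¬ f.HasEigenvalue β := fun h => hβ ((ha β).1 h)
      have h2 : f.maxGenEigenspace β = ⊥ := by
        by_contra h3
        exact h1 (End.HasUnifEigenvalue.lt (k := ⊤) zero_lt_one h3)
      rw [h2]
      exact bot_le
  rw [End.maxGenEigenspace_eq_genEigenspace_finrank, finrank_fin_fun] at htop
  have hzero : (f - algebraMap F K α • (1 : End K (Fin n → K))) ^ n = 0 := by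
    refine LinearMap.ext fun v => ?_
    have : v ∈ f.genEigenspace (algebraMap F K α) n := htop ▸ Submodule.mem_top
    rw [End.mem_genEigenspace_nat] at this
    simpa using this
  have hmat : f - algebraMap F K α • (1 : End K (Fin n → K)) =
      Matrix.toLinAlgEquiv' ((a - α • (1 : Matrix (Fin n) (Fin n) F)).map (algebraMap F K)) := by
    have : (a - α • (1 : Matrix (Fin n) (Fin n) F)).map (algebraMap F K) =
        a.map (algebraMap F K) - algebraMap F K α • 1 := by
      ext i j
      simp only [Matrix.map_apply, Matrix.sub_apply, Matrix.smul_apply, Matrix.one_apply,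
        smul_eq_mul, map_sub]
      split_ifs <;> simp
    rw [this, map_sub, map_smul, map_one]
    rfl
  rw [hmat, ← map_pow, ← Matrix.map_pow, EmbeddingLike.map_eq_zero_iff] at hzero
  ext i j
  have := congrFun (congrFun hzero i) j
  simpa using this

theorem hasRanks_toLin'_map {E : Type*} [Field E] [Algebra F E] (M : Matrix (Fin n) (Fin n) F) :
    HasRanks (Matrix.toLin' (M.map (algebraMap F E))) fun j => (M ^ j).rank := by
  intro j
  rw [← Matrix.toLin'_pow, ← Matrix.map_pow]
  exact Matrix.rank_map_algebraMap (E := E) (M ^ j)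

theorem muPart_one (a : Matrix (Fin n) (Fin n) F) (α : F) :
    muPart a α 1 = n - (a - α • (1 : Matrix (Fin n) (Fin n) F)).rank := by
  have h1 : (kerFiltration a α (1 - 1)).submoduleOf (kerFiltration a α 1) = ⊥ := by
    rw [Nat.sub_self]
    change Submodule.comap _ (LinearMap.ker LinearMap.id) = ⊥
    rw [LinearMap.ker_id, Submodule.comap_bot, Submodule.ker_subtype]
  have h2 : Matrix.toLin' a - α • (1 : End F (Fin n → F)) =
      Matrix.toLin' (a - α • (1 : Matrix (Fin n) (Fin n) F)) := by
    rw [map_sub, map_smul, Matrix.toLin'_one]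
    rfl
  have h3 : (a - α • (1 : Matrix (Fin n) (Fin n) F)).rank + finrank F (LinearMap.ker
      (Matrix.toLin' (a - α • (1 : Matrix (Fin n) (Fin n) F)))) = n :=
    (LinearMap.finrank_range_add_finrank_ker _).trans (finrank_fin_fun F)
  rw [muPart, h1, (Submodule.quotEquivOfEqBot _ rfl).finrank_eq, kerFiltration, pow_one, h2]
  omega

/-- The sums over matrices in terms of sums over automorphisms; the substitution is `y = x⁻¹`. -/
theorem matrixKloostermanSum_eq_glSum (ψ : AddChar F ℂ) (a : Matrix (Fin n) (Fin n) F) (α : F)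
    (E : Type*) [Field E] [Algebra F E] :
    matrixKloostermanSum ψ a E =
      glSum (ψ.compAddMonoidHom (Algebra.trace F E).toAddMonoidHom)
        (algebraMap F E α • (1 : End E (Fin n → E)) + Matrix.toLin'
          ((a - α • (1 : Matrix (Fin n) (Fin n) F)).map (algebraMap F E))) := by
  have hmat : algebraMap F E α • (1 : End E (Fin n → E)) + Matrix.toLin'
      ((a - α • (1 : Matrix (Fin n) (Fin n) F)).map (algebraMap F E)) =
        Matrix.toLin' (a.map (algebraMap F E)) := by
    have : a.map (algebraMap F E) = algebraMap F E α • 1 +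
        (a - α • (1 : Matrix (Fin n) (Fin n) F)).map (algebraMap F E) := by
      ext i j
      simp only [Matrix.map_apply, Matrix.sub_apply, Matrix.add_apply, Matrix.smul_apply,
        Matrix.one_apply, smul_eq_mul, map_sub]
      split_ifs <;> simp
    rw [this, map_add, map_smul, Matrix.toLin'_one]
    rfl
  rw [hmat, glSum, matrixKloostermanSum]
  refine finsum_eq_of_bijective
    (fun x : GL (Fin n) E => (LinearMap.GeneralLinearGroup.generalLinearEquiv E (Fin n → E)
      (Matrix.GeneralLinearGroup.toLin x)).symm) ?_ ?_
  · exact ((((Matrix.GeneralLinearGroup.toLin (n := Fin n) (R := E)).trans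
      (LinearMap.GeneralLinearGroup.generalLinearEquiv E (Fin n → E))).toEquiv.trans
      (Equiv.inv ((Fin n → E) ≃ₗ[E] (Fin n → E))))).bijective
  · intro x
    change ψ _ = ψ (Algebra.trace F E _)
    congr 2
    rw [Matrix.trace_add, add_comm]
    refine congrArg₂ _ ?_ ?_
    · exact (Matrix.trace_toLin'_eq _).symm
    · rw [Matrix.trace_mul_comm]
      exact (Matrix.trace_toLin'_eq _).symm.trans (by rw [Matrix.toLin'_mul]; rfl)
end MatrixSums

/-! ### Frobenius eigenvalues of two weights -/

section FrobeniusEigenvalues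

open Module Matrix Polynomial

universe u

variable {F : Type u} [Field F] {n : ℕ}

theorem hasWeight_of_norm_eq {q : ℕ} {z : ℂ} {w : ℕ} (h : ‖z‖ = √q ^ w) : HasWeight q z w := by
  rw [HasWeight, h, Real.sqrt_eq_rpow, ← Real.rpow_natCast, ← Real.rpow_mul q.cast_nonneg]
  congr 1
  ring

theorem add_two_mul_choose_two (n : ℕ) : n + 2 * n.choose 2 = n ^ 2 := by
  induction n with
  | zero => rfl
  | succ n ih =>
    rw [Nat.choose_succ_succ' n 1, Nat.choose_one_right]
    nlinarith

theorem compAddMonoidHom_trace_ne_one [Finite F] {E : Type*} [Field E] [Algebra F E]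
    [FiniteDimensional F E] {ψ : AddChar F ℂ} (hψ : ψ ≠ 1) :
    ψ.compAddMonoidHom (Algebra.trace F E).toAddMonoidHom ≠ 1 := by
  intro h
  apply hψ
  ext x
  obtain ⟨y, rfl⟩ := Algebra.trace_surjective F E x
  exact DFunLike.congr_fun h y

/-- For a nontrivial character the eigenvalues are the elements of the support of the group ring
element from `exists_computesGLSum`, multiplied by `q ^ n.choose 2`; as
`n + 2 * n.choose 2 = n ^ 2`, the two lowest weights are `n ^ 2` and `n ^ 2 + 2`. -/
theorem exists_frobeniusEigenvalues_of_ne_one [Finite F] {ψ : AddChar F ℂ} (hψ : ψ ≠ 1)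
    (a : Matrix (Fin n) (Fin n) F) {α : F} (hα : α ≠ 0) (ha : HasUniqueEigenvalue a α)
    (hμ : 1 < muPart a α 1) :
    ∃ z₁ z₂ : ℂ, IsFrobeniusEigenvalue ψ a z₁ ∧ IsFrobeniusEigenvalue ψ a z₂ ∧
      HasWeight (Nat.card F) z₁ (n ^ 2) ∧ HasWeight (Nat.card F) z₂ (n ^ 2 + 2) := by
  obtain ⟨u, v, huv, hu, hv, hsum⟩ := exists_weil_numbers hψ hα
  set s : ℝ := √(Nat.card F) with hs
  have hq : (1 : ℝ) < Nat.card F := by exact_mod_cast Finite.one_lt_card (α := F)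
  have hs1 : 1 < s := by rw [hs, Real.lt_sqrt zero_le_one]; simpa using hq
  have hs2 : s ^ 2 = Nat.card F := Real.sq_sqrt (by positivity)
  have hu0 : u ≠ 0 := by rw [← norm_pos_iff, hu]; linarith
  have hv0 : v ≠ 0 := by rw [← norm_pos_iff, hv]; linarith
  lift u to ℂˣ using hu0.isUnit
  lift v to ℂˣ using hv0.isUnit
  have ht : (((u * v : ℂˣ) : ℂ)) = Nat.card F := by rw [← huv]; rfl
  have htn : ‖((u * v : ℂˣ) : ℂ)‖ = s ^ 2 := by rw [ht, hs2]; simp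
  set M := a - α • (1 : Matrix (Fin n) (Fin n) F) with hM
  have hr0 : (M ^ 0).rank = n := by rw [pow_zero, Matrix.rank_one, Fintype.card_fin]
  rw [muPart_one, ← hM] at hμ
  obtain ⟨H, hH, hcomp⟩ := exists_computesGLSum.{u} hu hv rfl htn n (fun j => (M ^ j).rank) hr0
    ⟨n, by rw [hM, sub_smul_one_pow_eq_zero ha, Matrix.rank_zero]⟩
  simp only [hr0, pow_one] at hH
  rw [if_pos (by omega)] at hH
  obtain ⟨z₁, z₂, hz₁, hz₂, hn₁, hn₂⟩ := exists_coeff_ne_zero hs1 hu hv htn (by omega) hH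
  set f : ℂˣ → ℂ := fun z => ((z * (u * v) ^ n.choose 2 : ℂˣ) : ℂ) with hf
  have hfinj : Function.Injective f := fun x y h => mul_right_cancel (Units.ext h)
  set c : ℂ →₀ ℤ := ((-1 : ℤ) ^ n • H.coeff).mapDomain f with hc
  have hcz : ∀ z, H.coeff z ≠ 0 → c (f z) ≠ 0 := by
    intro z hz
    rw [hc, Finsupp.mapDomain_apply hfinj, Finsupp.smul_apply, smul_eq_mul]
    exact mul_ne_zero (pow_ne_zero _ (by norm_num)) hz
  have hdiv : IsFrobeniusDivisor ψ a c := by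
    refine ⟨Finsupp.mapDomain_of_notMem_range _ _ ?_, fun E _ => ?_⟩
    · rintro ⟨z, hz⟩
      exact Units.ne_zero _ hz
    have hEfin : Finite E := Module.finite_of_finite F
    have hα' : algebraMap F E α ≠ 0 := by simpa using hα
    rw [matrixKloostermanSum_eq_glSum ψ a α E,
      hcomp E _ (algebraMap F E α) (finrank F E) (compAddMonoidHom_trace_ne_one hψ) hα' ?_ ?_
        (Fin n → E) _ (hasRanks_toLin'_map M), powerSumEval_apply, hc,
      Finsupp.sum_mapDomain_index (by simp) (by intros; push_cast; ring),
      Finsupp.sum_smul_index (by simp), Finsupp.sum, Finsupp.sum, Finset.mul_sum]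
    · refine Finset.sum_congr rfl fun z _ => ?_
      simp only [hr0, hf]
      push_cast
      ring
    · rw [ht, Module.natCard_eq_pow_finrank (K := F)]
      push_cast
      rfl
    · rw [kloostermanSum_eq_eulerSum, hsum _ finrank_pos]
  have hnorm : ∀ (z : ℂˣ) (k : ℕ), ‖(z : ℂ)‖ = s ^ (n + k) → ‖f z‖ = s ^ (n ^ 2 + k) := by
    intro z k hz
    rw [hf, ← add_two_mul_choose_two n]
    simp only [Units.val_mul, Units.val_pow_eq_pow_val, norm_mul, norm_pow] at htn ⊢
    rw [hz, htn]
    ring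
  exact ⟨f z₁, f z₂, ⟨c, hdiv, hcz z₁ hz₁⟩, ⟨c, hdiv, hcz z₂ hz₂⟩,
    hasWeight_of_norm_eq (hnorm z₁ 0 hn₁), hasWeight_of_norm_eq (hnorm z₂ 2 hn₂)⟩

/-- The number of elements of `GL_n`, as a polynomial in the size of the field. -/
noncomputable def cardGLPolynomial (n : ℕ) : ℤ[X] := ∏ i : Fin n, (X ^ n - X ^ (i : ℕ))

theorem cardGLPolynomial_factor_monic (i : Fin n) : (X ^ n - X ^ (i : ℕ) : ℤ[X]).Monic :=
  monic_X_pow_sub (by rw [degree_X_pow]; exact_mod_cast i.2)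

theorem natDegree_cardGLPolynomial (n : ℕ) : (cardGLPolynomial n).natDegree = n ^ 2 := by
  rw [cardGLPolynomial, natDegree_prod_of_monic _ _ fun i _ => cardGLPolynomial_factor_monic i]
  have : ∀ i : Fin n, (X ^ n - X ^ (i : ℕ) : ℤ[X]).natDegree = n := fun i => by
    rw [natDegree_sub_eq_left_of_natDegree_lt, natDegree_X_pow]
    rw [natDegree_X_pow, natDegree_X_pow]
    exact i.2
  simp [this, sq]

theorem cardGLPolynomial_monic (n : ℕ) : (cardGLPolynomial n).Monic :=
  monic_prod_of_monic _ _ fun i _ => cardGLPolynomial_factor_monic i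

/-- Since `|GL_n|`, as a polynomial in the size of the field, vanishes at `1`, it is not a
monomial. -/
theorem exists_coeff_cardGLPolynomial_ne_zero (hn : 0 < n) :
    ∃ j, j ≠ n ^ 2 ∧ (cardGLPolynomial n).coeff j ≠ 0 := by
  by_contra! h
  have h1 : (cardGLPolynomial n).eval 1 = 0 := by
    rw [cardGLPolynomial, eval_prod]
    exact Finset.prod_eq_zero (Finset.mem_univ ⟨0, hn⟩) (by simp)
  have h2 : cardGLPolynomial n = X ^ (n ^ 2) := by
    ext j
    rw [coeff_X_pow]
    split_ifs with hj
    · rw [hj, ← natDegree_cardGLPolynomial n]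
      exact cardGLPolynomial_monic n
    · exact h j hj
  rw [h2] at h1
  simp at h1

/-- For the trivial character the sum is the number of elements of `GL_n`, and its eigenvalues are
powers of `q`. -/
theorem exists_frobeniusEigenvalues_one [Finite F] (hn : 0 < n) (a : Matrix (Fin n) (Fin n) F) :
    ∃ (z₁ z₂ : ℂ) (w₁ w₂ : ℕ), IsFrobeniusEigenvalue 1 a z₁ ∧ IsFrobeniusEigenvalue 1 a z₂ ∧
      HasWeight (Nat.card F) z₁ w₁ ∧ HasWeight (Nat.card F) z₂ w₂ ∧ w₁ ≠ w₂ := by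
  have hq : 1 < Nat.card F := Finite.one_lt_card
  set g : ℕ → ℂ := fun j => (Nat.card F : ℂ) ^ j with hg
  have hginj : Function.Injective g := by
    intro i j h
    have h' : Nat.card F ^ i = Nat.card F ^ j := by
      simp only [hg] at h
      exact_mod_cast h
    exact Nat.pow_right_injective hq h'
  set d : ℕ →₀ ℤ := Finsupp.onFinset (cardGLPolynomial n).support (cardGLPolynomial n).coeff
    (fun _ h => mem_support_iff.2 h) with hd
  have hcj : ∀ j, (cardGLPolynomial n).coeff j ≠ 0 → d.mapDomain g (g j) ≠ 0 := by
    intro j hj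
    rwa [Finsupp.mapDomain_apply hginj]
  have hdiv : IsFrobeniusDivisor 1 a (d.mapDomain g) := by
    refine ⟨Finsupp.mapDomain_of_notMem_range _ _ ?_, fun E _ => ?_⟩
    · rintro ⟨j, hj⟩
      exact pow_ne_zero j (by exact_mod_cast (by omega : Nat.card F ≠ 0)) hj
    have hEfin : Finite E := Module.finite_of_finite F
    have := Fintype.ofFinite E
    have h1 : matrixKloostermanSum 1 a E = Nat.card (GL (Fin n) E) := by
      simp only [matrixKloostermanSum, AddChar.one_apply]
      have := Fintype.ofFinite (GL (Fin n) E)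
      rw [finsum_eq_sum_of_fintype, Nat.card_eq_fintype_card]
      simp
    have h2 : (Nat.card (GL (Fin n) E) : ℂ) =
        (cardGLPolynomial n).eval₂ (Int.castRingHom ℂ) (Nat.card E) := by
      rw [Matrix.card_GL_field, cardGLPolynomial, eval₂_finsetProd, Nat.cast_prod]
      refine Finset.prod_congr rfl fun i _ => ?_
      rw [Nat.cast_sub (Nat.pow_le_pow_right Fintype.card_pos i.2.le), Nat.card_eq_fintype_card]
      simp
    rw [h1, h2, Finsupp.sum_mapDomain_index (by simp) (by intros; push_cast; ring), hd,
      Finsupp.onFinset_sum _ (by simp), eval₂_eq_sum, Polynomial.sum]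
    refine Finset.sum_congr rfl fun j _ => ?_
    rw [Module.natCard_eq_pow_finrank (K := F), hg, eq_intCast]
    push_cast
    ring
  have hw : ∀ j, HasWeight (Nat.card F) (g j) (2 * j) := by
    intro j
    apply hasWeight_of_norm_eq
    rw [hg, pow_mul, Real.sq_sqrt (Nat.cast_nonneg _)]
    simp
  obtain ⟨j, hj, hj0⟩ := exists_coeff_cardGLPolynomial_ne_zero hn
  refine ⟨g j, g (n ^ 2), 2 * j, 2 * n ^ 2, ⟨_, hdiv, hcj j hj0⟩, ⟨_, hdiv, hcj _ ?_⟩, hw _, hw _,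
    by omega⟩
  rw [← natDegree_cardGLPolynomial n]
  exact (cardGLPolynomial_monic n).ne_zero |> leadingCoeff_ne_zero.2

end FrobeniusEigenvalues

/-- If `α ≠ 0` is the unique eigenvalue of `a` and `μ₁ > 1`, then the matrix Kloosterman sum
attached to `a` has Frobenius eigenvalues of two different weights. -/
theorem mainTheorem8 {F : Type*} [Field F] [Finite F] (ψ : AddChar F ℂ) (n : ℕ)
    (a : Matrix (Fin n) (Fin n) F) (α : F) (hα : α ≠ 0) (ha : HasUniqueEigenvalue a α)
    (hμ : 1 < muPart a α 1) :
    ∃ (z₁ z₂ : ℂ) (w₁ w₂ : ℕ),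
      IsFrobeniusEigenvalue ψ a z₁ ∧ IsFrobeniusEigenvalue ψ a z₂ ∧
        HasWeight (Nat.card F) z₁ w₁ ∧ HasWeight (Nat.card F) z₂ w₂ ∧ w₁ ≠ w₂ := by
  rcases eq_or_ne ψ 1 with rfl | hψ
  · refine exists_frobeniusEigenvalues_one (Nat.pos_of_ne_zero ?_) a
    rintro rfl
    rw [muPart_one] at hμ
    omega
  · obtain ⟨z₁, z₂, h₁, h₂, hw₁, hw₂⟩ := exists_frobeniusEigenvalues_of_ne_one hψ a hα ha hμ
    exact ⟨z₁, z₂, n ^ 2, n ^ 2 + 2, h₁, h₂, hw₁, hw₂, by omega⟩
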